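/- Let $\operatorname{Im}\tau>0$, $\Lambda=\mathbb Z+\mathbb Z\tau$, $E=\mathbb C/\Lambda$, with Weierstrass functions $\wp,\zeta$ and quasi-periods $\eta(\omega)=\zeta(z+\omega)-\zeta(z)$. Let $p_1,\dots,p_r\in\mathbb C$ be pairwise distinct modulo $\Lambda$, let $n_1,\dots,n_r\in\frac12\mathbb Z_{>0}$, and assume that $n=\sum_i n_i$ is a positive integer. Consider the equations $w''=Qw$ with $$Q(z)=\sum_i n_i(n_i+1)\wp(z-p_i)+\sum_i A_i\zeta(z-p_i)+B .$$ *The log-free variety.* Write $Q(p_i+u)=n_i(n_i+1)u^{-2}+A_iu^{-1}+\sum_{m\ge0}q_{i,m}u^m$ and $\ell_i=2n_i$; put $c_0=1$ and $(k+1)(k-\ell_i)c_{k+1}=A_ic_k+\sum_{m<k}q_{i,m}c_{k-1-m}$ for $0\le k<\ell_i$. The log-free polynomial at $p_i$ is $F_{\ell_i}(A,B)=A_ic_{\ell_i}+\sum_{m<\ell_i}q_{i,m}c_{\ell_i-1-m}$. Let $V=V_{\mathbf n}(\mathbf p;\tau)\subset\mathbb C^{r+1}$ be the set of $(A_1,\dots,A_r,B)$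 with $\sum_iA_i=0$ and $F_{\ell_i}(A,B)=0$ for all $i$, and let $\overline V$ be its closure in the weighted projective space $\mathbb P(1,\dots,1,2)$ with coordinates $[A_0:A_1:\dots:A_r:B]$, where $V$ is embedded by $A_0=1$. The branches of $V$ near $B=\infty$ are the local analytic branches (irreducible components of the analytic germ, at the orbifold point taken up to its stabilizer $\pm1$) of $\overline V$ at the points of the infinity divisor $A_0=0$; points of that divisor are written $[A_1:\dots:A_r:B]$. *The generalized Lamé curve.* Let $\mathcal Y=\mathcal Y_{\mathbf n}(\mathbf p;\tau)$ be the set of classes $[(\mathbf a,h)]$ of $\mathbf a=(a_1,\dots,a_n)\in\mathbb C^n$, $h\in\mathbb C$, modulo permutation of the $a_\mu$ and $(\dots,a_\mu,\dots,h)\sim(\dots,a_\mu+\omega,\dots,h+\eta(\omega))$ for $\omega\in\Lambda$, such that the $a_\mu$ are distinct from each other and from all $p_i$ modulo $\Lambda$, $$\sum_{i}\sum_{\nu\ne\mu}n_i\bigl(\zeta(a_\mu-a_\nu)-\zeta(a_\mu-p_i)+\zeta(a_\nu-p_i)\bigr)=0\quad(\mu=1,\dots,n),\qquad h=\frac1n\sum_{\mu,i}n_i\zeta(a_\mu-p_i).$$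 Let $\overline{\mathcal Y}$ be its closure in the $\mathbb P^1$-bundle over $\mathrm{Sym}^nE$ obtained by adding the section $h=\infty$. Type I boundary points are the points of $\overline{\mathcal Y}$ with $h=\infty$. The natural map $\pi:\mathcal Y\to V$ sends $[(\mathbf a,h)]$ to the parameters $(A,B)$ of the equation solved by $e^{hz}\prod_\mu\sigma(z-a_\mu)/\prod_i\sigma(z-p_i)^{n_i}$, that is, for every $i$, $$\frac{A_i}{2n_i}=-\sum_\mu\zeta(p_i-a_\mu)+\sum_{j\ne i}n_j\zeta(p_i-p_j)-h,$$ $$B=\frac{A_i^2}{4n_i^2}-\sum_{j\ne i}n_j(n_j+2n_i)\wp(p_i-p_j)-\sum_{j\ne i}A_j\zeta(p_i-p_j)+(2n_i-1)\sum_\mu\wp(p_i-a_\mu).$$ **Theorem.** The Type I boundary points are exactly the points $\mathbf a_{\mathbf k}=([k_1p_1+\dots+k_rp_r],\infty)$, one for each $\mathbf k\in\mathbb Z_{\ge0}^r$ with $\sum_ik_i=n$ and $k_i\le 2n_i$. Call $\mathbf a\sim\mathbf a'$ if $\mathbf a+\mathbf a'=\sum_i2n_ip_i$ as divisors, i.e.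 $\mathbf a_{\mathbf k}\sim\mathbf a_{2\mathbf n-\mathbf k}$. There is a bijection between the Type I boundary points up to this equivalence and the branches of $V$ near $B=\infty$. It is induced by $\pi$: the germ of $\mathcal Y$ at a Type I point is mapped by $\pi$ onto the germ at infinity of the corresponding branch. Moreover: 1. The branch that corresponds to $\mathbf a_{\mathbf k}\sim\mathbf a_{2\mathbf n-\mathbf k}$ meets the infinity divisor at $[2(n_1-k_1):\dots:2(n_r-k_r):1]$. 2. If $\mathbf a$ is self-equivalent ($\mathbf a\sim\mathbf a$, so that $\mathbf n\in\mathbb Z^r$ and $\mathbf k=\mathbf n$), the corresponding branch is the unique branch through the orbifold point $[0:\dots:0:1]$. -/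

import Mathlib

open Filter Topology

namespace GLame

noncomputable section

/-! ### Elliptic functions -/

/-- The period pair `(1, τ)`, whose lattice is `Λ_τ = ℤ + ℤ τ`. -/
def tauPeriods (τ : UpperHalfPlane) : PeriodPair where
  ω₁ := 1
  ω₂ := (τ : ℂ)
  indep := by
    rw [LinearIndependent.pair_iff]
    intro s t h
    have him := congrArg Complex.im h
    have hre := congrArg Complex.re h
    have hτ : (τ : ℂ).im ≠ 0 := τ.im_ne_zero
    simp only [Complex.real_smul, mul_one, Complex.add_im, Complex.ofReal_im, Complex.mul_im,
      Complex.ofReal_re, zero_mul, add_zero, zero_add, Complex.zero_im] at him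
    have ht : t = 0 := (mul_eq_zero.mp him).resolve_right hτ
    subst ht
    simpa using hre

/-- The Weierstrass zeta function `ζ(z) = 1/z + ∑_{l ≠ 0} (1/(z-l) + 1/l + z/l²)`; the summand of
`l = 0` is `1/z`, because division by zero gives zero. -/
def zetaW (L : PeriodPair) (z : ℂ) : ℂ :=
  ∑' l : L.lattice, (1 / (z - l) + 1 / (l : ℂ) + z / (l : ℂ) ^ 2)

/-- The function `ζ(z) - 1/z`, extended holomorphically to `z = 0`. -/
def zetaWReg (L : PeriodPair) (z : ℂ) : ℂ :=
  ∑' l : L.lattice,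
    if (l : ℂ) = 0 then 0 else (1 / (z - l) + 1 / (l : ℂ) + z / (l : ℂ) ^ 2)

/-- The quasi-periods `η : Λ → ℂ` of `ζ`, that is `ζ(z + ω) = ζ(z) + η(ω)`: the additive map with
`η(ω_k) = 2 ζ(ω_k / 2)` on the two basic periods. -/
def quasiPeriod (L : PeriodPair) : L.lattice →ₗ[ℤ] ℂ :=
  L.latticeBasis.constr ℤ ![2 * zetaW L (L.ω₁ / 2), 2 * zetaW L (L.ω₂ / 2)]

/-- The elliptic curve `E = ℂ / Λ`. -/
abbrev Curve (L : PeriodPair) : Type := ℂ ⧸ L.lattice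

/-- The half-integral weight `n_i = ℓ_i / 2`. -/
def wt {r : ℕ} (ℓ : Fin r → ℕ) (i : Fin r) : ℂ := (ℓ i : ℂ) / 2

/-! ### The log-free variety

The potential is `Q(z) = ∑ n_i (n_i + 1) ℘(z - p_i) + ∑ A_i ζ(z - p_i) + B`. -/

/-- The regular part of the potential at `p_i` in the local coordinate `u = z - p_i`, that is
`Q(p_i + u) - n_i (n_i + 1) / u² - A_i / u`. -/
def regularPart {r : ℕ} (L : PeriodPair) (p : Fin r → ℂ) (ℓ : Fin r → ℕ) (i : Fin r)
    (A : Fin r → ℂ) (B : ℂ) (u : ℂ) : ℂ :=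
  wt ℓ i * (wt ℓ i + 1) * L.weierstrassPExcept 0 u + A i * zetaWReg L u
    + ∑ j ∈ Finset.univ.erase i,
        (wt ℓ j * (wt ℓ j + 1) * L.weierstrassP (p i - p j + u) + A j * zetaW L (p i - p j + u))
    + B

/-- The `m`-th Taylor coefficient of the regular part of the potential at `p_i`. -/
def potCoeff {r : ℕ} (L : PeriodPair) (p : Fin r → ℂ) (ℓ : Fin r → ℕ) (i : Fin r)
    (A : Fin r → ℂ) (B : ℂ) (m : ℕ) : ℂ :=
  iteratedDeriv m (regularPart L p ℓ i A B) 0 / (m.factorial : ℂ)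

/-- The right-hand side of the Frobenius recursion at step `k`, for an equation with residue `α`,
regular Taylor coefficients `q` and previous coefficients `c`. -/
def frobRHS (α : ℂ) (q : ℕ → ℂ) (c : ℕ → ℂ) (k : ℕ) : ℂ :=
  α * c k + ∑ m ∈ Finset.range k, q m * c (k - 1 - m)

/-- Coefficients `c_0 = 1, c_1, …, c_N` (extended by zero) of the Frobenius solution
`w = ∑ c_k u^(-ℓ/2 + k)` of `w'' = (ℓ/2 (ℓ/2 + 1) / u² + α / u + ∑ q_m u^m) w`.
Comparing the coefficients of `u^(-ℓ/2 + k - 1)` gives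
`(k + 1) (k - ℓ) c_{k+1} = α c_k + ∑_{m < k} q_m c_{k-1-m}`. Meaningful for `N ≤ ℓ`. -/
def frobCoeff (ℓ : ℕ) (α : ℂ) (q : ℕ → ℂ) : ℕ → ℕ → ℂ
  | 0 => Function.update 0 0 1
  | N + 1 => Function.update (frobCoeff ℓ α q N) (N + 1)
      (frobRHS α q (frobCoeff ℓ α q N) N / (((N : ℂ) + 1) * ((N : ℂ) - ℓ)))

/-- The log-free polynomial `F_{ℓ_i}(A, B)` at `p_i`: the obstruction in the Frobenius recursion at
the step `k = ℓ_i`, where the coefficient of `c_{ℓ_i + 1}` vanishes. -/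
def logFreePoly {r : ℕ} (L : PeriodPair) (p : Fin r → ℂ) (ℓ : Fin r → ℕ) (i : Fin r)
    (A : Fin r → ℂ) (B : ℂ) : ℂ :=
  frobRHS (A i) (potCoeff L p ℓ i A B)
    (frobCoeff (ℓ i) (A i) (potCoeff L p ℓ i A B) (ℓ i)) (ℓ i)

/-- The log-free variety `V_n(p; τ)` in the affine space with coordinates `(A_1, …, A_r, B)`. -/
def logFreeVariety {r : ℕ} (L : PeriodPair) (p : Fin r → ℂ) (ℓ : Fin r → ℕ) :
    Set ((Fin r → ℂ) × ℂ) :=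
  {x | ∑ i, x.1 i = 0 ∧ ∀ i, logFreePoly L p ℓ i x.1 x.2 = 0}

/-! ### Weighted projective space `ℙ(1, …, 1, 2)` -/

/-- Homogeneous coordinates `(A_0, (A_1, …, A_r), B)` of weights `1, (1, …, 1), 2`. -/
abbrev WVec (r : ℕ) : Type := ℂ × (Fin r → ℂ) × ℂ

/-- The weighted scaling `c · (A_0, A, B) = (c A_0, c A, c² B)`. -/
def wscale {r : ℕ} (c : ℂ) (u : WVec r) : WVec r := (c * u.1, c • u.2.1, c ^ 2 * u.2.2)

lemma wscale_one {r : ℕ} (u : WVec r) : wscale 1 u = u := by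
  simp [wscale]

lemma wscale_wscale {r : ℕ} (c d : ℂ) (u : WVec r) :
    wscale c (wscale d u) = wscale (c * d) u := by
  simp only [wscale, smul_smul, Prod.mk.injEq, true_and]
  constructor <;> ring

lemma wscale_inv_cancel {r : ℕ} {c : ℂ} (hc : c ≠ 0) (u : WVec r) :
    wscale c⁻¹ (wscale c u) = u := by
  rw [wscale_wscale, inv_mul_cancel₀ hc, wscale_one]

lemma continuous_wscale {r : ℕ} (c : ℂ) : Continuous (wscale (r := r) c) := by
  unfold wscale; fun_prop

/-- Proportionality of non-zero weighted homogeneous coordinates. -/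
def wpSetoid (r : ℕ) : Setoid {u : WVec r // u ≠ 0} where
  r u v := ∃ c : ℂ, c ≠ 0 ∧ v.1 = wscale c u.1
  iseqv :=
    { refl := fun u => ⟨1, one_ne_zero, (wscale_one _).symm⟩
      symm := by
        rintro u v ⟨c, hc, h⟩
        exact ⟨c⁻¹, inv_ne_zero hc, by rw [h, wscale_inv_cancel hc]⟩
      trans := by
        rintro u v w ⟨c, hc, h⟩ ⟨d, hd, h'⟩
        exact ⟨d * c, mul_ne_zero hd hc, by rw [h', h, wscale_wscale]⟩ }

/-- The weighted projective space `ℙ(1, 1, …, 1, 2)` of dimension `r + 1`, with its quotient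
topology. -/
abbrev WP (r : ℕ) : Type := Quotient (wpSetoid r)

/-- The point `[A_0 : A_1 : … : A_r : B]`. -/
def WP.mk {r : ℕ} (u : WVec r) (hu : u ≠ 0) : WP r := Quotient.mk (wpSetoid r) ⟨u, hu⟩

/-- The point `[x_1 : … : x_r : 1]` of the infinity divisor `A_0 = 0`. -/
def WP.infPoint {r : ℕ} (x : Fin r → ℂ) : WP r :=
  WP.mk (0, x, 1) (fun h => one_ne_zero (congrArg (fun u : WVec r => u.2.2) h))

/-- The projective log-free variety: the closure of the affine one, embedded by `A_0 = 1`. -/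
def projLogFree {r : ℕ} (L : PeriodPair) (p : Fin r → ℂ) (ℓ : Fin r → ℕ) : Set (WP r) :=
  closure {P | ∃ x ∈ logFreeVariety L p ℓ, ∃ h : ((1, x.1, x.2) : WVec r) ≠ 0,
    P = WP.mk (1, x.1, x.2) h}

/-- The cone over a subset of the weighted projective space. -/
def cone {r : ℕ} (X : Set (WP r)) : Set (WVec r) := {u | ∃ h : u ≠ 0, WP.mk u h ∈ X}

/-! ### Analytic germs and branches -/

/-- `S` is an analytic germ at `v`: near `v` it is the zero set of finitely many functions
analytic at `v`. -/
def IsAnalyticGerm {M : Type*} [NormedAddCommGroup M] [NormedSpace ℂ M] (S : Set M) (v : M) :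
    Prop :=
  ∃ (m : ℕ) (f : Fin m → M → ℂ), (∀ i, AnalyticAt ℂ (f i) v) ∧
    ∀ᶠ u in 𝓝 v, u ∈ S ↔ ∀ i, f i u = 0

/-- The germ of `S` at `v` is a non-empty irreducible analytic germ. -/
def IsIrreducibleGerm {M : Type*} [NormedAddCommGroup M] [NormedSpace ℂ M] (S : Set M) (v : M) :
    Prop :=
  IsAnalyticGerm S v ∧ v ∈ S ∧
    ∀ S₁ S₂ : Set M, IsAnalyticGerm S₁ v → IsAnalyticGerm S₂ v → S =ᶠ[𝓝 v] (S₁ ∪ S₂ : Set M) →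
      S =ᶠ[𝓝 v] S₁ ∨ S =ᶠ[𝓝 v] S₂

/-- The germ of `S` at `v` is an irreducible component of the germ of `X` at `v`: a maximal
irreducible analytic germ contained in it. -/
def IsGermComponent {M : Type*} [NormedAddCommGroup M] [NormedSpace ℂ M] (S X : Set M) (v : M) :
    Prop :=
  IsIrreducibleGerm S v ∧ S ≤ᶠ[𝓝 v] X ∧
    ∀ S' : Set M, IsIrreducibleGerm S' v → S ≤ᶠ[𝓝 v] S' → S' ≤ᶠ[𝓝 v] X → S' ≤ᶠ[𝓝 v] S

/-- Homogeneous coordinates of a point of the infinity divisor `A_0 = 0`, together with a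
representative of an irreducible component of the germ of the cone over `X` there. -/
structure PreBranch {r : ℕ} (X : Set (WP r)) where
  /-- homogeneous coordinates of the centre -/
  pt : WVec r
  ne_zero : pt ≠ 0
  at_infinity : pt.1 = 0
  /-- a representative of the germ -/
  carrier : Set (WVec r)
  isComponent : IsGermComponent carrier (cone X) pt

/-- Two such data define the same branch when a weighted scaling takes one germ to the other.
(The local branches of `X` at the point with coordinates `v` are the components of the germ of the
cone at `v`, modulo the stabilizer of `v`.) -/
def branchSetoid {r : ℕ} (X : Set (WP r)) : Setoid (PreBranch X) where
  r b b' := ∃ c : ℂ, c ≠ 0 ∧ b'.pt = wscale c b.pt ∧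
    ∀ᶠ u in 𝓝 b.pt, u ∈ b.carrier ↔ wscale c u ∈ b'.carrier
  iseqv :=
    { refl := fun b => ⟨1, one_ne_zero, (wscale_one _).symm,
        Eventually.of_forall fun u => by rw [wscale_one]⟩
      symm := by
        rintro b b' ⟨c, hc, h, hu⟩
        have hpt : b.pt = wscale c⁻¹ b'.pt := by rw [h, wscale_inv_cancel hc]
        refine ⟨c⁻¹, inv_ne_zero hc, hpt, ?_⟩
        have ht : Tendsto (wscale c⁻¹) (𝓝 b'.pt) (𝓝 b.pt) := by
          rw [hpt]
          exact (continuous_wscale c⁻¹).continuousAt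
        filter_upwards [ht.eventually hu] with u hu'
        rw [hu', wscale_wscale, mul_inv_cancel₀ hc, wscale_one]
      trans := by
        rintro b b' b'' ⟨c, hc, h, hu⟩ ⟨d, hd, h', hu'⟩
        refine ⟨d * c, mul_ne_zero hd hc, by rw [h', h, wscale_wscale], ?_⟩
        have ht : Tendsto (wscale c) (𝓝 b.pt) (𝓝 b'.pt) := by
          rw [h]
          exact (continuous_wscale c).continuousAt
        filter_upwards [hu, ht.eventually hu'] with u h1 h2
        rw [h1, h2, wscale_wscale] }

/-- The branches of `X` at the points of the infinity divisor `A_0 = 0`. -/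
abbrev Branch {r : ℕ} (X : Set (WP r)) : Type := Quotient (branchSetoid X)

/-- The point in which a branch meets the infinity divisor. -/
def Branch.point {r : ℕ} {X : Set (WP r)} (b : Branch X) : WP r :=
  Quotient.lift (fun b : PreBranch X => WP.mk b.pt b.ne_zero)
    (fun _ _ h => Quotient.sound (by obtain ⟨c, hc, h, -⟩ := h; exact ⟨c, hc, h⟩)) b

/-- The affine coordinates `(A / A_0, B / A_0²)` of the point `[A_0 : A : B]`. -/
def toAffine {r : ℕ} (u : WVec r) : (Fin r → ℂ) × ℂ := (u.1⁻¹ • u.2.1, u.2.2 / u.1 ^ 2)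

/-- The filter, on the affine space, of the part of a branch germ off the infinity divisor. -/
def PreBranch.affineFilter {r : ℕ} {X : Set (WP r)} (b : PreBranch X) :
    Filter ((Fin r → ℂ) × ℂ) :=
  map toAffine (𝓝[b.carrier ∩ {u | u.1 ≠ 0}] b.pt)

/-! ### The generalized Lamé curve -/

/-- `S_n ⋉ Λ^n`-equivalence on `ℂ^n × ℙ¹`: points are permuted, and
`(a_1, …, a_μ + ω, …, a_n, h + η(ω)) ∼ (a_1, …, a_n, h)`, the point `h = ∞` being fixed. -/
def lameSetoid (L : PeriodPair) (n : ℕ) : Setoid ((Fin n → ℂ) × OnePoint ℂ) where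
  r x y := ∃ (σ : Equiv.Perm (Fin n)) (ω : Fin n → L.lattice),
    (∀ μ, y.1 μ = x.1 (σ μ) + ω μ) ∧
      y.2 = OnePoint.map (fun h => h + ∑ μ, quasiPeriod L (ω μ)) x.2
  iseqv :=
    { refl := fun x => ⟨1, 0, by simp, by
        cases x.2 using OnePoint.rec <;> simp⟩
      symm := by
        rintro x y ⟨σ, ω, h1, h2⟩
        refine ⟨σ⁻¹, fun μ => - ω (σ⁻¹ μ), fun μ => ?_, ?_⟩
        · rw [h1 (σ⁻¹ μ)]; simp
        · rw [h2]
          have hs : ∑ μ, quasiPeriod L (ω (σ⁻¹ μ)) = ∑ μ, quasiPeriod L (ω μ) :=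
            Equiv.sum_comp σ⁻¹ (fun μ => quasiPeriod L (ω μ))
          have hs' : ∑ μ, quasiPeriod L (- ω (σ⁻¹ μ)) = - ∑ μ, quasiPeriod L (ω μ) := by
            rw [← hs, ← Finset.sum_neg_distrib]
            exact Finset.sum_congr rfl fun μ _ => map_neg _ _
          rw [hs']
          cases x.2 using OnePoint.rec <;> simp
      trans := by
        rintro x y z ⟨σ, ω, h1, h2⟩ ⟨σ', ω', h1', h2'⟩
        refine ⟨σ * σ', fun μ => ω (σ' μ) + ω' μ, fun μ => ?_, ?_⟩
        · rw [h1' μ, h1 (σ' μ)]; simp [add_assoc]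
        · rw [h2', h2]
          have hs : ∑ μ, quasiPeriod L (ω (σ' μ)) = ∑ μ, quasiPeriod L (ω μ) :=
            Equiv.sum_comp σ' (fun μ => quasiPeriod L (ω μ))
          cases x.2 using OnePoint.rec with
          | infty => simp
          | coe h => simp [Finset.sum_add_distrib, hs, add_assoc] }

/-- The projective bundle over `Sym^n E` that compactifies the affine bundle of the pairs
`(a, h)` by the section `h = ∞`, with its quotient topology. -/
abbrev LameBundle (L : PeriodPair) (n : ℕ) : Type := Quotient (lameSetoid L n)

/-- The point `[(a, h)]`. -/
def LameBundle.mk (L : PeriodPair) {n : ℕ} (a : Fin n → ℂ) (h : OnePoint ℂ) : LameBundle L n :=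
  Quotient.mk (lameSetoid L n) (a, h)

/-- The divisor `a_1 + … + a_n ∈ Sym^n E` under a point `[(a, h)]`. -/
def LameBundle.divisor {L : PeriodPair} {n : ℕ} (y : LameBundle L n) : Multiset (Curve L) :=
  Quotient.lift
    (fun x : (Fin n → ℂ) × OnePoint ℂ =>
      Finset.univ.val.map fun μ => (Submodule.Quotient.mk (x.1 μ) : Curve L))
    (by
      rintro x y ⟨σ, ω, h1, -⟩
      have e : (fun μ => (Submodule.Quotient.mk (y.1 μ) : Curve L))
          = (fun μ => (Submodule.Quotient.mk (x.1 μ) : Curve L)) ∘ σ := by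
        funext μ
        rw [Function.comp_apply, h1 μ, Submodule.Quotient.eq]
        simp
      change Multiset.map _ _ = Multiset.map _ _
      rw [e, ← Multiset.map_map]
      congr 1
      have := congrArg Finset.val (Finset.map_univ_equiv σ)
      rw [Finset.map_val] at this
      exact this.symm) y

/-- `(a, h)` is the datum of a generalized Hermite-Halphen ansatz that solves a generalized Lamé
equation of type `n_1, …, n_r`: the `a_μ` are distinct modulo `Λ` and different from the `p_i`,
the residue equations hold, and `h = (1/n) ∑_μ ∑_i n_i ζ(a_μ - p_i)`. -/
structure IsAnsatz {r n : ℕ} (L : PeriodPair) (p : Fin r → ℂ) (ℓ : Fin r → ℕ)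
    (a : Fin n → ℂ) (h : ℂ) : Prop where
  distinct : ∀ μ ν, μ ≠ ν → a μ - a ν ∉ L.lattice
  off_poles : ∀ μ i, a μ - p i ∉ L.lattice
  residue : ∀ μ, ∑ i, ∑ ν ∈ Finset.univ.erase μ,
    wt ℓ i * (zetaW L (a μ - a ν) - zetaW L (a μ - p i) + zetaW L (a ν - p i)) = 0
  h_eq : h = 1 / (n : ℂ) * ∑ μ, ∑ i, wt ℓ i * zetaW L (a μ - p i)

/-- The generalized Lamé curve `𝒴_n(p; τ)`, without its boundary. -/
def lameCurve {r : ℕ} (L : PeriodPair) (p : Fin r → ℂ) (ℓ : Fin r → ℕ) (n : ℕ) :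
    Set (LameBundle L n) :=
  {y | ∃ (a : Fin n → ℂ) (h : ℂ), IsAnsatz L p ℓ a h ∧ y = LameBundle.mk L a (h : OnePoint ℂ)}

/-- `(A, B)` are the accessory parameters of the equation solved by the ansatz `(a, h)`. The
formulas for `B` obtained from the different `i` have to agree. -/
def IsAccessory {r n : ℕ} (L : PeriodPair) (p : Fin r → ℂ) (ℓ : Fin r → ℕ)
    (a : Fin n → ℂ) (h : ℂ) (A : Fin r → ℂ) (B : ℂ) : Prop :=
  ∀ i,
    A i / (ℓ i : ℂ) = - (∑ μ, zetaW L (p i - a μ))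
      + ∑ j ∈ Finset.univ.erase i, wt ℓ j * zetaW L (p i - p j) - h ∧
    B = A i ^ 2 / (ℓ i : ℂ) ^ 2
      - ∑ j ∈ Finset.univ.erase i, wt ℓ j * (wt ℓ j + ℓ i) * L.weierstrassP (p i - p j)
      - ∑ j ∈ Finset.univ.erase i, A j * zetaW L (p i - p j)
      + ((ℓ i : ℂ) - 1) * ∑ μ, L.weierstrassP (p i - a μ)

/-- The image of `U ∩ 𝒴_n(p; τ)` under the natural map `π : 𝒴_n(p; τ) → V_n(p; τ)`,
`[(a, h)] ↦ (A, B)`. -/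
def piImage {r : ℕ} (L : PeriodPair) (p : Fin r → ℂ) (ℓ : Fin r → ℕ) (n : ℕ)
    (U : Set (LameBundle L n)) : Set ((Fin r → ℂ) × ℂ) :=
  {x | ∃ (a : Fin n → ℂ) (h : ℂ), IsAnsatz L p ℓ a h ∧
    LameBundle.mk L a (h : OnePoint ℂ) ∈ U ∧ IsAccessory L p ℓ a h x.1 x.2}

/-- The Type I boundary points: the points of the closure of `𝒴_n(p; τ)` with `h = ∞`. -/
def TypeI {r : ℕ} (L : PeriodPair) (p : Fin r → ℂ) (ℓ : Fin r → ℕ) (n : ℕ) : Type :=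
  {y : LameBundle L n // y ∈ closure (lameCurve L p ℓ n) ∧
    ∃ a : Fin n → ℂ, y = LameBundle.mk L a OnePoint.infty}

/-- The divisor `k_1 p_1 + … + k_r p_r` on `E`. -/
def poleDivisor {r : ℕ} (L : PeriodPair) (p : Fin r → ℂ) (k : Fin r → ℕ) : Multiset (Curve L) :=
  ∑ i, k i • ({(Submodule.Quotient.mk (p i) : Curve L)} : Multiset (Curve L))

/-- The relation `a ∼ a'` on Type I boundary points: `a + a' = ∑ 2 n_i p_i`. -/
def TypeI.Rel {r n : ℕ} {L : PeriodPair} {p : Fin r → ℂ} {ℓ : Fin r → ℕ}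
    (y y' : TypeI L p ℓ n) : Prop :=
  y.1.divisor + y'.1.divisor = poleDivisor L p ℓ

/-- Type I boundary points up to the equivalence generated by `a ∼ a'`. -/
abbrev TypeIClass {r : ℕ} (L : PeriodPair) (p : Fin r → ℂ) (ℓ : Fin r → ℕ) (n : ℕ) : Type :=
  Quot (TypeI.Rel (n := n) (L := L) (p := p) (ℓ := ℓ))

end

end GLame

namespace GLame

noncomputable section

/-! ### The Weierstrass zeta function -/

/-! On the infinity divisor `A_0 = 0` the homogenized log-free polynomial at `p_i` degenerates to
that of the Whittaker-type equation `w'' = (n_i(n_i+1)/u² + α/u + β) w`. For `β = c²` this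
polynomial is a nonzero constant times `∏_{k ≤ ℓ_i} (α - c(2k - ℓ_i))`, because `e^u` times a
Laguerre polynomial of degree `k` is a log-free solution for `c = 1`, `α = 2k - ℓ_i`; degree and
homogeneity do the rest (`exists_whittakerPoly_eq`). With `∑ A_i = 0`, the only possible points at
infinity are therefore the multiples of `infVec ℓ k = (0, 2k - ℓ, 1)` with `∑ k_i = n` and `k_i ≤
ℓ_i` (`exists_infVec_of_mem`).

The roots are simple, so `A_0`, the log-free polynomials and `B` are local coordinates near `infVec
ℓ k` (`exists_logFreeChart_injOn`), and the log-free equations at the `p_i` cut out a smooth surface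
there. That the cone over `V` fills this surface is not visible from the equations, which together
with `∑ A_i = 0` are one too many. It follows from the existence of arcs on the generalized Lamé
curve. Put `h = 1/s` and `a_μ = p_i + s x_μ` with `k_i` points near each `p_i`. At `s = 0` the
rescaled residue equations decouple into equilibrium equations, one system for each pole, solved by
the roots of Laguerre polynomials (`exists_equilibrium`). The equilibria are nondegenerate
(`equilibrium_linearization_injective`), so the implicit function theorem gives an analytic arc
(`exists_scaled_arc`, `exists_arc`). Its parameters `(s, sA, s²B)` run into `infVec ℓ k`. They
satisfy the log-free equations because the ansatz solves `w'' = Qw`: the function `y' + y² - Q`,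
with `y = w'/w`, is elliptic without poles and vanishes at a point
(`riccatiDefect_eventually_eq_zero`). Scaling the arc sweeps out the whole surface
(`eventually_exists_param`). Hence the germ of the cone is irreducible, and there is exactly one
branch at each point (`isIrreducibleGerm_cone`, `branch_point_injective`).

Conversely, let `h → ∞` on the curve. Summing the residue equations over a cluster of points shows
that every `a_μ` tends to a pole and that `A_i/h → 2k_i - ℓ_i`, `B/h² → 1`
(`exists_pole_of_tendsto`, `tendsto_wscale_inv`). The limit lies in the closed cone, which forces
`k_i ≤ ℓ_i`. The same limit, combined with the parametrization, identifies the image germ with the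
branch (`lift_piImage_eq`); injectivity of `π` plays no role. Finally `infVec ℓ k` and `infVec ℓ k'`
are proportional only with factor `±1`, that is for `k' = k` or `k + k' = ℓ`, which is the
equivalence of boundary points. -/

lemma zetaW_term_bound {r : ℝ} {s l : ℂ} (hr : 0 < r) (hs : ‖s‖ < r) (h : 2 * r ≤ ‖l‖) :
    ‖1 / (s - l) + 1 / l + s / l ^ 2‖ ≤ 2 * r ^ 2 * ‖l‖ ^ (-3 : ℝ) := by
  have h0 : 0 < ‖l‖ := by linarith
  have hl : l ≠ 0 := norm_pos_iff.mp h0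
  have hd : ‖l‖ / 2 ≤ ‖s - l‖ := by
    rw [norm_sub_rev]
    exact .trans (by linarith) (norm_sub_norm_le l s)
  have hsl : s - l ≠ 0 := norm_pos_iff.mp (by linarith)
  -- The two correction terms cancel the expansion of `1/(s - l)` to second order, leaving a summand
  -- of size `|l|⁻³`, which is summable over a planar lattice.
  have e : 1 / (s - l) + 1 / l + s / l ^ 2 = s ^ 2 / ((s - l) * l ^ 2) := by
    field_simp
    ring
  rw [e, norm_div, norm_mul, norm_pow, norm_pow, Real.rpow_neg h0.le, ← div_eq_mul_inv]
  calc ‖s‖ ^ 2 / (‖s - l‖ * ‖l‖ ^ 2) ≤ r ^ 2 / (‖l‖ / 2 * ‖l‖ ^ 2) := by gcongr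
    _ = 2 * r ^ 2 / ‖l‖ ^ 3 := by field_simp
    _ = _ := by norm_cast

variable (L : PeriodPair)

lemma hasSumLocallyUniformly_zetaWReg :
    HasSumLocallyUniformly
      (fun (l : L.lattice) (z : ℂ) ↦
        if (l : ℂ) = 0 then 0 else (1 / (z - l) + 1 / (l : ℂ) + z / (l : ℂ) ^ 2))
      (zetaWReg L) := by
  refine L.hasSumLocallyUniformly_aux (u := fun r l ↦ 2 * r ^ 2 * ‖l‖ ^ (-3 : ℝ)) _
    (fun _ _ ↦ (ZLattice.summable_norm_rpow _ _ (by simp; norm_num)).mul_left _) fun r hr ↦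
    Filter.eventually_atTop.mpr ⟨2 * r, ?_⟩
  rintro _ h s hs l rfl
  split_ifs
  · simp; positivity
  · exact zetaW_term_bound hr hs h

lemma zetaW_eq (z : ℂ) : zetaW L z = zetaWReg L z + 1 / z := by
  have h1 : Summable fun l : L.lattice ↦
      if (l : ℂ) = 0 then 0 else (1 / (z - l) + 1 / (l : ℂ) + z / (l : ℂ) ^ 2) :=
    (L |> hasSumLocallyUniformly_zetaWReg).hasSum (x := z) |>.summable
  have h2 : HasSum (fun l : L.lattice ↦ if l = 0 then 1 / z else 0) (1 / z) :=
    hasSum_ite_eq 0 (1 / z)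
  rw [zetaWReg, ← h2.tsum_eq, ← h1.tsum_add h2.summable, zetaW]
  congr 1 with l
  by_cases hl : l = 0
  · simp [hl]
  · have : (l : ℂ) ≠ 0 := by simpa using hl
    simp [hl]

lemma isOpen_punctured : IsOpen ((L.lattice : Set ℂ) \ {0})ᶜ := L.isOpen_compl_lattice_sdiff

lemma differentiableOn_zetaWReg :
    DifferentiableOn ℂ (zetaWReg L) ((L.lattice : Set ℂ) \ {0})ᶜ := by
  refine (hasSumLocallyUniformly_zetaWReg L).tendstoLocallyUniformlyOn.differentiableOn
    (.of_forall fun s ↦ .fun_sum fun i hi ↦ ?_) (isOpen_punctured L)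
  split_ifs
  · simp
  · refine .add (.add (.div (by fun_prop) (by fun_prop) fun x hx ↦ ?_) (by fun_prop)) (by fun_prop)
    have : x ≠ i := by rintro rfl; simp_all
    simpa [sub_eq_zero]

/-- Locally uniform convergence of holomorphic partial sums allows termwise differentiation, and the
derivative of each summand is minus the corresponding summand of `℘`. -/
lemma deriv_zetaWReg {z : ℂ} (hz : z ∈ ((L.lattice : Set ℂ) \ {0})ᶜ) :
    deriv (zetaWReg L) z = - L.weierstrassPExcept 0 z := by
  have key := (hasSumLocallyUniformly_zetaWReg L).tendstoLocallyUniformlyOn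
    (s := ((L.lattice : Set ℂ) \ {0})ᶜ)
  have hd : ∀ l : L.lattice, ∀ x ∈ ((L.lattice : Set ℂ) \ {0})ᶜ, (l : ℂ) ≠ 0 →
      HasDerivAt (fun z : ℂ ↦ 1 / (z - l) + 1 / (l : ℂ) + z / (l : ℂ) ^ 2)
        (-(1 / (x - l) ^ 2 - 1 / (l : ℂ) ^ 2)) x := by
    intro l x hx hl
    have hxl : x - l ≠ 0 := by
      rw [sub_ne_zero]; rintro rfl; simp_all
    have h1 := ((hasDerivAt_id x).sub_const (l : ℂ)).inv hxl
    have h2 := (hasDerivAt_id x).div_const ((l : ℂ) ^ 2)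
    refine (((h1.add_const (1 / (l : ℂ))).add h2).congr_deriv ?_).congr_of_eventuallyEq
      (.of_forall fun y ↦ by simp)
    simp [neg_div]
    ring
  have hdiff : ∀ᶠ s : Finset L.lattice in atTop, DifferentiableOn ℂ
      (fun z : ℂ ↦ ∑ l ∈ s, if (l : ℂ) = 0 then 0 else
        (1 / (z - l) + 1 / (l : ℂ) + z / (l : ℂ) ^ 2))
      ((L.lattice : Set ℂ) \ {0})ᶜ := by
    refine .of_forall fun s ↦ .fun_sum fun i hi ↦ ?_
    split_ifs with h
    · simp
    · exact fun x hx ↦ (hd i x hx h).differentiableAt.differentiableWithinAt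
  have h := (L.hasSum_weierstrassPExcept 0 z).neg
  rw [HasSum, SummationFilter.unconditional_filter] at h
  refine tendsto_nhds_unique ((key.deriv hdiff (isOpen_punctured L)).tendsto_at hz)
    (h.congr fun s ↦ ?_)
  simp only [Function.comp_apply]
  rw [deriv_fun_sum]
  · refine Finset.sum_congr rfl fun l _ ↦ ?_
    split_ifs with h1
    · simp
    · exact (hd l z hz h1).deriv.symm
  · intro l _
    split_ifs with h1
    · simp
    · exact (hd l z hz h1).differentiableAt

lemma hasDerivAt_zetaWReg {z : ℂ} (hz : z ∈ ((L.lattice : Set ℂ) \ {0})ᶜ) :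
    HasDerivAt (zetaWReg L) (- L.weierstrassPExcept 0 z) z := by
  rw [← deriv_zetaWReg L hz]
  exact ((differentiableOn_zetaWReg L).differentiableAt
    ((isOpen_punctured L).mem_nhds hz)).hasDerivAt

lemma weierstrassP_eq (z : ℂ) : L.weierstrassP z = L.weierstrassPExcept 0 z + 1 / z ^ 2 := by
  have := L.weierstrassPExcept_add 0 z
  simpa using this.symm

lemma hasDerivAt_zetaW {z : ℂ} (hz : z ∉ L.lattice) :
    HasDerivAt (zetaW L) (- L.weierstrassP z) z := by
  have h0 : z ≠ 0 := by rintro rfl; exact hz (zero_mem _)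
  have h := (hasDerivAt_zetaWReg L (z := z) (by simp [hz])).add (hasDerivAt_inv h0)
  rw [weierstrassP_eq]
  refine (h.congr_deriv (by rw [one_div]; ring)).congr_of_eventuallyEq (.of_forall fun y ↦ ?_)
  simp [zetaW_eq]

lemma analyticAt_zetaW {z : ℂ} (hz : z ∉ L.lattice) : AnalyticAt ℂ (zetaW L) z := by
  refine DifferentiableOn.analyticAt (s := (L.lattice : Set ℂ)ᶜ)
    (fun x hx ↦ (hasDerivAt_zetaW L hx).differentiableAt.differentiableWithinAt)
    (L.isClosed_lattice.isOpen_compl.mem_nhds hz)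

lemma analyticAt_zetaWReg : AnalyticAt ℂ (zetaWReg L) 0 :=
  (differentiableOn_zetaWReg L).analyticAt ((isOpen_punctured L).mem_nhds (by simp))

@[simp] lemma zetaWReg_zero : zetaWReg L 0 = 0 := by
  simp only [zetaWReg]
  refine (tsum_congr fun l ↦ ?_).trans tsum_zero
  split_ifs
  · rfl
  · simp

lemma zetaW_neg (z : ℂ) : zetaW L (-z) = - zetaW L z := by
  simp only [zetaW]
  rw [← (Equiv.neg L.lattice).tsum_eq, ← tsum_neg]
  congr with l
  simp only [Equiv.neg_apply, NegMemClass.coe_neg, sub_neg_eq_add, neg_add_eq_sub]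
  rw [show ((l : ℂ) - z) = -(z - l) by ring]
  simp only [div_neg, even_two.neg_pow, neg_div]
  ring

@[simp] lemma zetaW_zero : zetaW L 0 = 0 := by simp [zetaW_eq]

lemma analyticAt_weierstrassP {z : ℂ} (hz : z ∉ L.lattice) : AnalyticAt ℂ L.weierstrassP z :=
  L.analyticOnNhd_weierstrassP z hz

lemma countable_lattice : (L.lattice : Set ℂ).Countable :=
  countable_of_Lindelof_of_discrete (X := L.lattice)

/-- Both sides have derivative `-℘` on the complement of a countable set, which is connected, so one
point suffices. At `z = -w/2` oddness of `ζ` gives the constant; this is where `w/2` must avoid the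
lattice. -/
lemma zetaW_add_of_half {w : ℂ} (hw : w ∈ L.lattice) (hw2 : w / 2 ∉ L.lattice) {z : ℂ}
    (hz : z ∉ L.lattice) : zetaW L (z + w) = zetaW L z + 2 * zetaW L (w / 2) := by
  have hadd : ∀ x : ℂ, x + w ∈ L.lattice ↔ x ∈ L.lattice := fun x ↦
    ⟨fun h ↦ by simpa using sub_mem h hw, fun h ↦ add_mem h hw⟩
  have hopen : IsOpen (L.lattice : Set ℂ)ᶜ := L.isClosed_lattice.isOpen_compl
  have hd : ∀ x ∉ L.lattice, HasDerivAt (fun x ↦ zetaW L (x + w)) (- L.weierstrassP x) x := by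
    intro x hx
    have := (hasDerivAt_zetaW L (z := x + w) (by rwa [hadd])).comp_add_const x w
    rwa [L.weierstrassP_add_coe x ⟨w, hw⟩] at this
  have hd' : ∀ x ∉ L.lattice,
      HasDerivAt (fun x ↦ zetaW L x + 2 * zetaW L (w / 2)) (- L.weierstrassP x) x :=
    fun x hx ↦ (hasDerivAt_zetaW L hx).add_const _
  refine hopen.eqOn_of_deriv_eq (𝕜 := ℂ)
    (f := fun x ↦ zetaW L (x + w)) (g := fun x ↦ zetaW L x + 2 * zetaW L (w / 2)) ?_
    (fun x hx ↦ (hd x hx).differentiableAt.differentiableWithinAt)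
    (fun x hx ↦ (hd' x hx).differentiableAt.differentiableWithinAt)
    (fun x hx ↦ by rw [(hd x hx).deriv, (hd' x hx).deriv]) (x := -(w / 2)) (by simpa using hw2) ?_
    hz
  · exact (Set.Countable.isConnected_compl_of_one_lt_rank (by simp) (countable_lattice L)).2
  · simp only [zetaW_neg]
    rw [show -(w / 2) + w = w / 2 by ring]
    ring

/-- The periods for which the rule holds form a subgroup, and it contains the two basic periods. -/
lemma zetaW_add_coe (ω : L.lattice) : ∀ {z : ℂ}, z ∉ L.lattice →
    zetaW L (z + ω) = zetaW L z + quasiPeriod L ω := by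
  let S : AddSubgroup L.lattice :=
    { carrier := {ω | ∀ z : ℂ, z ∉ L.lattice → zetaW L (z + ω) = zetaW L z + quasiPeriod L ω}
      zero_mem' := by simp
      add_mem' := by
        intro a b ha hb z hz
        have : z + a ∉ L.lattice := fun h ↦ hz (by simpa using sub_mem h a.2)
        have e : z + ((a + b : L.lattice) : ℂ) = z + a + b := by simp [add_assoc]
        rw [e, hb _ this, ha _ hz, map_add]
        ring
      neg_mem' := by
        intro a ha z hz
        have : z - a ∉ L.lattice := fun h ↦ hz (by simpa using add_mem h a.2)
        have h := ha _ this
        rw [sub_add_cancel] at h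
        rw [h, map_neg]
        simp [sub_eq_add_neg] }
  have hb : ∀ i, L.latticeBasis i ∈ S := by
    intro i z hz
    fin_cases i
    · have := zetaW_add_of_half L L.ω₁_mem_lattice L.ω₁_div_two_notMem_lattice hz
      simp only [Fin.zero_eta, PeriodPair.latticeBasis_zero, this, quasiPeriod,
        Module.Basis.constr_basis]
      rfl
    · have := zetaW_add_of_half L L.ω₂_mem_lattice L.ω₂_div_two_notMem_lattice hz
      simp only [Fin.mk_one, PeriodPair.latticeBasis_one, this, quasiPeriod,
        Module.Basis.constr_basis]
      rfl
  have hS : AddSubgroup.toIntSubmodule S = ⊤ := by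
    rw [eq_top_iff, ← L.latticeBasis.span_eq, Submodule.span_le]
    rintro _ ⟨i, rfl⟩
    exact hb i
  have : ω ∈ AddSubgroup.toIntSubmodule S := hS ▸ Submodule.mem_top
  exact fun {z} hz ↦ this z hz

end

end GLame

namespace GLame

noncomputable section

lemma sum_wt {r n : ℕ} {ℓ : Fin r → ℕ} (hsum : ∑ i, ℓ i = 2 * n) : ∑ i, wt ℓ i = n := by
  have : (∑ i, (ℓ i : ℂ)) = 2 * n := by exact_mod_cast congrArg (Nat.cast (R := ℂ)) hsum
  simp only [wt, ← Finset.sum_div, this]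
  ring

lemma two_mul_wt {r : ℕ} (ℓ : Fin r → ℕ) (i : Fin r) : 2 * wt ℓ i = ℓ i := by
  simp only [wt]; ring

lemma sum_sum_antisymm {ι : Type*} (S : Finset ι) (f : ι → ι → ℂ) (hf : ∀ i j, f j i = - f i j) :
    ∑ i ∈ S, ∑ j ∈ S, f i j = 0 := by
  have h : ∑ i ∈ S, ∑ j ∈ S, f i j = - ∑ i ∈ S, ∑ j ∈ S, f i j := by
    conv_lhs => rw [Finset.sum_comm]
    simp only [← Finset.sum_neg_distrib]
    exact Finset.sum_congr rfl fun i _ ↦ Finset.sum_congr rfl fun j _ ↦ hf i j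
  exact self_eq_neg.mp h

/-! ### The equations of the ansatz -/

section Ansatz

variable {r n : ℕ} (L : PeriodPair) (p : Fin r → ℂ) (ℓ : Fin r → ℕ)

/-- The logarithmic derivative `y = w'/w` of the ansatz `w`. -/
def logDerivAnsatz (a : Fin n → ℂ) (h z : ℂ) : ℂ :=
  h + ∑ μ, zetaW L (z - a μ) - ∑ i, wt ℓ i * zetaW L (z - p i)

/-- The derivative of `logDerivAnsatz`. -/
def logDerivAnsatz' (a : Fin n → ℂ) (z : ℂ) : ℂ :=
  - ∑ μ, L.weierstrassP (z - a μ) + ∑ i, wt ℓ i * L.weierstrassP (z - p i)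

/-- The potential `Q`. -/
def potential (A : Fin r → ℂ) (B z : ℂ) : ℂ :=
  ∑ i, wt ℓ i * (wt ℓ i + 1) * L.weierstrassP (z - p i) + ∑ i, A i * zetaW L (z - p i) + B

/-- The residue equation at `a_μ`; the summand `ν = μ` of the first sum is `ζ(0) = 0`. -/
def ansatzEq (a : Fin n → ℂ) (h : ℂ) (μ : Fin n) : ℂ :=
  h + ∑ ν, zetaW L (a μ - a ν) - ∑ i, wt ℓ i * zetaW L (a μ - p i)

variable {L p ℓ}

lemma zetaW_sub_comm (x y : ℂ) : zetaW L (y - x) = - zetaW L (x - y) := by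
  rw [← zetaW_neg, neg_sub]

lemma sum_erase_zetaW {ι : Type*} [Fintype ι] [DecidableEq ι] (a : ι → ℂ) (μ : ι) (c : ι → ℂ) :
    ∑ ν ∈ Finset.univ.erase μ, c ν * zetaW L (a μ - a ν) = ∑ ν, c ν * zetaW L (a μ - a ν) :=
  Finset.sum_erase _ (by simp)

/-- Since `∑ n_i = n`, the residue equation at `μ` reads `n (D μ - R μ) + ∑ R ν = 0`, where `D`
collects the interactions and `R` the pole terms. The `D μ` sum to zero by oddness of `ζ`, so the
formula for `h` together with these equations amounts to the more usable system `h + D μ - R μ = 0`.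
-/
lemma isAnsatz_iff (hn : 0 < n) (hsum : ∑ i, ℓ i = 2 * n) {a : Fin n → ℂ} {h : ℂ} :
    IsAnsatz L p ℓ a h ↔ (∀ μ ν, μ ≠ ν → a μ - a ν ∉ L.lattice) ∧
      (∀ μ i, a μ - p i ∉ L.lattice) ∧ ∀ μ, ansatzEq L p ℓ a h μ = 0 := by
  have hn' : (n : ℂ) ≠ 0 := by exact_mod_cast hn.ne'
  set R : Fin n → ℂ := fun μ ↦ ∑ i, wt ℓ i * zetaW L (a μ - p i) with hR
  set D : Fin n → ℂ := fun μ ↦ ∑ ν, zetaW L (a μ - a ν) with hD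
  have hDsum : ∑ μ, D μ = 0 :=
    sum_sum_antisymm Finset.univ (fun μ ν ↦ zetaW L (a μ - a ν)) fun μ ν ↦ zetaW_sub_comm _ _
  have hE : ∀ μ, ansatzEq L p ℓ a h μ = h + D μ - R μ := fun μ ↦ rfl
  have hres : ∀ μ, ∑ i, ∑ ν ∈ Finset.univ.erase μ,
      wt ℓ i * (zetaW L (a μ - a ν) - zetaW L (a μ - p i) + zetaW L (a ν - p i))
        = n * (D μ - R μ) + ∑ ν, R ν := by
    intro μ
    have e : ∀ i, ∑ ν ∈ Finset.univ.erase μ,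
        wt ℓ i * (zetaW L (a μ - a ν) - zetaW L (a μ - p i) + zetaW L (a ν - p i))
        = wt ℓ i * D μ - n * (wt ℓ i * zetaW L (a μ - p i))
          + ∑ ν, wt ℓ i * zetaW L (a ν - p i) := by
      intro i
      rw [Finset.sum_erase _ (by simp)]
      simp only [mul_add, mul_sub, Finset.sum_add_distrib, Finset.sum_sub_distrib, hD,
        Finset.mul_sum, Finset.sum_const, Finset.card_univ, Fintype.card_fin, nsmul_eq_mul]
    simp only [e, Finset.sum_add_distrib, Finset.sum_sub_distrib, ← Finset.sum_mul,
      ← Finset.mul_sum, sum_wt hsum]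
    rw [Finset.sum_comm]
    simp only [hR, Finset.mul_sum, mul_sub]
  constructor
  · rintro ⟨h1, h2, h3, h4⟩
    refine ⟨h1, h2, fun μ ↦ ?_⟩
    have h3' := h3 μ
    rw [hres] at h3'
    have h4' : n * h = ∑ μ, R μ := by rw [h4]; field_simp; rfl
    rw [hE]
    refine (mul_eq_zero.mp ?_).resolve_left hn'
    rw [← h3', ← h4']
    ring
  · rintro ⟨h1, h2, h3⟩
    simp only [hE] at h3
    have h4 : n * h = ∑ μ, R μ := by
      have : ∑ μ, (h + D μ - R μ) = 0 := Finset.sum_eq_zero fun μ _ ↦ h3 μ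
      simp only [Finset.sum_add_distrib, Finset.sum_sub_distrib, hDsum, Finset.sum_const,
        Finset.card_univ, Fintype.card_fin, nsmul_eq_mul] at this
      linear_combination this
    refine ⟨h1, h2, fun μ ↦ ?_, ?_⟩
    · rw [hres, ← h4]
      linear_combination n * h3 μ
    · change h = 1 / (n : ℂ) * ∑ μ, R μ
      rw [← h4]
      field_simp

lemma notMem_add {x : ℂ} (hx : x ∉ L.lattice) (w : L.lattice) : x + w ∉ L.lattice :=
  fun h ↦ hx (by simpa using sub_mem h w.2)

lemma notMem_neg {x y : ℂ} (hx : x - y ∉ L.lattice) : y - x ∉ L.lattice :=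
  fun h ↦ hx (by simpa using neg_mem h)

/-- The interactions contribute `n η(ω_μ) - ∑ η(ω_ν)` and the pole terms `-n η(ω_μ)`, as `∑ n_i =
n`; the shift of `h` compensates exactly what is left. -/
lemma ansatzEq_translate (hsum : ∑ i, ℓ i = 2 * n) {a : Fin n → ℂ} {h : ℂ}
    (h1 : ∀ μ ν, μ ≠ ν → a μ - a ν ∉ L.lattice) (h2 : ∀ μ i, a μ - p i ∉ L.lattice)
    (σ : Equiv.Perm (Fin n)) (ω : Fin n → L.lattice) (μ : Fin n) :
    ansatzEq L p ℓ (fun μ ↦ a (σ μ) + ω μ) (h + ∑ μ, quasiPeriod L (ω μ)) μ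
      = ansatzEq L p ℓ a h (σ μ) := by
  have e1 : ∀ ν, zetaW L (a (σ μ) + ω μ - (a (σ ν) + ω ν))
      = zetaW L (a (σ μ) - a (σ ν)) + (quasiPeriod L (ω μ) - quasiPeriod L (ω ν)) := by
    intro ν
    by_cases hν : μ = ν
    · simp [hν]
    · have := zetaW_add_coe L (ω μ - ω ν) (h1 (σ μ) (σ ν) (by simpa using hν))
      rw [map_sub] at this
      rw [← this]
      congr 1
      push_cast
      ring
  have e2 : ∀ i, zetaW L (a (σ μ) + ω μ - p i)
      = zetaW L (a (σ μ) - p i) + quasiPeriod L (ω μ) := by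
    intro i
    rw [← zetaW_add_coe L (ω μ) (h2 (σ μ) i)]
    congr 1
    ring
  simp only [ansatzEq, e1, e2, mul_add, Finset.sum_add_distrib, Finset.sum_sub_distrib,
    ← Finset.sum_mul, sum_wt hsum, Finset.sum_const, Finset.card_univ, Fintype.card_fin,
    nsmul_eq_mul, Equiv.sum_comp σ (fun ν ↦ zetaW L (a (σ μ) - a ν))]
  ring

lemma IsAnsatz.translate (hn : 0 < n) (hsum : ∑ i, ℓ i = 2 * n) {a : Fin n → ℂ} {h : ℂ}
    (H : IsAnsatz L p ℓ a h) (σ : Equiv.Perm (Fin n)) (ω : Fin n → L.lattice) :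
    IsAnsatz L p ℓ (fun μ ↦ a (σ μ) + ω μ) (h + ∑ μ, quasiPeriod L (ω μ)) := by
  rw [isAnsatz_iff hn hsum] at H ⊢
  obtain ⟨h1, h2, h3⟩ := H
  refine ⟨fun μ ν hμ ↦ ?_, fun μ i ↦ ?_, fun μ ↦ ?_⟩
  · have := notMem_add (h1 (σ μ) (σ ν) (by simpa using hμ)) (ω μ - ω ν)
    convert this using 1
    push_cast
    ring_nf
  · have := notMem_add (h2 (σ μ) i) (ω μ)
    convert this using 1
    ring_nf
  · rw [ansatzEq_translate hsum h1 h2, h3]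

lemma IsAccessory.translate {a : Fin n → ℂ} {h : ℂ} (h2 : ∀ μ i, a μ - p i ∉ L.lattice)
    {A : Fin r → ℂ} {B : ℂ} (H : IsAccessory L p ℓ a h A B)
    (σ : Equiv.Perm (Fin n)) (ω : Fin n → L.lattice) :
    IsAccessory L p ℓ (fun μ ↦ a (σ μ) + ω μ) (h + ∑ μ, quasiPeriod L (ω μ)) A B := by
  intro i
  have e1 : ∀ μ, p i - (a (σ μ) + ω μ) = p i - a (σ μ) + ((-ω μ : L.lattice) : ℂ) := by
    intro μ; push_cast; ring
  have e2 : ∀ μ, zetaW L (p i - (a (σ μ) + ω μ))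
      = zetaW L (p i - a (σ μ)) - quasiPeriod L (ω μ) := by
    intro μ
    rw [e1, zetaW_add_coe L _ (notMem_neg (h2 (σ μ) i)), map_neg]
    ring
  have e3 : ∀ μ, L.weierstrassP (p i - (a (σ μ) + ω μ)) = L.weierstrassP (p i - a (σ μ)) := by
    intro μ
    rw [e1, L.weierstrassP_add_coe]
  obtain ⟨h3, h4⟩ := H i
  constructor
  · rw [h3]
    simp only [e2, Finset.sum_sub_distrib, Equiv.sum_comp σ (fun μ ↦ zetaW L (p i - a μ))]
    ring
  · simp only [e3, Equiv.sum_comp σ (fun μ ↦ L.weierstrassP (p i - a μ))]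
    exact h4

/-- Multiplying the formula for `A_i` by `ℓ_i` and summing, the terms in `p_i - p_j` cancel by
antisymmetry, and the formula for `h` makes the remaining terms cancel. -/
lemma sum_accessory_eq_zero (hn : 0 < n) (hsum : ∑ i, ℓ i = 2 * n) (hℓ : ∀ i, 0 < ℓ i)
    {a : Fin n → ℂ} {h : ℂ} (H : IsAnsatz L p ℓ a h) {A : Fin r → ℂ}
    (hA : ∀ i, A i / (ℓ i : ℂ) = - (∑ μ, zetaW L (p i - a μ))
      + ∑ j ∈ Finset.univ.erase i, wt ℓ j * zetaW L (p i - p j) - h) : ∑ i, A i = 0 := by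
  have hn' : (n : ℂ) ≠ 0 := by exact_mod_cast hn.ne'
  have e : ∀ i, A i = 2 * (∑ μ, wt ℓ i * zetaW L (a μ - p i)
      + ∑ j, wt ℓ i * (wt ℓ j * zetaW L (p i - p j)) - wt ℓ i * h) := by
    intro i
    have h0 : (ℓ i : ℂ) ≠ 0 := by exact_mod_cast (hℓ i).ne'
    have := hA i
    rw [div_eq_iff h0, sum_erase_zetaW p i (wt ℓ)] at this
    rw [this, ← two_mul_wt ℓ i, ← Finset.mul_sum, ← Finset.mul_sum]
    have : ∑ μ, zetaW L (p i - a μ) = - ∑ μ, zetaW L (a μ - p i) := by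
      rw [← Finset.sum_neg_distrib]
      exact Finset.sum_congr rfl fun μ _ ↦ zetaW_sub_comm _ _
    rw [this]
    ring
  have h1 : ∑ i, ∑ j, wt ℓ i * (wt ℓ j * zetaW L (p i - p j)) = 0 := by
    refine sum_sum_antisymm Finset.univ _ fun i j ↦ ?_
    rw [zetaW_sub_comm]
    ring
  have h2 : ∑ i, ∑ μ, wt ℓ i * zetaW L (a μ - p i) = n * h := by
    rw [Finset.sum_comm, H.h_eq]
    field_simp
  simp only [e, ← Finset.mul_sum, Finset.sum_sub_distrib, Finset.sum_add_distrib]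
  rw [← Finset.sum_mul, sum_wt hsum]
  simp only [Finset.mul_sum] at h1 h2 ⊢
  rw [h1, h2]
  ring

end Ansatz

end

end GLame

namespace GLame

noncomputable section

/-! ### Liouville's theorem for elliptic functions with removable singularities -/

lemma exists_norm_le_lattice_translate (L : PeriodPair) :
    ∃ R : ℝ, ∀ z : ℂ, ∃ ω : L.lattice, ‖z + ω‖ ≤ R := by
  refine ⟨∑ i, ‖L.basis i‖, fun z ↦ ?_⟩
  have hmem : ((ZSpan.floor L.basis z : Submodule.span ℤ (Set.range L.basis)) : ℂ) ∈ L.lattice := by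
    rw [L.lattice_eq_span_range_basis]
    exact (ZSpan.floor L.basis z).2
  refine ⟨-⟨_, hmem⟩, ?_⟩
  have := ZSpan.norm_fract_le L.basis z
  rwa [ZSpan.fract_apply, sub_eq_add_neg] at this

/-- Values of `D` at its singular points are arbitrary, so hypotheses and conclusion are stated on
punctured neighbourhoods. The local extensions glue to an entire function, bounded by periodicity,
and Liouville's theorem applies. -/
lemma elliptic_eq_const (L : PeriodPair) {D : ℂ → ℂ}
    (hper : ∀ (ω : L.lattice) (z : ℂ), ∀ᶠ x in 𝓝[≠] z, D (x + ω) = D x)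
    (hreg : ∀ z, ∃ g : ℂ → ℂ, AnalyticAt ℂ g z ∧ D =ᶠ[𝓝[≠] z] g) :
    ∃ c, ∀ z, ∀ᶠ x in 𝓝[≠] z, D x = c := by
  choose g hg hDg using hreg
  -- The corrected function: at each point, the value of the extension chosen there. By `key` it
  -- does not depend on the choice.
  set F : ℂ → ℂ := fun z ↦ g z z with hF
  have key : ∀ z (f : ℂ → ℂ), ContinuousAt f z → D =ᶠ[𝓝[≠] z] f → F z = f z := by
    intro z f hf h
    have h1 : Tendsto (g z) (𝓝[≠] z) (𝓝 (g z z)) :=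
      (hg z).continuousAt.tendsto.mono_left inf_le_left
    have h2 : Tendsto f (𝓝[≠] z) (𝓝 (f z)) := hf.tendsto.mono_left inf_le_left
    exact tendsto_nhds_unique (h1.congr' ((hDg z).symm.trans h)) h2
  have hFg : ∀ z, F =ᶠ[𝓝 z] g z := by
    intro z
    have h1 : ∀ᶠ x in 𝓝 z, AnalyticAt ℂ (g z) x := (hg z).eventually_analyticAt
    have h2 : ∀ᶠ x in 𝓝 z, x ≠ z → ∀ᶠ y in 𝓝[≠] x, D y = g z y := by
      have h := eventually_nhdsWithin_iff.mp (hDg z)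
      filter_upwards [h.eventually_nhds] with x hx hne
      refine eventually_nhdsWithin_of_eventually_nhds ?_
      filter_upwards [hx, isOpen_ne.mem_nhds hne] with y hy hy'
      exact hy hy'
    filter_upwards [h1, h2] with x h3 h4
    by_cases hx : x = z
    · rw [hx]
    · exact key x _ h3.continuousAt (h4 hx)
  have hdiff : Differentiable ℂ F := fun z ↦
    ((hg z).congr (hFg z).symm).differentiableAt
  have hDF : ∀ z, D =ᶠ[𝓝[≠] z] F := fun z ↦
    (hDg z).trans ((hFg z).filter_mono inf_le_left).symm
  have hperF : ∀ (ω : L.lattice) z, F (z + ω) = F z := by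
    intro ω z
    refine (key z (fun x ↦ F (x + ω)) ?_ ?_).symm
    · exact (hdiff.continuous.comp (continuous_add_const _)).continuousAt
    · have ht : Tendsto (fun x ↦ x + (ω : ℂ)) (𝓝[≠] z) (𝓝[≠] (z + ω)) := by
        refine tendsto_nhdsWithin_iff.mpr ⟨?_, ?_⟩
        · exact ((continuous_add_const _).tendsto z).mono_left inf_le_left
        · filter_upwards [self_mem_nhdsWithin] with x hx
          simpa using hx
      filter_upwards [hper ω z, ht.eventually (hDF (z + ω))] with x h1 h2
      rw [← h1, h2]
  obtain ⟨R, hR⟩ := exists_norm_le_lattice_translate L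
  have hbdd : Bornology.IsBounded (Set.range F) := by
    refine ((isCompact_closedBall (0 : ℂ) R).image hdiff.continuous).isBounded.subset ?_
    rintro _ ⟨z, rfl⟩
    obtain ⟨ω, hω⟩ := hR z
    exact ⟨z + ω, by simpa using hω, hperF ω z⟩
  refine ⟨F 0, fun z ↦ ?_⟩
  filter_upwards [hDF z] with x hx
  rw [hx, hdiff.apply_eq_apply_of_bounded hbdd x 0]

/-! ### The equation solved by the ansatz -/

variable {r n : ℕ} {L : PeriodPair} {p : Fin r → ℂ} {ℓ : Fin r → ℕ}

lemma eventually_notMem_lattice (L : PeriodPair) (z c : ℂ) : ∀ᶠ x in 𝓝[≠] z, x - c ∉ L.lattice := by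
  have h : ((L.lattice : Set ℂ) \ {z - c})ᶜ ∈ 𝓝 (z - c) :=
    L.compl_lattice_sdiff_singleton_mem_nhds _
  have hc : Tendsto (fun x : ℂ ↦ x - c) (𝓝 z) (𝓝 (z - c)) :=
    (continuous_sub_right c).tendsto z
  filter_upwards [(hc.eventually h).filter_mono inf_le_left, self_mem_nhdsWithin] with x hx hne
  intro hmem
  exact hx ⟨hmem, by simpa using hne⟩

lemma eventually_generic (L : PeriodPair) (a : Fin n → ℂ) (p : Fin r → ℂ) (z : ℂ) :
    ∀ᶠ x in 𝓝[≠] z, (∀ μ, x - a μ ∉ L.lattice) ∧ ∀ i, x - p i ∉ L.lattice :=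
  (eventually_all.mpr fun μ ↦ eventually_notMem_lattice L z (a μ)).and
    (eventually_all.mpr fun i ↦ eventually_notMem_lattice L z (p i))

lemma hasDerivAt_logDerivAnsatz {a : Fin n → ℂ} {h z : ℂ} (h1 : ∀ μ, z - a μ ∉ L.lattice)
    (h2 : ∀ i, z - p i ∉ L.lattice) :
    HasDerivAt (logDerivAnsatz L p ℓ a h) (logDerivAnsatz' L p ℓ a z) z := by
  have e1 : HasDerivAt (fun z ↦ ∑ μ, zetaW L (z - a μ)) (∑ μ, - L.weierstrassP (z - a μ)) z :=
    HasDerivAt.fun_sum fun μ _ ↦ (hasDerivAt_zetaW L (h1 μ)).comp_sub_const z (a μ)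
  have e2 : HasDerivAt (fun z ↦ ∑ i, wt ℓ i * zetaW L (z - p i))
      (∑ i, wt ℓ i * - L.weierstrassP (z - p i)) z :=
    HasDerivAt.fun_sum fun i _ ↦ ((hasDerivAt_zetaW L (h2 i)).comp_sub_const z (p i)).const_mul _
  refine ((e1.const_add h).sub e2).congr_deriv ?_
  simp [logDerivAnsatz', Finset.sum_neg_distrib]

/-- The difference `y' + y² - Q`. -/
def riccatiDefect (L : PeriodPair) (p : Fin r → ℂ) (ℓ : Fin r → ℕ) (a : Fin n → ℂ) (h : ℂ)
    (A : Fin r → ℂ) (B z : ℂ) : ℂ :=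
  logDerivAnsatz' L p ℓ a z + logDerivAnsatz L p ℓ a h z ^ 2 - potential L p ℓ A B z

/-- The quasi-periods cancel in `y` because there are `n = ∑ n_i` zeros, and in `Q` because `∑ A_i =
0`. -/
lemma riccatiDefect_add_coe (hsum : ∑ i, ℓ i = 2 * n) {a : Fin n → ℂ} {h z : ℂ}
    (h1 : ∀ μ, z - a μ ∉ L.lattice) (h2 : ∀ i, z - p i ∉ L.lattice) {A : Fin r → ℂ} {B : ℂ}
    (hA : ∑ i, A i = 0) (ω : L.lattice) :
    riccatiDefect L p ℓ a h A B (z + ω) = riccatiDefect L p ℓ a h A B z := by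
  have e : ∀ c : ℂ, z + ω - c = z - c + ω := fun c ↦ by ring
  have e1 : ∀ μ, zetaW L (z + ω - a μ) = zetaW L (z - a μ) + quasiPeriod L ω := fun μ ↦ by
    rw [e, zetaW_add_coe L ω (h1 μ)]
  have e2 : ∀ i, zetaW L (z + ω - p i) = zetaW L (z - p i) + quasiPeriod L ω := fun i ↦ by
    rw [e, zetaW_add_coe L ω (h2 i)]
  have e3 : ∀ c, L.weierstrassP (z + ω - c) = L.weierstrassP (z - c) := fun c ↦ by
    rw [e, L.weierstrassP_add_coe]
  simp only [riccatiDefect, logDerivAnsatz, logDerivAnsatz', potential, e1, e2, e3, mul_add,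
    Finset.sum_add_distrib, ← Finset.sum_mul, sum_wt hsum, hA, Finset.sum_const, Finset.card_univ,
    Fintype.card_fin, nsmul_eq_mul]
  ring

lemma zetaW_eq' (x c : ℂ) : zetaW L (x - c) = 1 / (x - c) + zetaWReg L (x - c) := by
  rw [zetaW_eq, add_comm]

lemma analyticAt_zetaW_sub {z c : ℂ} (hz : z - c ∉ L.lattice) :
    AnalyticAt ℂ (fun x ↦ zetaW L (x - c)) z :=
  (analyticAt_zetaW L hz).comp (f := fun x ↦ x - c) (by fun_prop)

lemma analyticAt_weierstrassP_sub {z c : ℂ} (hz : z - c ∉ L.lattice) :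
    AnalyticAt ℂ (fun x ↦ L.weierstrassP (x - c)) z :=
  (analyticAt_weierstrassP L hz).comp (f := fun x ↦ x - c) (by fun_prop)

lemma analyticAt_potential {A : Fin r → ℂ} {B z : ℂ} (h2 : ∀ i, z - p i ∉ L.lattice) :
    AnalyticAt ℂ (potential L p ℓ A B) z := by
  refine .add (.add (Finset.analyticAt_fun_sum _ fun i _ ↦ ?_)
    (Finset.analyticAt_fun_sum _ fun i _ ↦ ?_)) analyticAt_const
  · exact analyticAt_const.mul (analyticAt_weierstrassP_sub (h2 i))
  · exact analyticAt_const.mul (analyticAt_zetaW_sub (h2 i))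

/-- The regular part of the logarithmic derivative at `a_μ`. -/
def ansatzRegA (L : PeriodPair) (p : Fin r → ℂ) (ℓ : Fin r → ℕ) (a : Fin n → ℂ) (h : ℂ)
    (μ : Fin n) (z : ℂ) : ℂ :=
  h + (zetaWReg L (z - a μ) + ∑ ν ∈ Finset.univ.erase μ, zetaW L (z - a ν))
    - ∑ i, wt ℓ i * zetaW L (z - p i)

/-- The regular part of the logarithmic derivative at `p_i`, in the coordinate `u = z - p_i`. -/
def ansatzRegP (L : PeriodPair) (p : Fin r → ℂ) (ℓ : Fin r → ℕ) (a : Fin n → ℂ) (h : ℂ)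
    (i : Fin r) (u : ℂ) : ℂ :=
  h + ∑ μ, zetaW L (p i - a μ + u)
    - (wt ℓ i * zetaWReg L u + ∑ j ∈ Finset.univ.erase i, wt ℓ j * zetaW L (p i - p j + u))

lemma logDerivAnsatz_eq_regA (a : Fin n → ℂ) (h : ℂ) (μ : Fin n) (z : ℂ) :
    logDerivAnsatz L p ℓ a h z = 1 / (z - a μ) + ansatzRegA L p ℓ a h μ z := by
  rw [logDerivAnsatz, ansatzRegA, ← Finset.add_sum_erase _ _ (Finset.mem_univ μ), zetaW_eq']
  ring

lemma logDerivAnsatz_eq_regP (a : Fin n → ℂ) (h : ℂ) (i : Fin r) (u : ℂ) :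
    logDerivAnsatz L p ℓ a h (p i + u) = - wt ℓ i / u + ansatzRegP L p ℓ a h i u := by
  have e : ∀ c : ℂ, p i + u - c = p i - c + u := fun c ↦ by ring
  rw [logDerivAnsatz, ansatzRegP, ← Finset.add_sum_erase _ _ (Finset.mem_univ i)]
  simp only [e, sub_self, zero_add]
  rw [zetaW_eq]
  ring

lemma potential_eq_regularPart (A : Fin r → ℂ) (B : ℂ) (i : Fin r) (u : ℂ) :
    potential L p ℓ A B (p i + u)
      = wt ℓ i * (wt ℓ i + 1) / u ^ 2 + A i / u + regularPart L p ℓ i A B u := by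
  have e : ∀ c : ℂ, p i + u - c = p i - c + u := fun c ↦ by ring
  rw [potential, regularPart, ← Finset.add_sum_erase _ _ (Finset.mem_univ i),
    ← Finset.add_sum_erase _ (fun i ↦ A i * _) (Finset.mem_univ i)]
  simp only [e, sub_self, zero_add, Finset.sum_add_distrib]
  rw [zetaW_eq, weierstrassP_eq]
  ring

lemma analyticAt_ansatzRegA {a : Fin n → ℂ} {h : ℂ} {μ : Fin n}
    (h1 : ∀ ν, μ ≠ ν → a μ - a ν ∉ L.lattice) (h2 : ∀ i, a μ - p i ∉ L.lattice) :
    AnalyticAt ℂ (ansatzRegA L p ℓ a h μ) (a μ) := by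
  refine .sub (.add analyticAt_const (.add ?_ (Finset.analyticAt_fun_sum _ fun ν hν ↦ ?_)))
    (Finset.analyticAt_fun_sum _ fun i _ ↦ analyticAt_const.mul (analyticAt_zetaW_sub (h2 i)))
  · exact AnalyticAt.comp_of_eq (g := zetaWReg L) (f := fun x ↦ x - a μ) (analyticAt_zetaWReg L)
      (by fun_prop) (by simp)
  · exact analyticAt_zetaW_sub (h1 ν (Finset.ne_of_mem_erase hν).symm)

lemma analyticAt_zetaW_add {c : ℂ} (hz : c ∉ L.lattice) :
    AnalyticAt ℂ (fun x ↦ zetaW L (c + x)) 0 :=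
  AnalyticAt.comp_of_eq (g := zetaW L) (f := fun x ↦ c + x) (analyticAt_zetaW L hz)
    (by fun_prop) (by simp)

lemma analyticAt_ansatzRegP (hp : ∀ i j, i ≠ j → p i - p j ∉ L.lattice)
    {a : Fin n → ℂ} {h : ℂ} {i : Fin r} (h2 : ∀ μ, a μ - p i ∉ L.lattice) :
    AnalyticAt ℂ (ansatzRegP L p ℓ a h i) 0 := by
  refine .sub (.add analyticAt_const (Finset.analyticAt_fun_sum _ fun μ _ ↦ ?_))
    (.add (analyticAt_const.mul (analyticAt_zetaWReg L))
      (Finset.analyticAt_fun_sum _ fun j hj ↦ ?_))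
  · exact analyticAt_zetaW_add (notMem_neg (h2 μ))
  · exact analyticAt_const.mul (analyticAt_zetaW_add (hp i j (Finset.ne_of_mem_erase hj).symm))

lemma analyticAt_weierstrassP_add {c : ℂ} (hz : c ∉ L.lattice) :
    AnalyticAt ℂ (fun x ↦ L.weierstrassP (c + x)) 0 :=
  AnalyticAt.comp_of_eq (g := L.weierstrassP) (f := fun x ↦ c + x) (analyticAt_weierstrassP L hz)
    (by fun_prop) (by simp)

lemma analyticAt_regularPart (hp : ∀ i j, i ≠ j → p i - p j ∉ L.lattice) (i : Fin r)
    (A : Fin r → ℂ) (B : ℂ) : AnalyticAt ℂ (regularPart L p ℓ i A B) 0 := by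
  refine .add (.add (.add (analyticAt_const.mul (L.analyticAt_weierstrassPExcept 0))
    (analyticAt_const.mul (analyticAt_zetaWReg L))) (Finset.analyticAt_fun_sum _ fun j hj ↦ ?_))
    analyticAt_const
  have := hp i j (Finset.ne_of_mem_erase hj).symm
  exact .add (analyticAt_const.mul (analyticAt_weierstrassP_add this))
    (analyticAt_const.mul (analyticAt_zetaW_add this))

lemma ansatzRegP_zero (a : Fin n → ℂ) (h : ℂ) (i : Fin r) :
    ansatzRegP L p ℓ a h i 0 = h + ∑ μ, zetaW L (p i - a μ)
      - ∑ j ∈ Finset.univ.erase i, wt ℓ j * zetaW L (p i - p j) := by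
  simp [ansatzRegP]

lemma deriv_ansatzRegP_zero (hp : ∀ i j, i ≠ j → p i - p j ∉ L.lattice)
    {a : Fin n → ℂ} {h : ℂ} {i : Fin r} (h2 : ∀ μ, a μ - p i ∉ L.lattice) :
    deriv (ansatzRegP L p ℓ a h i) 0 = - ∑ μ, L.weierstrassP (p i - a μ)
      + ∑ j ∈ Finset.univ.erase i, wt ℓ j * L.weierstrassP (p i - p j) := by
  have d : ∀ c : ℂ, c ∉ L.lattice →
      HasDerivAt (fun u ↦ zetaW L (c + u)) (- L.weierstrassP c) 0 := fun c hc ↦ by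
    have := (hasDerivAt_zetaW L (z := c + 0) (by simpa using hc)).comp_const_add c 0
    simpa using this
  have e1 : HasDerivAt (fun u ↦ ∑ μ, zetaW L (p i - a μ + u))
      (∑ μ, - L.weierstrassP (p i - a μ)) 0 :=
    HasDerivAt.fun_sum fun μ _ ↦ d _ (notMem_neg (h2 μ))
  have e2 : HasDerivAt (fun u ↦ ∑ j ∈ Finset.univ.erase i, wt ℓ j * zetaW L (p i - p j + u))
      (∑ j ∈ Finset.univ.erase i, wt ℓ j * - L.weierstrassP (p i - p j)) 0 :=
    HasDerivAt.fun_sum fun j hj ↦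
      (d _ (hp i j (Finset.ne_of_mem_erase hj).symm)).const_mul _
  have e3 : HasDerivAt (fun u ↦ wt ℓ i * zetaWReg L u) 0 0 := by
    simpa using (hasDerivAt_zetaWReg L (z := 0) (by simp)).const_mul (wt ℓ i)
  refine (((e1.const_add h).sub (e3.add e2)).congr_deriv ?_).deriv
  simp [Finset.sum_neg_distrib]

lemma dslope_mul_eq {f : ℂ → ℂ} {c x : ℂ} (hx : x ≠ c) :
    dslope f c x = (f x - f c) / (x - c) := by
  rw [dslope_of_ne _ hx, slope_def_field]

lemma analyticAt_dslope {f : ℂ → ℂ} {c : ℂ} (hf : AnalyticAt ℂ f c) :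
    AnalyticAt ℂ (dslope f c) c := by
  obtain ⟨p, hp⟩ := hf
  exact ⟨_, hp.has_fpower_series_dslope_fslope⟩

/-- With `y = 1/(x - a_μ) + ρ` the double poles of `y'` and `y²` cancel. What remains singular is
`2ρ/(x - a_μ)`, and it is regular since the residue equation says `ρ(a_μ) = 0`. -/
lemma riccatiDefect_near_zero {a : Fin n → ℂ} {h : ℂ} (A : Fin r → ℂ)
    (B : ℂ) {μ : Fin n} (h1 : ∀ ν, μ ≠ ν → a μ - a ν ∉ L.lattice)
    (h2 : ∀ i, a μ - p i ∉ L.lattice) (h3 : ansatzEq L p ℓ a h μ = 0) :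
    ∃ g : ℂ → ℂ, AnalyticAt ℂ g (a μ) ∧ riccatiDefect L p ℓ a h A B =ᶠ[𝓝[≠] (a μ)] g := by
  have hρ := analyticAt_ansatzRegA (ℓ := ℓ) (h := h) h1 h2
  have hρ0 : ansatzRegA L p ℓ a h μ (a μ) = 0 := by
    rw [← h3, ansatzRegA, ansatzEq, Finset.sum_erase _ (by simp)]
    simp
  set ρ := ansatzRegA L p ℓ a h μ with hρdef
  refine ⟨fun x ↦ deriv ρ x + ρ x ^ 2 + 2 * dslope ρ (a μ) x - potential L p ℓ A B x,
    ((hρ.deriv.add (hρ.pow 2)).add (analyticAt_const.mul (analyticAt_dslope hρ))).sub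
      (analyticAt_potential h2), ?_⟩
  filter_upwards [eventually_generic L a p (a μ), self_mem_nhdsWithin,
    hρ.eventually_analyticAt.filter_mono inf_le_left] with x hx hne hρx
  have hne' : x - a μ ≠ 0 := sub_ne_zero.mpr hne
  have hd : HasDerivAt (logDerivAnsatz L p ℓ a h) (-(1 / (x - a μ) ^ 2) + deriv ρ x) x := by
    have h4 := ((hasDerivAt_id x).sub_const (a μ)).inv hne'
    refine ((h4.add hρx.differentiableAt.hasDerivAt).congr_deriv ?_).congr_of_eventuallyEq
      (.of_forall fun y ↦ ?_)
    · simp [neg_div]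
    · rw [logDerivAnsatz_eq_regA a h μ y]
      simp [hρdef]
  rw [riccatiDefect, (hasDerivAt_logDerivAnsatz hx.1 hx.2).unique hd,
    logDerivAnsatz_eq_regA a h μ x, dslope_mul_eq hne, hρ0, ← hρdef]
  field_simp
  ring

/-- With `y = -n_i/u + ρ` the double pole of `y' + y²` is `n_i(n_i+1)/u²`, as in `Q`. The simple
pole `-ℓ_i ρ(0)/u` is matched by the value of `A_i`, and `-ℓ_i (ρ - ρ(0))/u` survives as the
`dslope` term. -/
lemma riccatiDefect_near_pole (hp : ∀ i j, i ≠ j → p i - p j ∉ L.lattice)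
    {a : Fin n → ℂ} {h : ℂ} (A : Fin r → ℂ) (B : ℂ) {i : Fin r} (h2 : ∀ μ, a μ - p i ∉ L.lattice)
    (hA : A i = - (ℓ i * ansatzRegP L p ℓ a h i 0)) :
    (fun u ↦ riccatiDefect L p ℓ a h A B (p i + u)) =ᶠ[𝓝[≠] 0] fun u ↦
      deriv (ansatzRegP L p ℓ a h i) u + ansatzRegP L p ℓ a h i u ^ 2
        - ℓ i * dslope (ansatzRegP L p ℓ a h i) 0 u - regularPart L p ℓ i A B u := by
  have hρ := analyticAt_ansatzRegP (ℓ := ℓ) (h := h) hp h2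
  set ρ := ansatzRegP L p ℓ a h i with hρdef
  have ht : Tendsto (fun u ↦ p i + u) (𝓝[≠] 0) (𝓝[≠] (p i)) := by
    refine tendsto_nhdsWithin_iff.mpr ⟨?_, ?_⟩
    · have : Tendsto (fun u ↦ p i + u) (𝓝 0) (𝓝 (p i + 0)) := (continuous_const_add (p i)).tendsto 0
      rw [add_zero] at this
      exact this.mono_left inf_le_left
    · filter_upwards [self_mem_nhdsWithin] with x hx
      simpa using hx
  filter_upwards [ht.eventually (eventually_generic L a p (p i)), self_mem_nhdsWithin,
    hρ.eventually_analyticAt.filter_mono inf_le_left] with u hu hne hρu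
  have hne' : u ≠ 0 := hne
  have hd : HasDerivAt (logDerivAnsatz L p ℓ a h) (wt ℓ i / u ^ 2 + deriv ρ u) (p i + u) := by
    have h4 : HasDerivAt (fun x ↦ - wt ℓ i / x + ρ x) (wt ℓ i / u ^ 2 + deriv ρ u) u := by
      refine (((hasDerivAt_inv hne').const_mul (- wt ℓ i)).add
        hρu.differentiableAt.hasDerivAt).congr_deriv ?_
      simp [div_eq_mul_inv]
    have h5 : HasDerivAt (fun x ↦ - wt ℓ i / (x - p i) + ρ (x - p i))
        (wt ℓ i / u ^ 2 + deriv ρ u) (p i + u) := by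
      have := HasDerivAt.comp_sub_const (f := fun x ↦ - wt ℓ i / x + ρ x) (p i + u) (p i)
        (by simpa using h4)
      exact this
    refine h5.congr_of_eventuallyEq (.of_forall fun y ↦ ?_)
    have := logDerivAnsatz_eq_regP (L := L) (p := p) (ℓ := ℓ) a h i (y - p i)
    rwa [add_sub_cancel] at this
  rw [riccatiDefect, (hasDerivAt_logDerivAnsatz hu.1 hu.2).unique hd,
    logDerivAnsatz_eq_regP a h i u, dslope_mul_eq hne, potential_eq_regularPart, hA,
    ← hρdef, sub_zero, ← two_mul_wt]
  field_simp
  ring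

lemma regularPart_zero (A : Fin r → ℂ) (B : ℂ) (i : Fin r) :
    regularPart L p ℓ i A B 0 = ∑ j ∈ Finset.univ.erase i,
      (wt ℓ j * (wt ℓ j + 1) * L.weierstrassP (p i - p j) + A j * zetaW L (p i - p j)) + B := by
  simp [regularPart]

lemma accessory_residue_iff (hℓ : ∀ i, 0 < ℓ i) (a : Fin n → ℂ) (h : ℂ) (A : Fin r → ℂ)
    (i : Fin r) :
    A i / (ℓ i : ℂ) = - (∑ μ, zetaW L (p i - a μ))
      + ∑ j ∈ Finset.univ.erase i, wt ℓ j * zetaW L (p i - p j) - h ↔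
    A i = - (ℓ i * ansatzRegP L p ℓ a h i 0) := by
  have h0 : (ℓ i : ℂ) ≠ 0 := by exact_mod_cast (hℓ i).ne'
  rw [div_eq_iff h0, ansatzRegP_zero]
  constructor <;> intro h <;> rw [h] <;> ring

/-- The value at `p_i` of the regular extension of `y' + y² - Q`. -/
lemma accessory_const_iff (hp : ∀ i j, i ≠ j → p i - p j ∉ L.lattice) (hℓ : ∀ i, 0 < ℓ i)
    {a : Fin n → ℂ} {h : ℂ} {A : Fin r → ℂ} {B : ℂ}
    {i : Fin r} (h2 : ∀ μ, a μ - p i ∉ L.lattice)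
    (hA : A i = - (ℓ i * ansatzRegP L p ℓ a h i 0)) :
    (B = A i ^ 2 / (ℓ i : ℂ) ^ 2
      - ∑ j ∈ Finset.univ.erase i, wt ℓ j * (wt ℓ j + ℓ i) * L.weierstrassP (p i - p j)
      - ∑ j ∈ Finset.univ.erase i, A j * zetaW L (p i - p j)
      + ((ℓ i : ℂ) - 1) * ∑ μ, L.weierstrassP (p i - a μ)) ↔
    deriv (ansatzRegP L p ℓ a h i) 0 + ansatzRegP L p ℓ a h i 0 ^ 2
        - ℓ i * dslope (ansatzRegP L p ℓ a h i) 0 0 - regularPart L p ℓ i A B 0 = 0 := by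
  have h0 : (ℓ i : ℂ) ≠ 0 := by exact_mod_cast (hℓ i).ne'
  have hq : ansatzRegP L p ℓ a h i 0 ^ 2 = A i ^ 2 / (ℓ i : ℂ) ^ 2 := by
    rw [hA]; field_simp
  rw [dslope_same, deriv_ansatzRegP_zero hp h2, regularPart_zero, hq]
  simp only [mul_add, add_mul, Finset.sum_add_distrib, mul_one]
  have e : ∀ j, wt ℓ j * ↑(ℓ i) * L.weierstrassP (p i - p j)
      = ℓ i * (wt ℓ j * L.weierstrassP (p i - p j)) := fun j ↦ by ring
  simp only [e, ← Finset.mul_sum]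
  constructor <;> intro h <;> linear_combination -h

/-- The ansatz solves `w'' = Q w`. -/
lemma riccatiDefect_eventually_eq_zero (hn : 0 < n)
    (hp : ∀ i j, i ≠ j → p i - p j ∉ L.lattice) (hℓ : ∀ i, 0 < ℓ i) (hsum : ∑ i, ℓ i = 2 * n)
    {a : Fin n → ℂ} {h : ℂ} (H : IsAnsatz L p ℓ a h) {A : Fin r → ℂ} {B : ℂ}
    (hA : ∀ i, A i = - (ℓ i * ansatzRegP L p ℓ a h i 0)) (i₀ : Fin r)
    (hB : deriv (ansatzRegP L p ℓ a h i₀) 0 + ansatzRegP L p ℓ a h i₀ 0 ^ 2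
        - ℓ i₀ * dslope (ansatzRegP L p ℓ a h i₀) 0 0 - regularPart L p ℓ i₀ A B 0 = 0) (z : ℂ) :
    ∀ᶠ x in 𝓝[≠] z, riccatiDefect L p ℓ a h A B x = 0 := by
  have hA0 : ∑ i, A i = 0 := sum_accessory_eq_zero hn hsum hℓ H
    fun i ↦ (accessory_residue_iff hℓ a h A i).mpr (hA i)
  obtain ⟨h1, h2, h3⟩ := (isAnsatz_iff hn hsum).mp H
  set D := riccatiDefect L p ℓ a h A B with hD
  have hper : ∀ (ω : L.lattice) (z : ℂ), ∀ᶠ x in 𝓝[≠] z, D (x + ω) = D x := by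
    intro ω z
    filter_upwards [eventually_generic L a p z] with x hx
    exact riccatiDefect_add_coe hsum hx.1 hx.2 hA0 ω
  have hpole : ∀ i, AnalyticAt ℂ (fun u ↦
      deriv (ansatzRegP L p ℓ a h i) u + ansatzRegP L p ℓ a h i u ^ 2
        - ℓ i * dslope (ansatzRegP L p ℓ a h i) 0 u - regularPart L p ℓ i A B u) 0 := by
    intro i
    have hρ := analyticAt_ansatzRegP (ℓ := ℓ) (h := h) hp (fun μ ↦ h2 μ i)
    exact ((hρ.deriv.add (hρ.pow 2)).sub (analyticAt_const.mul (analyticAt_dslope hρ))).sub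
      (analyticAt_regularPart hp i A B)
  have hsub : ∀ z c : ℂ, Tendsto (fun x ↦ x - c) (𝓝[≠] z) (𝓝[≠] (z - c)) := by
    intro z c
    refine tendsto_nhdsWithin_iff.mpr ⟨?_, ?_⟩
    · exact ((continuous_sub_right c).tendsto z).mono_left inf_le_left
    · filter_upwards [self_mem_nhdsWithin] with x hx
      simpa using hx
  -- Periodicity reduces the regularity of `D` at all singular points to the points `a_μ` and `p_i`
  -- themselves.
  have hshift : ∀ (c : ℂ) (ω : L.lattice), (∃ g : ℂ → ℂ, AnalyticAt ℂ g c ∧ D =ᶠ[𝓝[≠] c] g) →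
      ∃ g : ℂ → ℂ, AnalyticAt ℂ g (c + ω) ∧ D =ᶠ[𝓝[≠] (c + ω)] g := by
    rintro c ω ⟨g, hg, hDg⟩
    refine ⟨fun x ↦ g (x - ω), AnalyticAt.comp_of_eq (g := g) (f := fun x ↦ x - (ω : ℂ))
      hg (by fun_prop) (by simp), ?_⟩
    have ht := hsub (c + ω) ω
    rw [add_sub_cancel_right] at ht
    filter_upwards [ht.eventually hDg, hper (-ω) (c + ω)] with x hx hx'
    rw [← hx, ← hx']
    simp [sub_eq_add_neg]
  have hreg : ∀ z, ∃ g : ℂ → ℂ, AnalyticAt ℂ g z ∧ D =ᶠ[𝓝[≠] z] g := by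
    intro z
    by_cases hz1 : ∃ μ, z - a μ ∈ L.lattice
    · obtain ⟨μ, hμ⟩ := hz1
      have := hshift (a μ) ⟨_, hμ⟩ (riccatiDefect_near_zero A B (h1 μ) (h2 μ) (h3 μ))
      simpa using this
    by_cases hz2 : ∃ i, z - p i ∈ L.lattice
    · obtain ⟨i, hi⟩ := hz2
      refine (?_ : z = p i + (⟨z - p i, hi⟩ : L.lattice)) ▸ hshift (p i) ⟨_, hi⟩ ?_
      · simp
      refine ⟨_, AnalyticAt.comp_of_eq (f := fun x ↦ x - p i) (hpole i) (by fun_prop) (by simp), ?_⟩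
      have ht := hsub (p i) (p i)
      rw [sub_self] at ht
      filter_upwards [ht.eventually (riccatiDefect_near_pole hp A B (fun μ ↦ h2 μ i) (hA i))]
        with x hx
      rw [add_sub_cancel] at hx
      exact hx
    · push Not at hz1 hz2
      refine ⟨fun x ↦ deriv (logDerivAnsatz L p ℓ a h) x + logDerivAnsatz L p ℓ a h x ^ 2
        - potential L p ℓ A B x, ?_, ?_⟩
      · have hy : AnalyticAt ℂ (logDerivAnsatz L p ℓ a h) z := by
          refine .sub (.add analyticAt_const (Finset.analyticAt_fun_sum _ fun μ _ ↦ ?_))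
            (Finset.analyticAt_fun_sum _ fun i _ ↦ analyticAt_const.mul ?_)
          · exact analyticAt_zetaW_sub (hz1 μ)
          · exact analyticAt_zetaW_sub (hz2 i)
        exact (hy.deriv.add (hy.pow 2)).sub (analyticAt_potential hz2)
      · filter_upwards [eventually_generic L a p z] with x hx
        rw [hD, riccatiDefect, (hasDerivAt_logDerivAnsatz hx.1 hx.2).deriv]
  -- The constant is read off at `p_{i₀}`, where `hB` says that the regular extension vanishes.
  obtain ⟨c, hc⟩ := elliptic_eq_const L hper hreg
  suffices c = 0 by subst this; exact hc z
  have hρ := (hpole i₀).continuousAt.tendsto.mono_left (inf_le_left : 𝓝[≠] (0:ℂ) ≤ 𝓝 0)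
  rw [hB, ← nhdsWithin] at hρ
  refine tendsto_nhds_unique ((tendsto_const_nhds (x := c)).congr' ?_) hρ
  have ht := hsub 0 (- p i₀)
  have e : (0 : ℂ) - - p i₀ = p i₀ := by ring
  rw [e] at ht
  filter_upwards [riccatiDefect_near_pole hp A B (fun μ ↦ h2 μ i₀) (hA i₀),
    ht.eventually (hc (p i₀))] with u hu hu'
  rw [← hu, ← hu']
  congr 1
  ring

end

end GLame

namespace GLame

noncomputable section

/-! ### The Frobenius recursion and power series -/

lemma frobRHS_congr {α : ℂ} {q c c' : ℕ → ℂ} {k : ℕ} (h : ∀ j ≤ k, c j = c' j) :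
    frobRHS α q c k = frobRHS α q c' k := by
  rw [frobRHS, frobRHS, h k le_rfl]
  congr 1
  exact Finset.sum_congr rfl fun m _ ↦ by rw [h _ (by omega)]

/-- Below the resonant step `k = ℓ` the factor `(k + 1)(k - ℓ)` is invertible, so the recursion
determines its solution. -/
lemma frobCoeff_eq_of_recursion {ℓ : ℕ} {α : ℂ} {q f : ℕ → ℂ} (h0 : f 0 = 1)
    (hf : ∀ k : ℕ, ((k : ℂ) + 1) * ((k : ℂ) - ℓ) * f (k + 1) = frobRHS α q f k)
    {N : ℕ} (hN : N ≤ ℓ) :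
    ∀ j ≤ N, frobCoeff ℓ α q N j = f j := by
  induction N with
  | zero =>
    intro j hj
    obtain rfl : j = 0 := by omega
    simp [frobCoeff, h0]
  | succ N ih =>
    intro j hj
    have ih' := ih (by omega)
    rcases Nat.lt_or_ge j (N + 1) with h | h
    · rw [frobCoeff, Function.update_of_ne (by omega)]
      exact ih' j (by omega)
    · obtain rfl : j = N + 1 := by omega
      rw [frobCoeff, Function.update_self, frobRHS_congr ih', ← hf]
      have h1 : (N : ℂ) + 1 ≠ 0 := by exact_mod_cast N.succ_ne_zero
      have h2 : (N : ℂ) - ℓ ≠ 0 := by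
        rw [sub_ne_zero]
        exact_mod_cast (by omega : N ≠ ℓ)
      field_simp

open PowerSeries in
-- The hypothesis `hf` is the differential equation for `w = u^(-ℓ/2) f`. Its coefficients are the
-- Frobenius recursion, and at step `ℓ` the left-hand side carries the factor `ℓ - ℓ`: a solution
-- without logarithm forces the obstruction to vanish.
lemma frobRHS_eq_zero_of_powerSeries {ℓ : ℕ} {α : ℂ} {q f : PowerSeries ℂ}
    (h0 : coeff 0 f = 1)
    (hf : X * d⁄dX ℂ (d⁄dX ℂ f) - C (ℓ : ℂ) * d⁄dX ℂ f = (C α + X * q) * f) :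
    frobRHS α (fun m ↦ coeff m q) (frobCoeff ℓ α (fun m ↦ coeff m q) ℓ) ℓ = 0 := by
  have hrec : ∀ k : ℕ, ((k : ℂ) + 1) * ((k : ℂ) - ℓ) * coeff (k + 1) f
      = frobRHS α (fun m ↦ coeff m q) (fun m ↦ coeff m f) k := by
    intro k
    have h := congrArg (coeff k) hf
    rw [map_sub, add_mul, map_add, coeff_C_mul, coeff_C_mul, coeff_derivative, mul_assoc X] at h
    rw [frobRHS]
    cases k with
    | zero =>
      simp only [coeff_zero_X_mul] at h
      simp only [Nat.cast_zero, Finset.range_zero, Finset.sum_empty]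
      linear_combination h
    | succ k =>
      simp only [coeff_succ_X_mul, coeff_derivative] at h
      rw [coeff_mul, Finset.Nat.sum_antidiagonal_eq_sum_range_succ
        (fun i j ↦ coeff i q * coeff j f)] at h
      simp only [Nat.add_sub_cancel, Nat.succ_eq_add_one] at h ⊢
      push_cast at h ⊢
      linear_combination h
  rw [frobRHS_congr (frobCoeff_eq_of_recursion (f := fun m ↦ coeff m f) h0 hrec le_rfl), ← hrec]
  simp

/-- The coefficients of the power series `f` with `f' = g f` and `f(0) = 1`. -/
def logSolution (g : ℕ → ℂ) : ℕ → ℂ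
  | 0 => 1
  | k + 1 => (∑ i : Fin (k + 1), g (k - i) * logSolution g i) / (k + 1)

open PowerSeries in
lemma derivative_logSolution (g : PowerSeries ℂ) :
    d⁄dX ℂ (mk (logSolution fun m ↦ coeff m g)) = g * mk (logSolution fun m ↦ coeff m g) := by
  ext k
  rw [coeff_derivative, coeff_mk, mul_comm g, coeff_mul,
    Finset.Nat.sum_antidiagonal_eq_sum_range_succ
      (fun i j ↦ coeff i (mk (logSolution fun m ↦ coeff m g)) * coeff j g), logSolution,
    Fin.sum_univ_eq_sum_range (fun i ↦ coeff (k - i) g * logSolution (fun m ↦ coeff m g) i)]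
  have h1 : (k : ℂ) + 1 ≠ 0 := by exact_mod_cast k.succ_ne_zero
  field_simp
  exact Finset.sum_congr rfl fun i _ ↦ by rw [coeff_mk]; ring

open PowerSeries in
-- Formally `w'/w = -ℓ/(2u) + g`. The series `f` with `f' = g f` then gives `w = u^(-ℓ/2) f`, and
-- the Riccati equation for `g` becomes the linear equation for `f`.
lemma frobRHS_eq_zero_of_riccati {ℓ : ℕ} {α : ℂ} {q g s : PowerSeries ℂ} {g₀ : ℂ}
    (hg : g = C g₀ + X * s) (hα : α = - (ℓ * g₀))
    (hq : d⁄dX ℂ g + g ^ 2 - C (ℓ : ℂ) * s - q = 0) :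
    frobRHS α (fun m ↦ coeff m q) (frobCoeff ℓ α (fun m ↦ coeff m q) ℓ) ℓ = 0 := by
  have hf := derivative_logSolution g
  set f : PowerSeries ℂ := mk (logSolution fun m ↦ coeff m g) with hfdef
  refine frobRHS_eq_zero_of_powerSeries (f := f) (by simp [hfdef, logSolution]) ?_
  rw [hf, Derivation.leibniz, hf, hα, map_neg, map_mul]
  simp only [smul_eq_mul]
  linear_combination (X * f) * hq - (C (ℓ : ℂ)) * f * hg

/-! ### Taylor series at the origin -/

/-- The Taylor series at the origin. -/
def taylor (f : ℂ → ℂ) : PowerSeries ℂ := .mk fun m ↦ iteratedDeriv m f 0 / (m.factorial : ℂ)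

lemma coeff_taylor (f : ℂ → ℂ) (m : ℕ) :
    PowerSeries.coeff m (taylor f) = iteratedDeriv m f 0 / (m.factorial : ℂ) := by
  simp [taylor]

lemma taylor_congr {f g : ℂ → ℂ} (h : f =ᶠ[𝓝 0] g) : taylor f = taylor g := by
  ext m
  rw [coeff_taylor, coeff_taylor, h.iteratedDeriv_eq]

lemma taylor_add {f g : ℂ → ℂ} (hf : AnalyticAt ℂ f 0) (hg : AnalyticAt ℂ g 0) :
    taylor (fun x ↦ f x + g x) = taylor f + taylor g := by
  ext m
  simp only [coeff_taylor, map_add]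
  rw [← add_div]
  congr 1
  exact iteratedDeriv_add hf.contDiffAt hg.contDiffAt

lemma taylor_const_mul (c : ℂ) (f : ℂ → ℂ) :
    taylor (fun x ↦ c * f x) = PowerSeries.C c * taylor f := by
  ext m
  rw [PowerSeries.coeff_C_mul]
  simp only [coeff_taylor]
  rw [iteratedDeriv_const_mul_field, mul_div_assoc]

lemma taylor_mul {f g : ℂ → ℂ} (hf : AnalyticAt ℂ f 0) (hg : AnalyticAt ℂ g 0) :
    taylor (fun x ↦ f x * g x) = taylor f * taylor g := by
  ext m
  rw [PowerSeries.coeff_mul, Finset.Nat.sum_antidiagonal_eq_sum_range_succ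
    (fun i j ↦ PowerSeries.coeff i (taylor f) * PowerSeries.coeff j (taylor g))]
  simp only [coeff_taylor]
  have h := iteratedDeriv_mul (n := m) (hf.contDiffAt) (hg.contDiffAt)
  change iteratedDeriv m (f * g) 0 / _ = _
  rw [h, Finset.sum_div]
  refine Finset.sum_congr rfl fun i hi ↦ ?_
  have hi' : i ≤ m := by simpa [Nat.lt_succ_iff] using hi
  rw [Nat.cast_choose ℂ hi']
  have h1 : (m.factorial : ℂ) ≠ 0 := by exact_mod_cast m.factorial_ne_zero
  field_simp

lemma taylor_deriv (f : ℂ → ℂ) : taylor (deriv f) = PowerSeries.derivative ℂ (taylor f) := by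
  ext m
  rw [PowerSeries.coeff_derivative, coeff_taylor, coeff_taylor, iteratedDeriv_succ',
    Nat.factorial_succ]
  have h1 : (m.factorial : ℂ) ≠ 0 := by exact_mod_cast m.factorial_ne_zero
  have h2 : (m : ℂ) + 1 ≠ 0 := by exact_mod_cast m.succ_ne_zero
  push_cast
  field_simp

lemma taylor_const (c : ℂ) : taylor (fun _ ↦ c) = PowerSeries.C c := by
  ext m
  rw [coeff_taylor, iteratedDeriv_const, PowerSeries.coeff_C]
  split_ifs with h
  · simp [h]
  · simp

lemma taylor_id : taylor (fun x ↦ x) = PowerSeries.X := by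
  ext m
  rw [coeff_taylor, PowerSeries.coeff_X]
  rcases m with _ | _ | m
  · simp
  · simp
  · rw [iteratedDeriv_succ', iteratedDeriv_succ']
    simp

lemma taylor_eq_add_dslope {f : ℂ → ℂ} (hf : AnalyticAt ℂ f 0) :
    taylor f = PowerSeries.C (f 0) + PowerSeries.X * taylor (dslope f 0) := by
  have h : f = fun x ↦ f 0 + x * dslope f 0 x := by
    funext x
    have := sub_smul_dslope f 0 x
    rw [sub_zero, smul_eq_mul] at this
    rw [this]
    ring
  have hd := analyticAt_dslope hf
  conv_lhs => rw [h]
  rw [taylor_add (f := fun _ ↦ f 0) (g := fun x ↦ x * dslope f 0 x) analyticAt_const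
    (analyticAt_id.mul hd),
    taylor_mul (f := fun x ↦ x) analyticAt_id hd, taylor_const, taylor_id]

/-! ### The ansatz maps to the log-free variety -/

variable {r n : ℕ} {L : PeriodPair} {p : Fin r → ℂ} {ℓ : Fin r → ℕ}

lemma logFreePoly_eq_zero_of_riccati (hp : ∀ i j, i ≠ j → p i - p j ∉ L.lattice)
    {a : Fin n → ℂ} {h : ℂ} {A : Fin r → ℂ} {B : ℂ} {i : Fin r} (h2 : ∀ μ, a μ - p i ∉ L.lattice)
    (hA : A i = - (ℓ i * ansatzRegP L p ℓ a h i 0))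
    (hD : ∀ᶠ x in 𝓝[≠] (p i), riccatiDefect L p ℓ a h A B x = 0) :
    logFreePoly L p ℓ i A B = 0 := by
  have hρ := analyticAt_ansatzRegP (ℓ := ℓ) (h := h) hp h2
  have hq := analyticAt_regularPart (ℓ := ℓ) hp i A B
  have hnear := riccatiDefect_near_pole hp A B h2 hA
  have ht : Tendsto (fun u ↦ p i + u) (𝓝[≠] 0) (𝓝[≠] (p i)) := by
    refine tendsto_nhdsWithin_iff.mpr ⟨?_, ?_⟩
    · have : Tendsto (fun u ↦ p i + u) (𝓝 0) (𝓝 (p i + 0)) := (continuous_const_add (p i)).tendsto 0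
      rw [add_zero] at this
      exact this.mono_left inf_le_left
    · filter_upwards [self_mem_nhdsWithin] with x hx
      simpa using hx
  set ρ := ansatzRegP L p ℓ a h i with hρdef
  have han : AnalyticAt ℂ (fun u ↦ deriv ρ u + ρ u ^ 2 - ℓ i * dslope ρ 0 u
      - regularPart L p ℓ i A B u) 0 :=
    ((hρ.deriv.add (hρ.pow 2)).sub (analyticAt_const.mul (analyticAt_dslope hρ))).sub hq
  have hev : ∀ᶠ u in 𝓝[≠] (0 : ℂ), deriv ρ u + ρ u ^ 2 - ℓ i * dslope ρ 0 u
      - regularPart L p ℓ i A B u = 0 := by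
    filter_upwards [hnear, ht.eventually hD] with u h3 h4
    rw [← h3, h4]
  -- The equation is known only off the centre; the identity theorem extends it there, so that
  -- Taylor series can be compared.
  have hz := han.frequently_zero_iff_eventually_zero.mp hev.frequently
  have hreg : regularPart L p ℓ i A B =ᶠ[𝓝 0]
      fun u ↦ deriv ρ u + (ρ u * ρ u + (-(ℓ i : ℂ)) * dslope ρ 0 u) := by
    filter_upwards [hz] with u hu
    linear_combination -hu
  have htay : taylor (regularPart L p ℓ i A B) = PowerSeries.derivative ℂ (taylor ρ)
      + (taylor ρ * taylor ρ + PowerSeries.C (-(ℓ i : ℂ)) * taylor (dslope ρ 0)) := by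
    have hds := analyticAt_dslope hρ
    rw [taylor_congr hreg, taylor_add (f := deriv ρ) hρ.deriv
        (g := fun u ↦ ρ u * ρ u + (-(ℓ i : ℂ)) * dslope ρ 0 u)
        ((hρ.mul hρ).add (analyticAt_const.mul hds)),
      taylor_add (f := fun u ↦ ρ u * ρ u) (hρ.mul hρ) (g := fun u ↦ (-(ℓ i : ℂ)) * dslope ρ 0 u)
        (analyticAt_const.mul hds),
      taylor_mul hρ hρ, taylor_const_mul, taylor_deriv]
  have := frobRHS_eq_zero_of_riccati (ℓ := ℓ i) (α := A i) (taylor_eq_add_dslope hρ) hA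
    (q := taylor (regularPart L p ℓ i A B)) (by rw [htay, map_neg]; ring)
  have e : (fun m ↦ PowerSeries.coeff m (taylor (regularPart L p ℓ i A B)))
      = potCoeff L p ℓ i A B := funext fun m ↦ coeff_taylor _ m
  rw [e] at this
  exact this

lemma IsAccessory.riccatiDefect_eq_zero (hn : 0 < n)
    (hp : ∀ i j, i ≠ j → p i - p j ∉ L.lattice) (hℓ : ∀ i, 0 < ℓ i) (hsum : ∑ i, ℓ i = 2 * n)
    {a : Fin n → ℂ} {h : ℂ} (H : IsAnsatz L p ℓ a h) {A : Fin r → ℂ} {B : ℂ}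
    (hAB : IsAccessory L p ℓ a h A B) (z : ℂ) :
    ∀ᶠ x in 𝓝[≠] z, riccatiDefect L p ℓ a h A B x = 0 := by
  have hr : 0 < r := by
    rcases Nat.eq_zero_or_pos r with rfl | hr
    · simp at hsum; omega
    · exact hr
  have hA : ∀ i, A i = - (ℓ i * ansatzRegP L p ℓ a h i 0) := fun i ↦
    (accessory_residue_iff hℓ a h A i).mp (hAB i).1
  exact riccatiDefect_eventually_eq_zero hn hp hℓ hsum H hA ⟨0, hr⟩
    ((accessory_const_iff hp hℓ (fun μ ↦ H.off_poles μ _) (hA _)).mp (hAB _).2) z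

lemma IsAccessory.mem_logFreeVariety (hn : 0 < n)
    (hp : ∀ i j, i ≠ j → p i - p j ∉ L.lattice) (hℓ : ∀ i, 0 < ℓ i) (hsum : ∑ i, ℓ i = 2 * n)
    {a : Fin n → ℂ} {h : ℂ} (H : IsAnsatz L p ℓ a h) {A : Fin r → ℂ} {B : ℂ}
    (hAB : IsAccessory L p ℓ a h A B) : (A, B) ∈ logFreeVariety L p ℓ := by
  refine ⟨sum_accessory_eq_zero hn hsum hℓ H fun i ↦ (hAB i).1, fun i ↦ ?_⟩
  exact logFreePoly_eq_zero_of_riccati hp (fun μ ↦ H.off_poles μ i)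
    ((accessory_residue_iff hℓ a h A i).mp (hAB i).1)
    (hAB.riccatiDefect_eq_zero hn hp hℓ hsum H (p i))

/-- The point is that the formulas for `B` at different poles agree. Take `B` from the first pole;
then `y' + y² - Q` vanishes identically, and its value at any other pole is the formula there. -/
lemma exists_isAccessory (hn : 0 < n)
    (hp : ∀ i j, i ≠ j → p i - p j ∉ L.lattice) (hℓ : ∀ i, 0 < ℓ i) (hsum : ∑ i, ℓ i = 2 * n)
    {a : Fin n → ℂ} {h : ℂ} (H : IsAnsatz L p ℓ a h) :
    ∃ B, IsAccessory L p ℓ a h (fun i ↦ - (ℓ i * ansatzRegP L p ℓ a h i 0)) B := by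
  have hr : 0 < r := by
    rcases Nat.eq_zero_or_pos r with rfl | hr
    · simp at hsum; omega
    · exact hr
  set A : Fin r → ℂ := fun i ↦ - (ℓ i * ansatzRegP L p ℓ a h i 0) with hA
  obtain ⟨B, hB⟩ : ∃ B, B = A ⟨0, hr⟩ ^ 2 / (ℓ ⟨0, hr⟩ : ℂ) ^ 2
      - ∑ j ∈ Finset.univ.erase ⟨0, hr⟩,
        wt ℓ j * (wt ℓ j + ℓ ⟨0, hr⟩) * L.weierstrassP (p ⟨0, hr⟩ - p j)
      - ∑ j ∈ Finset.univ.erase ⟨0, hr⟩, A j * zetaW L (p ⟨0, hr⟩ - p j)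
      + ((ℓ ⟨0, hr⟩ : ℂ) - 1) * ∑ μ, L.weierstrassP (p ⟨0, hr⟩ - a μ) := ⟨_, rfl⟩
  have hD := riccatiDefect_eventually_eq_zero hn hp hℓ hsum H (fun i ↦ rfl) ⟨0, hr⟩
    ((accessory_const_iff hp hℓ (fun μ ↦ H.off_poles μ _) rfl).mp hB)
  refine ⟨B, fun i ↦ ⟨(accessory_residue_iff hℓ a h A i).mpr rfl, ?_⟩⟩
  refine (accessory_const_iff hp hℓ (fun μ ↦ H.off_poles μ i) rfl).mpr ?_
  have hρ := analyticAt_ansatzRegP (ℓ := ℓ) (h := h) hp (fun μ ↦ H.off_poles μ i)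
  have han : AnalyticAt ℂ (fun u ↦ deriv (ansatzRegP L p ℓ a h i) u
      + ansatzRegP L p ℓ a h i u ^ 2 - ℓ i * dslope (ansatzRegP L p ℓ a h i) 0 u
      - regularPart L p ℓ i A B u) 0 :=
    ((hρ.deriv.add (hρ.pow 2)).sub (analyticAt_const.mul (analyticAt_dslope hρ))).sub
      (analyticAt_regularPart hp i A B)
  have ht : Tendsto (fun u ↦ p i + u) (𝓝[≠] 0) (𝓝[≠] (p i)) := by
    refine tendsto_nhdsWithin_iff.mpr ⟨?_, ?_⟩
    · have : Tendsto (fun u ↦ p i + u) (𝓝 0) (𝓝 (p i + 0)) := (continuous_const_add (p i)).tendsto 0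
      rw [add_zero] at this
      exact this.mono_left inf_le_left
    · filter_upwards [self_mem_nhdsWithin] with x hx
      simpa using hx
  refine (han.frequently_zero_iff_eventually_zero.mp (Eventually.frequently ?_)).self_of_nhds
  filter_upwards [riccatiDefect_near_pole hp A B (fun μ ↦ H.off_poles μ i) rfl,
    ht.eventually (hD (p i))] with u h3 h4
  rw [← h3, h4]

end

end GLame

namespace GLame

noncomputable section

/-! ### The leading part of the log-free polynomial -/

section Analytic

variable {E : Type*} [NormedAddCommGroup E] [NormedSpace ℂ E]

lemma analyticAt_frobRHS {α : E → ℂ} {q c : E → ℕ → ℂ} {x : E} (hα : AnalyticAt ℂ α x)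
    (hq : ∀ m, AnalyticAt ℂ (fun u ↦ q u m) x) (hc : ∀ m, AnalyticAt ℂ (fun u ↦ c u m) x) (k : ℕ) :
    AnalyticAt ℂ (fun u ↦ frobRHS (α u) (q u) (c u) k) x :=
  (hα.mul (hc k)).add (Finset.analyticAt_fun_sum _ fun m _ ↦ (hq m).mul (hc _))

lemma analyticAt_frobCoeff {α : E → ℂ} {q : E → ℕ → ℂ} {x : E} (hα : AnalyticAt ℂ α x)
    (hq : ∀ m, AnalyticAt ℂ (fun u ↦ q u m) x) (ℓ N m : ℕ) :
    AnalyticAt ℂ (fun u ↦ frobCoeff ℓ (α u) (q u) N m) x := by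
  induction N generalizing m with
  | zero => simp only [frobCoeff]; exact analyticAt_const
  | succ N ih =>
    by_cases hm : m = N + 1
    · subst hm
      simp only [frobCoeff, Function.update_self]
      exact (analyticAt_frobRHS hα hq ih N).div_const
    · simp only [frobCoeff, Function.update_of_ne hm]
      exact ih m

end Analytic

/-- Weighted homogeneity: `α` has weight 1, `q m` weight `m + 2` and `c m` weight `m`. -/
lemma frobRHS_scale (s α : ℂ) {q q' c c' : ℕ → ℂ} (hq : ∀ m, q' m = s ^ (m + 2) * q m)
    (hc : ∀ m, c' m = s ^ m * c m) (k : ℕ) :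
    frobRHS (s * α) q' c' k = s ^ (k + 1) * frobRHS α q c k := by
  rw [frobRHS, frobRHS, hc, mul_add, Finset.mul_sum]
  congr 1
  · ring
  · refine Finset.sum_congr rfl fun m hm ↦ ?_
    have hm' : m < k := by simpa using hm
    rw [hq, hc, show k + 1 = m + 2 + (k - 1 - m) by omega, pow_add]
    ring

lemma frobCoeff_scale (s α : ℂ) {q q' : ℕ → ℂ} (hq : ∀ m, q' m = s ^ (m + 2) * q m) (ℓ N m : ℕ) :
    frobCoeff ℓ (s * α) q' N m = s ^ m * frobCoeff ℓ α q N m := by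
  induction N generalizing m with
  | zero =>
    by_cases hm : m = 0
    · simp [frobCoeff, hm]
    · simp [frobCoeff, hm]
  | succ N ih =>
    by_cases hm : m = N + 1
    · subst hm
      simp only [frobCoeff, Function.update_self]
      rw [frobRHS_scale s α hq ih, mul_div_assoc]
    · simp only [frobCoeff, Function.update_of_ne hm]
      exact ih m

/-! ### Factorization of the log-free polynomial at infinity -/

/-- The log-free polynomial of `w'' = (ℓ/2 (ℓ/2 + 1) / u² + α / u + β) w`. -/
def whittakerPoly (ℓ : ℕ) (α β : ℂ) : ℂ :=
  frobRHS α (fun m ↦ if m = 0 then β else 0)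
    (frobCoeff ℓ α (fun m ↦ if m = 0 then β else 0) ℓ) ℓ

/-- The coefficients of the polynomial solution of `X P'' + 2 X P' - ℓ P' = 2 k P`. -/
def laguerreCoeff (ℓ k j : ℕ) : ℂ :=
  ∏ i ∈ Finset.range j, 2 * ((k : ℂ) - i) / (((i : ℂ) + 1) * ((i : ℂ) - ℓ))

lemma laguerreCoeff_eq_zero {ℓ k j : ℕ} (h : k < j) : laguerreCoeff ℓ k j = 0 :=
  Finset.prod_eq_zero (Finset.mem_range.mpr h) (by simp)

lemma laguerreCoeff_ne_zero {ℓ k j : ℕ} (hk : k ≤ ℓ) (h : j ≤ k) : laguerreCoeff ℓ k j ≠ 0 := by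
  refine Finset.prod_ne_zero_iff.mpr fun i hi ↦ ?_
  have hi' : i < j := by simpa using hi
  have h1 : (k : ℂ) - i ≠ 0 := by rw [sub_ne_zero]; exact_mod_cast (by omega : k ≠ i)
  have h2 : (i : ℂ) - ℓ ≠ 0 := by rw [sub_ne_zero]; exact_mod_cast (by omega : i ≠ ℓ)
  have h3 : (i : ℂ) + 1 ≠ 0 := by exact_mod_cast i.succ_ne_zero
  exact div_ne_zero (mul_ne_zero two_ne_zero h1) (mul_ne_zero h3 h2)

/-- The cases are separated because the quotient defining the coefficients divides by zero at `j =
ℓ`. By `k ≤ ℓ` this happens only for `j ≥ k`, where both sides are zero. -/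
lemma laguerreCoeff_succ {ℓ k : ℕ} (hk : k ≤ ℓ) (j : ℕ) :
    ((j : ℂ) + 1) * ((j : ℂ) - ℓ) * laguerreCoeff ℓ k (j + 1)
      = 2 * ((k : ℂ) - j) * laguerreCoeff ℓ k j := by
  rcases lt_trichotomy j k with h | rfl | h
  · rw [laguerreCoeff, Finset.prod_range_succ, ← laguerreCoeff]
    have h2 : (j : ℂ) - ℓ ≠ 0 := by rw [sub_ne_zero]; exact_mod_cast (by omega : j ≠ ℓ)
    have h3 : (j : ℂ) + 1 ≠ 0 := by exact_mod_cast j.succ_ne_zero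
    field_simp
  · rw [laguerreCoeff_eq_zero (by omega)]
    ring
  · rw [laguerreCoeff_eq_zero (by omega), laguerreCoeff_eq_zero h]
    ring

/-- The polynomial solution of `X P'' + 2 X P' - ℓ P' = 2 k P`. -/
def laguerrePoly (ℓ k : ℕ) : Polynomial ℂ :=
  ∑ j ∈ Finset.range (k + 1), Polynomial.monomial j (laguerreCoeff ℓ k j)

lemma coeff_laguerrePoly (ℓ k j : ℕ) : (laguerrePoly ℓ k).coeff j = laguerreCoeff ℓ k j := by
  simp only [laguerrePoly, Polynomial.finsetSum_coeff, Polynomial.coeff_monomial,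
    Finset.sum_ite_eq', Finset.mem_range]
  split_ifs with h
  · rfl
  · rw [laguerreCoeff_eq_zero (by omega)]

lemma natDegree_laguerrePoly {ℓ k : ℕ} (hk : k ≤ ℓ) : (laguerrePoly ℓ k).natDegree = k := by
  refine le_antisymm (Polynomial.natDegree_le_iff_coeff_eq_zero.mpr fun j hj ↦ ?_)
    (Polynomial.le_natDegree_of_ne_zero ?_)
  · rw [coeff_laguerrePoly, laguerreCoeff_eq_zero hj]
  · rw [coeff_laguerrePoly]
    exact laguerreCoeff_ne_zero hk le_rfl

open Polynomial in
lemma laguerrePoly_ode {ℓ k : ℕ} (hk : k ≤ ℓ) :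
    X * derivative (derivative (laguerrePoly ℓ k)) + 2 * (X * derivative (laguerrePoly ℓ k))
      - C (ℓ : ℂ) * derivative (laguerrePoly ℓ k) = C (2 * (k : ℂ)) * laguerrePoly ℓ k := by
  ext j
  rw [show (2 : ℂ[X]) = C 2 from (map_ofNat C 2).symm]
  rw [coeff_sub, coeff_add, coeff_C_mul, coeff_C_mul, coeff_C_mul]
  have h := laguerreCoeff_succ hk j
  rcases j with _ | j
  · simp only [coeff_X_mul_zero, coeff_derivative, coeff_laguerrePoly]
    push_cast at h ⊢
    linear_combination h
  · simp only [coeff_X_mul, coeff_derivative, coeff_laguerrePoly]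
    push_cast at h ⊢
    linear_combination h

open PowerSeries in
-- If `P` is the Laguerre polynomial, then `f = e^X P` satisfies `X f'' - ℓ f' = (2k - ℓ + X) f`, so
-- the equation with these parameters has a solution without logarithm.
lemma whittakerPoly_root {ℓ k : ℕ} (hk : k ≤ ℓ) : whittakerPoly ℓ (2 * k - ℓ) 1 = 0 := by
  have hP := congrArg (fun P : Polynomial ℂ ↦ (P : PowerSeries ℂ)) (laguerrePoly_ode hk)
  simp only [Polynomial.coe_sub, Polynomial.coe_add, Polynomial.coe_mul, Polynomial.coe_X,
    Polynomial.coe_C, ← derivative_coe] at hP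
  set P : PowerSeries ℂ := (laguerrePoly ℓ k : PowerSeries ℂ) with hPdef
  have h2 : ((2 : Polynomial ℂ) : PowerSeries ℂ) = 2 := by
    rw [show (2 : Polynomial ℂ) = Polynomial.C 2 from (map_ofNat Polynomial.C 2).symm,
      Polynomial.coe_C]
    exact map_ofNat _ 2
  rw [h2] at hP
  have hE : d⁄dX ℂ (exp ℂ) = exp ℂ := by
    ext m
    rw [coeff_derivative, coeff_exp, coeff_exp, Nat.factorial_succ]
    have h1 : (m.factorial : ℂ) ≠ 0 := by exact_mod_cast m.factorial_ne_zero
    have h2 : (m : ℂ) + 1 ≠ 0 := by exact_mod_cast m.succ_ne_zero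
    simp
    field_simp
  have hC : (C (2 * (k : ℂ)) : PowerSeries ℂ) = C (2 * (k : ℂ) - ℓ) + C (ℓ : ℂ) := by
    rw [← map_add]; congr 1; ring
  have := frobRHS_eq_zero_of_powerSeries (ℓ := ℓ) (α := 2 * k - ℓ) (q := 1)
    (f := exp ℂ * P) ?_ ?_
  · rw [whittakerPoly]
    have e : (fun m : ℕ ↦ if m = 0 then (1 : ℂ) else 0)
        = fun m ↦ coeff m (1 : PowerSeries ℂ) := by
      funext m
      rw [coeff_one]
    rw [e]
    exact this
  · rw [coeff_zero_eq_constantCoeff, map_mul, ← coeff_zero_eq_constantCoeff,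
      Polynomial.coeff_coe, coeff_laguerrePoly]
    simp [laguerreCoeff]
  · simp only [Derivation.leibniz, map_add, hE, smul_eq_mul]
    rw [hC] at hP
    linear_combination (exp ℂ) * hP

open Polynomial in
-- Each step multiplies by `α` and a nonzero constant, up to terms of lower degree, so `c_j` has
-- degree exactly `j` in `α`.
lemma exists_frobCoeff_poly (ℓ : ℕ) (N : ℕ) (hN : N ≤ ℓ) : ∃ P : ℕ → ℂ[X],
    (∀ j ≤ N, (P j).natDegree ≤ j ∧ (P j).coeff j ≠ 0) ∧
    ∀ α : ℂ, ∀ j ≤ N, frobCoeff ℓ α (fun m ↦ if m = 0 then 1 else 0) N j = (P j).eval α := by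
  induction N with
  | zero => exact ⟨fun _ ↦ 1, by simp, by simp [frobCoeff]⟩
  | succ N ih =>
    obtain ⟨P, hP, hPα⟩ := ih (by omega)
    have h1 : (N : ℂ) + 1 ≠ 0 := by exact_mod_cast N.succ_ne_zero
    have h2 : (N : ℂ) - ℓ ≠ 0 := by
      rw [sub_ne_zero]
      exact_mod_cast (by omega : N ≠ ℓ)
    -- The contribution of `q_0 = 1`, the only nonzero Taylor coefficient; it multiplies `c_{N-1}`
    -- and is absent for `N = 0`.
    set S : ℂ[X] := if N = 0 then 0 else P (N - 1) with hS
    have hSdeg : S.natDegree ≤ N := by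
      rw [hS]; split_ifs with h
      · simp
      · exact (hP (N - 1) (by omega)).1.trans (by omega)
    set R : ℂ[X] := C (((N : ℂ) + 1) * ((N : ℂ) - ℓ))⁻¹ * (X * P N + S) with hR
    refine ⟨Function.update P (N + 1) R, fun j hj ↦ ?_, fun α j hj ↦ ?_⟩
    · rcases Nat.lt_or_ge j (N + 1) with h | h
      · rw [Function.update_of_ne (by omega)]
        exact hP j (by omega)
      · obtain rfl : j = N + 1 := by omega
        rw [Function.update_self]
        constructor
        · refine (natDegree_C_mul_le _ _).trans ((natDegree_add_le _ _).trans (max_le ?_ ?_))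
          · refine natDegree_mul_le.trans ?_
            rw [natDegree_X]
            have := (hP N le_rfl).1
            omega
          · omega
        · rw [hR, coeff_C_mul, coeff_add, coeff_X_mul, coeff_eq_zero_of_natDegree_lt
            (p := S) (by omega), add_zero]
          exact mul_ne_zero (inv_ne_zero (mul_ne_zero h1 h2)) (hP N le_rfl).2
    · rcases Nat.lt_or_ge j (N + 1) with h | h
      · rw [Function.update_of_ne (by omega), frobCoeff, Function.update_of_ne (by omega)]
        exact hPα α j (by omega)
      · obtain rfl : j = N + 1 := by omega
        rw [Function.update_self, frobCoeff, Function.update_self, frobRHS, hPα α N le_rfl, hR]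
        have hs : ∑ m ∈ Finset.range N, (if m = 0 then (1 : ℂ) else 0)
            * frobCoeff ℓ α (fun m ↦ if m = 0 then 1 else 0) N (N - 1 - m) = S.eval α := by
          rw [hS]
          rcases N with _ | N
          · simp
          · rw [Finset.sum_eq_single 0]
            · simp only [Nat.add_sub_cancel, Nat.sub_zero, if_true, one_mul]
              rw [hPα α N (by omega)]
              simp
            · intro b _ hb
              simp [hb]
            · simp
        rw [hs]
        simp only [eval_mul, eval_C, eval_add, eval_X]
        field_simp

open Polynomial in
lemma exists_whittakerPoly_poly (ℓ : ℕ) : ∃ F : ℂ[X], F.natDegree ≤ ℓ + 1 ∧ F.coeff (ℓ + 1) ≠ 0 ∧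
    ∀ α, whittakerPoly ℓ α 1 = F.eval α := by
  obtain ⟨P, hP, hPα⟩ := exists_frobCoeff_poly ℓ ℓ le_rfl
  set S : ℂ[X] := if ℓ = 0 then 0 else P (ℓ - 1) with hS
  have hSdeg : S.natDegree ≤ ℓ := by
    rw [hS]; split_ifs with h
    · simp
    · exact (hP (ℓ - 1) (by omega)).1.trans (by omega)
  refine ⟨X * P ℓ + S, ?_, ?_, fun α ↦ ?_⟩
  · refine (natDegree_add_le _ _).trans (max_le ?_ (by omega))
    refine natDegree_mul_le.trans ?_
    rw [natDegree_X]
    have := (hP ℓ le_rfl).1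
    omega
  · rw [coeff_add, coeff_X_mul, coeff_eq_zero_of_natDegree_lt (p := S) (by omega), add_zero]
    exact (hP ℓ le_rfl).2
  · rw [whittakerPoly, frobRHS, hPα α ℓ le_rfl]
    have hs : ∑ m ∈ Finset.range ℓ, (if m = 0 then (1 : ℂ) else 0)
        * frobCoeff ℓ α (fun m ↦ if m = 0 then 1 else 0) ℓ (ℓ - 1 - m) = S.eval α := by
      rw [hS]
      rcases ℓ with _ | N
      · simp
      · rw [Finset.sum_eq_single 0]
        · simp only [Nat.add_sub_cancel, Nat.sub_zero, if_true, one_mul]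
          rw [hPα α N (by omega)]
          simp
        · intro b _ hb
          simp [hb]
        · simp
    rw [hs]
    simp

lemma two_mul_sub_injective (ℓ : ℕ) : Function.Injective fun k : ℕ ↦ (2 * (k : ℂ) - ℓ) := by
  intro a b h
  have : (a : ℂ) = b := by
    have h' : 2 * (a : ℂ) - ℓ = 2 * b - ℓ := h
    linear_combination h' / 2
  exact_mod_cast this

open Polynomial in
-- A polynomial of degree `ℓ + 1` in `α` with the `ℓ + 1` distinct roots `2k - ℓ`, `0 ≤ k ≤ ℓ`, has
-- no others.
lemma exists_whittakerPoly_one (ℓ : ℕ) : ∃ a : ℂ, a ≠ 0 ∧ ∀ α,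
    whittakerPoly ℓ α 1 = a * ∏ k ∈ Finset.range (ℓ + 1), (α - (2 * k - ℓ)) := by
  obtain ⟨F, hF, hF0, hFα⟩ := exists_whittakerPoly_poly ℓ
  refine ⟨F.coeff (ℓ + 1), hF0, fun α ↦ ?_⟩
  set s : Finset ℂ := (Finset.range (ℓ + 1)).map ⟨_, two_mul_sub_injective ℓ⟩ with hs
  have hcard : s.card = ℓ + 1 := by simp [hs]
  have hdeg : F.natDegree = ℓ + 1 := le_antisymm hF (le_natDegree_of_ne_zero hF0)
  have hFne : F ≠ 0 := by rintro rfl; simp at hF0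
  have hroots : F.roots = s.val := by
    refine (Multiset.eq_of_le_of_card_le ?_ ?_).symm
    · refine (Multiset.le_iff_subset s.nodup).mpr fun x hx ↦ ?_
      have hx' : x ∈ s := hx
      simp only [hs, Finset.mem_map, Finset.mem_range, Function.Embedding.coeFn_mk] at hx'
      obtain ⟨k, hk, rfl⟩ := hx'
      rw [mem_roots hFne, IsRoot, ← hFα]
      exact whittakerPoly_root (by omega)
    · refine (card_roots' F).trans ?_
      rw [hdeg]
      exact hcard.ge
  have h := C_leadingCoeff_mul_prod_multiset_X_sub_C (p := F)
    (by rw [hroots, hdeg]; exact hcard)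
  rw [hFα]
  conv_lhs => rw [← h]
  rw [hroots, leadingCoeff, hdeg, eval_mul, eval_C]
  change _ * eval α (∏ x ∈ s, (X - C x)) = _
  rw [eval_prod, hs, Finset.prod_map]
  simp

/-- Homogeneity reduces `c ≠ 0` to `c = 1`, and continuity in `c` adds the value `c = 0`. -/
lemma exists_whittakerPoly_eq (ℓ : ℕ) : ∃ a : ℂ, a ≠ 0 ∧ ∀ α c,
    whittakerPoly ℓ α (c ^ 2) = a * ∏ k ∈ Finset.range (ℓ + 1), (α - c * (2 * k - ℓ)) := by
  obtain ⟨a, ha, h⟩ := exists_whittakerPoly_one ℓ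
  refine ⟨a, ha, fun α c ↦ ?_⟩
  have hne : ∀ c : ℂ, c ≠ 0 →
      whittakerPoly ℓ α (c ^ 2) = a * ∏ k ∈ Finset.range (ℓ + 1), (α - c * (2 * k - ℓ)) := by
    intro c hc
    have hq : ∀ m : ℕ, (if m = 0 then c ^ 2 else 0)
        = c ^ (m + 2) * (if m = 0 then (1 : ℂ) else 0) := by
      intro m
      split_ifs with hm
      · simp [hm]
      · simp
    have hα : α = c * (α / c) := by field_simp
    have h1 : whittakerPoly ℓ α (c ^ 2) = c ^ (ℓ + 1) * whittakerPoly ℓ (α / c) 1 := by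
      rw [whittakerPoly, whittakerPoly]
      conv_lhs => rw [hα]
      exact frobRHS_scale c (α / c) hq (fun m ↦ frobCoeff_scale c (α / c) hq ℓ ℓ m) ℓ
    rw [h1, h]
    have h2 : c ^ (ℓ + 1) = ∏ k ∈ Finset.range (ℓ + 1), c := by simp
    rw [h2, mul_left_comm, ← Finset.prod_mul_distrib]
    congr 1
    refine Finset.prod_congr rfl fun k _ ↦ ?_
    rw [mul_sub, mul_div_cancel₀ _ hc]
  have hcont : Continuous fun c : ℂ ↦ whittakerPoly ℓ α (c ^ 2) := by
    rw [continuous_iff_continuousAt]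
    intro c
    have hq : ∀ m : ℕ, AnalyticAt ℂ (fun c : ℂ ↦ if m = 0 then c ^ 2 else 0) c := by
      intro m
      split_ifs
      · exact analyticAt_id.pow 2
      · exact analyticAt_const
    exact (analyticAt_frobRHS analyticAt_const hq
      (fun m ↦ analyticAt_frobCoeff analyticAt_const hq ℓ ℓ m) ℓ).continuousAt
  have hcont2 : Continuous fun c : ℂ ↦ a * ∏ k ∈ Finset.range (ℓ + 1), (α - c * (2 * k - ℓ)) := by
    fun_prop
  exact congrFun (Continuous.ext_on (dense_compl_singleton (0 : ℂ)) hcont hcont2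
    fun c hc ↦ hne c hc) c

end

end GLame

namespace GLame

noncomputable section

/-! ### Equilibrium configurations and their linearization -/

section Equilibrium

open Polynomial

variable {ι : Type*} [DecidableEq ι]

lemma eval_derivative_prod_X_sub_C (s : Finset ι) (x : ι → ℂ) {z : ℂ} (hz : ∀ ν ∈ s, z ≠ x ν) :
    (derivative (∏ ν ∈ s, (X - C (x ν)))).eval z
      = (∏ ν ∈ s, (X - C (x ν))).eval z * ∑ ν ∈ s, (z - x ν)⁻¹ := by
  rw [derivative_prod_finset, eval_finsetSum, Finset.mul_sum]
  refine Finset.sum_congr rfl fun ν hν ↦ ?_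
  have h := sub_ne_zero.mpr (hz ν hν)
  rw [← Finset.mul_prod_erase s _ hν]
  simp only [derivative_sub, derivative_X, derivative_C, sub_zero, mul_one, eval_mul, eval_sub,
    eval_X, eval_C]
  field_simp

/-- Differentiate `R' = R Λ`, where `Λ` is the logarithmic derivative; the identity holds near `z`,
which is all that is needed. -/
lemma eval_derivative_derivative_prod_X_sub_C (s : Finset ι) (x : ι → ℂ) {z : ℂ}
    (hz : ∀ ν ∈ s, z ≠ x ν) :
    (derivative (derivative (∏ ν ∈ s, (X - C (x ν))))).eval z
      = (∏ ν ∈ s, (X - C (x ν))).eval z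
        * ((∑ ν ∈ s, (z - x ν)⁻¹) ^ 2 - ∑ ν ∈ s, ((z - x ν) ^ 2)⁻¹) := by
  set R : ℂ[X] := ∏ ν ∈ s, (X - C (x ν)) with hR
  have h1 : HasDerivAt (fun w ↦ (derivative R).eval w) ((derivative (derivative R)).eval z) z :=
    (derivative R).hasDerivAt z
  have h2 : HasDerivAt (fun w ↦ R.eval w) ((derivative R).eval z) z := R.hasDerivAt z
  have h3 : HasDerivAt (fun w ↦ ∑ ν ∈ s, (w - x ν)⁻¹) (∑ ν ∈ s, -((z - x ν) ^ 2)⁻¹) z := by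
    refine HasDerivAt.fun_sum fun ν hν ↦ ?_
    have := ((hasDerivAt_id z).sub_const (x ν)).inv (sub_ne_zero.mpr (hz ν hν))
    refine this.congr_deriv ?_
    simp [neg_div]
  have hev : ∀ᶠ w in 𝓝 z, ∀ ν ∈ s, w ≠ x ν :=
    (Finset.eventually_all s).mpr fun ν hν ↦ isOpen_ne.mem_nhds (hz ν hν)
  have h4 := (h2.mul h3).congr_of_eventuallyEq (f₁ := fun w ↦ (derivative R).eval w) (by
    filter_upwards [hev] with w hw
    exact eval_derivative_prod_X_sub_C s x hw)
  rw [h1.unique h4, eval_derivative_prod_X_sub_C s x hz, Finset.sum_neg_distrib]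
  ring

/-- The equation differentiated `m` times. Away from `X = 0` it expresses each derivative by the two
preceding ones. -/
lemma laguerrePoly_iterate_ode {ℓ k : ℕ} (hk : k ≤ ℓ) (m : ℕ) :
    X * derivative^[m + 2] (laguerrePoly ℓ k)
      + (C (m : ℂ) + 2 * X - C (ℓ : ℂ)) * derivative^[m + 1] (laguerrePoly ℓ k)
      + (2 * C (m : ℂ) - C (2 * (k : ℂ))) * derivative^[m] (laguerrePoly ℓ k) = 0 := by
  induction m with
  | zero =>
    have := laguerrePoly_ode hk
    simp only [Function.iterate_succ_apply', Function.iterate_zero, id]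
    rw [Nat.cast_zero, C_0]
    linear_combination this
  | succ m ih =>
    have h := congrArg derivative ih
    have h2 : derivative (2 : ℂ[X]) = 0 := by
      rw [show (2 : ℂ[X]) = C 2 from (map_ofNat C 2).symm, derivative_C]
    simp only [derivative_add, derivative_mul, derivative_sub, derivative_X, derivative_C,
      derivative_zero, h2, ← Function.iterate_succ_apply' derivative] at h
    have hC : (C ((m + 1 : ℕ) : ℂ) : ℂ[X]) = C (m : ℂ) + 1 := by
      push_cast; rw [C_add, C_1]
    rw [hC]
    simp only [Nat.succ_eq_add_one] at h ⊢
    linear_combination h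

lemma laguerrePoly_ne_zero {ℓ k : ℕ} (hk : k ≤ ℓ) : laguerrePoly ℓ k ≠ 0 := by
  intro h
  have := coeff_laguerrePoly ℓ k 0
  rw [h] at this
  exact laguerreCoeff_ne_zero hk (Nat.zero_le k) this.symm

lemma laguerrePoly_eval_zero (ℓ k : ℕ) : (laguerrePoly ℓ k).eval 0 = 1 := by
  rw [← coeff_zero_eq_eval_zero, coeff_laguerrePoly]
  simp [laguerreCoeff]

/-- A multiple root is not the singular point `0`, where the polynomial equals `1`. Elsewhere the
differential equation would make all derivatives vanish, giving a multiplicity larger than the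
degree. -/
lemma laguerrePoly_simple {ℓ k : ℕ} (hk : k ≤ ℓ) {x : ℂ} (hx : (laguerrePoly ℓ k).eval x = 0) :
    (derivative (laguerrePoly ℓ k)).eval x ≠ 0 := by
  intro hx'
  have hx0 : x ≠ 0 := by
    rintro rfl
    rw [laguerrePoly_eval_zero] at hx
    exact one_ne_zero hx
  have hall : ∀ m, (derivative^[m] (laguerrePoly ℓ k)).eval x = 0
      ∧ (derivative^[m + 1] (laguerrePoly ℓ k)).eval x = 0 := by
    intro m
    induction m with
    | zero => exact ⟨hx, hx'⟩
    | succ m ih =>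
      refine ⟨ih.2, ?_⟩
      have h := congrArg (eval x) (laguerrePoly_iterate_ode hk m)
      simp only [eval_add, eval_mul, ih.1, ih.2, mul_zero, add_zero, eval_X, eval_zero] at h
      exact (mul_eq_zero.mp h).resolve_left hx0
  have h0 := laguerrePoly_ne_zero hk
  have h1 : (laguerrePoly ℓ k).natDegree < (laguerrePoly ℓ k).rootMultiplicity x :=
    (lt_rootMultiplicity_iff_isRoot_iterate_derivative h0).mpr fun m _ ↦ (hall m).1
  have h2 := (count_roots (laguerrePoly ℓ k) (a := x)).symm.trans_le
    ((Multiset.count_le_card _ _).trans (card_roots' _))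
  omega

/-- Stieltjes' argument. At a simple root write `P = (X - x)R`; then `P' = R` and `P'' = 2R'` at
`x`, and `R'/R` is the sum over the other roots. The differential equation becomes `2x(1 + ∑ (x -
x_ν)⁻¹) = ℓ`. The summand `ν = μ` is `0⁻¹ = 0`. -/
lemma exists_equilibrium [Fintype ι] {ℓ : ℕ} (hk : Fintype.card ι ≤ ℓ) : ∃ x : ι → ℂ,
    Function.Injective x ∧ (∀ μ, x μ ≠ 0) ∧
      ∀ μ, 1 + ∑ ν, (x μ - x ν)⁻¹ - (ℓ : ℂ) / 2 / x μ = 0 := by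
  set k := Fintype.card ι with hkdef
  set P := laguerrePoly ℓ k with hP
  have hP0 : P ≠ 0 := laguerrePoly_ne_zero hk
  have hnodup : P.roots.Nodup := by
    rw [Multiset.nodup_iff_count_le_one]
    intro x
    rw [count_roots]
    by_contra! h
    have := (one_lt_rootMultiplicity_iff_isRoot hP0).mp h
    exact laguerrePoly_simple hk this.1.eq_zero this.2.eq_zero
  have hcard : Multiset.card P.roots = k := by
    have := (splits_iff_card_roots (f := P)).mp (IsAlgClosed.splits P)
    rw [this]
    exact natDegree_laguerrePoly hk
  have hcard' : Fintype.card ι = Fintype.card P.roots.toFinset := by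
    rw [Fintype.card_coe, Multiset.toFinset_card_of_nodup hnodup, hcard]
  let e : ι ≃ P.roots.toFinset := Fintype.equivOfCardEq hcard'
  set x : ι → ℂ := fun μ ↦ e μ with hx
  have hinj : Function.Injective x := fun a b h ↦ e.injective (Subtype.ext h)
  have hroot : ∀ μ, P.eval (x μ) = 0 := fun μ ↦ by
    have := (e μ).2
    rw [Multiset.mem_toFinset, mem_roots hP0] at this
    exact this
  have hx0 : ∀ μ, x μ ≠ 0 := by
    intro μ h
    have := hroot μ
    rw [h, laguerrePoly_eval_zero] at this
    exact one_ne_zero this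
  have hprod : P = C P.leadingCoeff * ∏ ν, (X - C (x ν)) := by
    have h := C_leadingCoeff_mul_prod_multiset_X_sub_C (p := P)
      (by rw [hcard]; exact (natDegree_laguerrePoly hk).symm)
    conv_lhs => rw [← h]
    congr 1
    have h1 : P.roots = P.roots.toFinset.val := by
      rw [Multiset.toFinset_val, hnodup.dedup]
    rw [h1]
    change ∏ a ∈ P.roots.toFinset, (X - C a) = _
    rw [← Finset.prod_coe_sort, ← e.prod_comp]
  refine ⟨x, hinj, hx0, fun μ ↦ ?_⟩
  set R : ℂ[X] := C P.leadingCoeff * ∏ ν ∈ Finset.univ.erase μ, (X - C (x ν)) with hR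
  have hPR : P = (X - C (x μ)) * R := by
    rw [hR, mul_left_comm, Finset.mul_prod_erase _ (fun ν ↦ X - C (x ν)) (Finset.mem_univ μ)]
    exact hprod
  have hne : ∀ ν ∈ Finset.univ.erase μ, x μ ≠ x ν := fun ν hν h ↦
    (Finset.ne_of_mem_erase hν).symm (hinj h)
  have hRμ : R.eval (x μ) ≠ 0 := by
    rw [hR, eval_mul, eval_C, eval_prod]
    refine mul_ne_zero (leadingCoeff_ne_zero.mpr hP0) (Finset.prod_ne_zero_iff.mpr fun ν hν ↦ ?_)
    simpa [sub_eq_zero] using hne ν hν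
  have hR' : (derivative R).eval (x μ) = R.eval (x μ) * ∑ ν, (x μ - x ν)⁻¹ := by
    rw [hR, derivative_C_mul, eval_mul, eval_mul, eval_derivative_prod_X_sub_C _ _ hne,
      Finset.sum_erase _ (by simp)]
    ring
  generalize ∑ ν, (x μ - x ν)⁻¹ = Λ at hR' ⊢
  have hode := congrArg (eval (x μ)) (laguerrePoly_ode hk)
  rw [← hP, hPR] at hode
  simp only [derivative_mul, derivative_sub, derivative_X, derivative_C, derivative_add,
    derivative_one, sub_zero, eval_sub, eval_add, eval_mul, eval_X, eval_C,
    eval_ofNat, eval_one, eval_zero, sub_self, hR'] at hode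
  have h2 : R.eval (x μ) * (2 * x μ * (1 + Λ) - ℓ) = 0 := by
    linear_combination hode
  have h3 := (mul_eq_zero.mp h2).resolve_left hRμ
  have := hx0 μ
  field_simp
  linear_combination h3

/-! ### Nondegeneracy of the equilibria -/

lemma sq_X_sub_C_dvd {W : ℂ[X]} {x : ℂ} (h0 : W.eval x = 0) (h1 : (derivative W).eval x = 0) :
    (X - C x) ^ 2 ∣ W := by
  obtain ⟨V, rfl⟩ := dvd_iff_isRoot.mpr h0
  have : V.eval x = 0 := by simpa using h1
  obtain ⟨U, rfl⟩ := dvd_iff_isRoot.mpr this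
  exact ⟨U, by ring⟩

lemma sq_X_sub_C_dvd_ode {P T : ℂ[X]} {x δ R Λ Λ₂ ℓ : ℂ} (hx : x ≠ 0) (hP : P.eval x = R)
    (hP1 : (derivative P).eval x = R * Λ)
    (hP2 : (derivative (derivative P)).eval x = R * (Λ ^ 2 - Λ₂)) (hℓ : ℓ = 2 * x * (1 + Λ))
    (hT : T.eval x = R ^ 2 * (δ * Λ₂ - ℓ / 2 * δ * (x ^ 2)⁻¹)) :
    (X - C x) ^ 2 ∣ X * derivative (C δ * P ^ 2 + (X - C x) ^ 2 * T)
      + (C 2 * X - C ℓ) * (C δ * P ^ 2 + (X - C x) ^ 2 * T) := by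
  refine sq_X_sub_C_dvd ?_ ?_
  · simp only [sq, derivative_add, derivative_mul, derivative_C, derivative_sub,
      derivative_X, eval_add, eval_mul, eval_sub, eval_X, eval_C,
      eval_zero, eval_one, sub_self, hP1, hP, hℓ]
    ring
  · simp only [sq, derivative_add, derivative_mul, derivative_C, derivative_sub,
      derivative_X, eval_add, eval_mul, eval_sub, eval_X, eval_C,
      eval_zero, eval_one, sub_self, hP1, hP2, hP, hT, derivative_one, derivative_zero]
    rw [hℓ]
    field_simp
    ring

/-- In the degree one above that of `S`, only the term `2X S` contributes, with twice the leading
coefficient. -/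
lemma eq_zero_of_ode {S : ℂ[X]} {ℓ : ℂ} (h : X * derivative S + (C 2 * X - C ℓ) * S = 0) :
    S = 0 := by
  by_contra hne
  have h0 : S.coeff (S.natDegree + 1) = 0 := coeff_eq_zero_of_natDegree_lt (by omega)
  have e : X * derivative S + (C 2 * X - C ℓ) * S
      = X * derivative S + (C 2 * (X * S) - C ℓ * S) := by ring
  have h' := congrArg (fun V : ℂ[X] ↦ V.coeff (S.natDegree + 1)) (e ▸ h)
  simp only [coeff_add, coeff_sub, coeff_C_mul, coeff_X_mul, h0, coeff_derivative,
    coeff_zero] at h'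
  simp at h'
  exact hne h'

lemma natDegree_ode_le {S : ℂ[X]} {ℓ : ℂ} {d : ℕ} (hS : S.natDegree ≤ d) :
    (X * derivative S + (C 2 * X - C ℓ) * S).natDegree ≤ d + 1 := by
  refine (natDegree_add_le _ _).trans (max_le ?_ ?_)
  · refine natDegree_mul_le.trans ?_
    rw [natDegree_X]
    have := natDegree_derivative_le S
    omega
  · refine natDegree_mul_le.trans ?_
    have : (C 2 * X - C ℓ : ℂ[X]).natDegree ≤ 1 := by
      refine (natDegree_sub_le _ _).trans (max_le ?_ (by simp))
      exact (natDegree_C_mul_le _ _).trans natDegree_X_le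
    omega

lemma prod_erase_eq_mul (s : Finset ι) (x : ι → ℂ) {μ ν : ι} (hμ : μ ∈ s) (h : ν ≠ μ) :
    ∏ κ ∈ s.erase ν, (X - C (x κ))
      = (X - C (x μ)) * ∏ κ ∈ (s.erase ν).erase μ, (X - C (x κ)) :=
  (Finset.mul_prod_erase _ (fun κ ↦ X - C (x κ)) (Finset.mem_erase.mpr ⟨h.symm, hμ⟩)).symm

/-- Put `P = ∏ (X - x_ν)` and `y = 1 + P'/P - ℓ/(2X)`. A displacement `δ` of the points changes `y`
by `S/P²`, and the linearized Riccati expression `(S/P²)' + 2y S/P²` equals `(X S' + (2X - ℓ)S)/(X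
P²)`. The linearized equilibrium equations say that it has no pole at the `x_μ`, which is the
divisibility. -/
lemma equilibrium_sq_dvd [Fintype ι] {ℓ : ℕ} {x : ι → ℂ}
    (hinj : Function.Injective x) (hx0 : ∀ μ, x μ ≠ 0)
    (heq : ∀ μ, 1 + ∑ ν, (x μ - x ν)⁻¹ - (ℓ : ℂ) / 2 / x μ = 0) {δ : ι → ℂ}
    (hδ : ∀ μ, - ∑ ν, (δ μ - δ ν) * ((x μ - x ν) ^ 2)⁻¹ + (ℓ : ℂ) / 2 * δ μ * (x μ ^ 2)⁻¹ = 0)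
    {S : ℂ[X]} (hS : S = ∑ μ, C (δ μ) * (∏ ν ∈ Finset.univ.erase μ, (X - C (x ν))) ^ 2) (μ : ι) :
    (X - C (x μ)) ^ 2 ∣ X * derivative S + (C 2 * X - C (ℓ : ℂ)) * S := by
  have hne : ∀ ν ∈ Finset.univ.erase μ, x μ ≠ x ν := fun ν hν h ↦
    (Finset.ne_of_mem_erase hν).symm (hinj h)
  have hST : S = C (δ μ) * (∏ ν ∈ Finset.univ.erase μ, (X - C (x ν))) ^ 2
      + (X - C (x μ)) ^ 2 * ∑ ν ∈ Finset.univ.erase μ,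
        C (δ ν) * (∏ κ ∈ (Finset.univ.erase ν).erase μ, (X - C (x κ))) ^ 2 := by
    rw [hS, ← Finset.add_sum_erase _ _ (Finset.mem_univ μ), Finset.mul_sum]
    congr 1
    refine Finset.sum_congr rfl fun ν hν ↦ ?_
    rw [prod_erase_eq_mul _ x (Finset.mem_univ μ) (Finset.ne_of_mem_erase hν)]
    ring
  rw [hST]
  have hx := hx0 μ
  have heq' : (ℓ : ℂ) = 2 * x μ * (1 + ∑ ν, (x μ - x ν)⁻¹) := by
    have := heq μ
    generalize ∑ ν, (x μ - x ν)⁻¹ = Λ at this ⊢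
    field_simp at this
    linear_combination -this
  have hδ' : ∑ ν, δ ν * ((x μ - x ν) ^ 2)⁻¹
      = δ μ * ∑ ν, ((x μ - x ν) ^ 2)⁻¹ - (ℓ : ℂ) / 2 * δ μ * (x μ ^ 2)⁻¹ := by
    have := hδ μ
    simp only [sub_mul, Finset.sum_sub_distrib, ← Finset.mul_sum] at this
    linear_combination this
  refine sq_X_sub_C_dvd_ode hx rfl (Λ := ∑ ν, (x μ - x ν)⁻¹) (Λ₂ := ∑ ν, ((x μ - x ν) ^ 2)⁻¹)
    ?_ ?_ heq' ?_
  · rw [eval_derivative_prod_X_sub_C _ _ hne, Finset.sum_erase _ (by simp)]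
  · rw [eval_derivative_derivative_prod_X_sub_C _ _ hne, Finset.sum_erase _ (by simp),
      Finset.sum_erase _ (by simp)]
  · rw [← hδ', eval_finsetSum, ← Finset.sum_erase (a := μ) (f := fun ν ↦ δ ν * _) _ (by simp),
      Finset.mul_sum]
    refine Finset.sum_congr rfl fun ν hν ↦ ?_
    have hνμ := Finset.ne_of_mem_erase hν
    have h2 : x μ - x ν ≠ 0 := sub_ne_zero.mpr fun e ↦ hνμ.symm (hinj e)
    rw [prod_erase_eq_mul _ x (Finset.mem_univ ν) hνμ.symm, Finset.erase_right_comm]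
    simp only [eval_mul, eval_C, eval_pow, eval_sub, eval_X]
    field_simp

/-- With `m` points, `S` has degree at most `2m - 2`, so `X S' + (2X - ℓ)S` has degree at most `2m -
1`. It is divisible by `∏ (X - x_μ)²`, of degree `2m`, hence is zero; this forces `S = 0`, and
evaluation at `x_μ` isolates `δ_μ`. -/
lemma equilibrium_linearization_injective [Fintype ι] {ℓ : ℕ} {x : ι → ℂ}
    (hinj : Function.Injective x) (hx0 : ∀ μ, x μ ≠ 0)
    (heq : ∀ μ, 1 + ∑ ν, (x μ - x ν)⁻¹ - (ℓ : ℂ) / 2 / x μ = 0) {δ : ι → ℂ}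
    (hδ : ∀ μ, - ∑ ν, (δ μ - δ ν) * ((x μ - x ν) ^ 2)⁻¹ + (ℓ : ℂ) / 2 * δ μ * (x μ ^ 2)⁻¹ = 0) :
    δ = 0 := by
  obtain ⟨S, hS⟩ : ∃ S : ℂ[X],
    S = ∑ μ, C (δ μ) * (∏ ν ∈ Finset.univ.erase μ, (X - C (x ν))) ^ 2 := ⟨_, rfl⟩
  funext μ
  have hprod : ∏ μ, (X - C (x μ)) ^ 2 ∣ X * derivative S + (C 2 * X - C (ℓ : ℂ)) * S := by
    refine Finset.prod_dvd_of_coprime (fun a _ b _ hab ↦ ?_)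
      fun μ _ ↦ equilibrium_sq_dvd hinj hx0 heq hδ hS μ
    exact (isCoprime_X_sub_C_of_isUnit_sub (sub_ne_zero.mpr (hinj.ne hab)).isUnit).pow
  have hSdeg : S.natDegree ≤ 2 * (Fintype.card ι - 1) := by
    rw [hS]
    refine natDegree_sum_le_of_forall_le _ _ fun μ _ ↦ ?_
    refine (natDegree_C_mul_le _ _).trans (natDegree_pow_le.trans ?_)
    rw [natDegree_prod _ _ fun μ _ ↦ X_sub_C_ne_zero _]
    simp
  have hW : X * derivative S + (C 2 * X - C (ℓ : ℂ)) * S = 0 := by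
    by_contra hne
    have h1 := natDegree_le_of_dvd hprod hne
    have h2 : (∏ μ, (X - C (x μ)) ^ 2).natDegree = 2 * Fintype.card ι := by
      rw [natDegree_prod _ _ fun μ _ ↦ pow_ne_zero _ (X_sub_C_ne_zero _)]
      simp [natDegree_pow, mul_comm]
    have hk : 0 < Fintype.card ι := Fintype.card_pos_iff.mpr ⟨μ⟩
    have h3 := natDegree_ode_le (ℓ := (ℓ : ℂ)) hSdeg
    omega
  have h := congrArg (eval (x μ)) (eq_zero_of_ode hW)
  rw [hS, eval_finsetSum, Finset.sum_eq_single μ] at h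
  · simp only [eval_mul, eval_C, eval_pow, eval_zero] at h
    refine (mul_eq_zero.mp h).resolve_right (pow_ne_zero _ ?_)
    rw [eval_prod]
    refine Finset.prod_ne_zero_iff.mpr fun ν hν ↦ ?_
    have : x μ ≠ x ν := fun h ↦ (Finset.ne_of_mem_erase hν).symm (hinj h)
    simpa [sub_eq_zero] using this
  · intro ν _ hν
    rw [prod_erase_eq_mul _ x (Finset.mem_univ μ) hν]
    simp
  · simp

end Equilibrium

end

end GLame

namespace GLame

noncomputable section

/-! ### Analytic arcs of the generalized Lamé curve -/

lemma exists_analytic_localInverse {E : Type*} [NormedAddCommGroup E] [NormedSpace ℂ E]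
    [FiniteDimensional ℂ E] {F : E → E} {x : E} (hF : AnalyticAt ℂ F x)
    (hinj : ∀ v, fderiv ℂ F x v = 0 → v = 0) :
    ∃ g : E → E, AnalyticAt ℂ g (F x) ∧ g (F x) = x ∧ (∀ᶠ y in 𝓝 (F x), F (g y) = y) ∧
      ∀ᶠ z in 𝓝 x, g (F z) = z := by
  have : CompleteSpace E := FiniteDimensional.complete ℂ E
  have hi : Function.Injective (fderiv ℂ F x : E →ₗ[ℂ] E) :=
    (injective_iff_map_eq_zero _).mpr hinj
  let e : E ≃L[ℂ] E := (LinearEquiv.ofInjectiveEndo _ hi).toContinuousLinearEquiv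
  have he : HasFDerivAt F (e : E →L[ℂ] E) x := by
    have : (e : E →L[ℂ] E) = fderiv ℂ F x := by
      ext v
      simp [e]
    rw [this]
    exact hF.differentiableAt.hasFDerivAt
  -- Here `⊤` is the analytic smoothness class, so the inverse function theorem returns an analytic
  -- inverse.
  have hc : ContDiffAt ℂ ⊤ F x := hF.contDiffAt
  have hs : HasStrictFDerivAt F (e : E →L[ℂ] E) x := hc.hasStrictFDerivAt' he (by simp)
  refine ⟨hc.localInverse he (by simp), ?_, ?_, ?_, ?_⟩
  · exact (hc.to_localInverse he (by simp)).analyticAt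
  · exact hs.localInverse_apply_image
  · exact hs.eventually_right_inverse
  · exact hs.eventually_left_inverse

variable {r n : ℕ} {L : PeriodPair} {p : Fin r → ℂ} {ℓ : Fin r → ℕ}

/-- To leading order points at different poles do not interact, so the fibres of `idx` can be
treated separately, both for existence and for the linearization. -/
lemma exists_clustered_equilibrium (ℓ : Fin r → ℕ) {idx : Fin n → Fin r}
    (hidx : ∀ i, Fintype.card {μ // idx μ = i} ≤ ℓ i) : ∃ x : Fin n → ℂ,
    (∀ μ ν, idx μ = idx ν → x μ = x ν → μ = ν) ∧ (∀ μ, x μ ≠ 0) ∧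
    (∀ μ, 1 + ∑ ν, (if idx ν = idx μ then (x μ - x ν)⁻¹ else 0) - wt ℓ (idx μ) * (x μ)⁻¹ = 0) ∧
    ∀ δ : Fin n → ℂ, (∀ μ, - ∑ ν, (if idx ν = idx μ then (δ μ - δ ν) * ((x μ - x ν) ^ 2)⁻¹ else 0)
      + wt ℓ (idx μ) * (δ μ * (x μ ^ 2)⁻¹) = 0) → δ = 0 := by
  choose y hy1 hy2 hy3 using fun i ↦ exists_equilibrium (ι := {μ // idx μ = i}) (hidx i)
  set x : Fin n → ℂ := fun μ ↦ y (idx μ) ⟨μ, rfl⟩ with hx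
  have hxy : ∀ i (m : {μ // idx μ = i}), x m = y i m := by
    rintro i ⟨μ, rfl⟩
    rfl
  have hsum : ∀ (i : Fin r) (f : Fin n → ℂ),
      ∑ ν, (if idx ν = i then f ν else 0) = ∑ m : {μ // idx μ = i}, f m := by
    intro i f
    rw [← Finset.sum_filter]
    exact Finset.sum_subtype _ (by simp) f
  refine ⟨x, fun μ ν h1 h2 ↦ ?_, fun μ ↦ hy2 _ _, fun μ ↦ ?_, fun δ hδ ↦ ?_⟩
  · rw [hxy (idx ν) ⟨μ, h1⟩, hxy (idx ν) ⟨ν, rfl⟩] at h2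
    exact congrArg Subtype.val (hy1 _ h2)
  · rw [hsum]
    have := hy3 (idx μ) ⟨μ, rfl⟩
    simp only [hxy]
    rw [wt, ← div_eq_mul_inv]
    exact this
  · funext μ
    have := equilibrium_linearization_injective (hy1 (idx μ)) (hy2 (idx μ)) (hy3 (idx μ))
      (δ := fun m ↦ δ m) fun m ↦ ?_
    · exact congrFun this ⟨μ, rfl⟩
    · have h := hδ m
      rw [hsum, m.2] at h
      simp only [hxy] at h
      rw [wt] at h
      linear_combination h

/-- The contribution of `a_ν` to the rescaled residue equation at `a_μ`, where
`a_μ = p_{idx μ} + s x_μ`. -/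
def pairTerm (L : PeriodPair) (p : Fin r → ℂ) (idx : Fin n → Fin r) (μ ν : Fin n)
    (v : ℂ × (Fin n → ℂ)) : ℂ :=
  if idx ν = idx μ then (v.2 μ - v.2 ν)⁻¹ + v.1 * zetaWReg L (v.1 * (v.2 μ - v.2 ν))
  else v.1 * zetaW L (p (idx μ) - p (idx ν) + v.1 * (v.2 μ - v.2 ν))

/-- The contribution of `p_i` to the rescaled residue equation at `a_μ`. -/
def poleTerm (L : PeriodPair) (p : Fin r → ℂ) (idx : Fin n → Fin r) (μ : Fin n) (i : Fin r)
    (v : ℂ × (Fin n → ℂ)) : ℂ :=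
  if i = idx μ then (v.2 μ)⁻¹ + v.1 * zetaWReg L (v.1 * v.2 μ)
  else v.1 * zetaW L (p (idx μ) - p i + v.1 * v.2 μ)

/-- The rescaled residue equation. -/
def scaledEq (L : PeriodPair) (p : Fin r → ℂ) (ℓ : Fin r → ℕ) (idx : Fin n → Fin r) (μ : Fin n)
    (v : ℂ × (Fin n → ℂ)) : ℂ :=
  1 + ∑ ν, pairTerm L p idx μ ν v - ∑ i, wt ℓ i * poleTerm L p idx μ i v

/-- This splits off the singular part of the rescaled `ζ`; the right-hand side makes sense at `s =
0` and is analytic there for `y ≠ 0`. -/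
lemma mul_zetaW_mul {s : ℂ} (hs : s ≠ 0) (y : ℂ) :
    s * zetaW L (s * y) = y⁻¹ + s * zetaWReg L (s * y) := by
  rw [zetaW_eq]
  by_cases hy : y = 0
  · simp [hy]
  · field_simp
    ring

lemma scaledEq_eq {idx : Fin n → Fin r} {s : ℂ} (hs : s ≠ 0) (x : Fin n → ℂ) (μ : Fin n) :
    scaledEq L p ℓ idx μ (s, x) = s * ansatzEq L p ℓ (fun μ ↦ p (idx μ) + s * x μ) s⁻¹ μ := by
  have h1 : ∀ ν, pairTerm L p idx μ ν (s, x)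
      = s * zetaW L (p (idx μ) + s * x μ - (p (idx ν) + s * x ν)) := by
    intro ν
    rw [pairTerm]
    split_ifs with h
    · rw [← mul_zetaW_mul hs, h]
      congr 2
      ring
    · congr 2
      ring
  have h2 : ∀ i, wt ℓ i * poleTerm L p idx μ i (s, x)
      = s * (wt ℓ i * zetaW L (p (idx μ) + s * x μ - p i)) := by
    intro i
    rw [poleTerm]
    split_ifs with h
    · rw [← mul_zetaW_mul hs, h, add_sub_cancel_left]
      ring
    · rw [mul_left_comm]
      congr 4
      ring
  simp only [scaledEq, ansatzEq, h1, h2, ← Finset.mul_sum]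
  field_simp

section AnalyticTerms

variable {E : Type*} [NormedAddCommGroup E] [NormedSpace ℂ E]

lemma analyticAt_mul_zetaWReg {s y : E → ℂ} {v : E} (hs : AnalyticAt ℂ s v)
    (hy : AnalyticAt ℂ y v) (h0 : s v = 0) :
    AnalyticAt ℂ (fun v ↦ s v * zetaWReg L (s v * y v)) v :=
  hs.mul (AnalyticAt.comp_of_eq (g := zetaWReg L) (analyticAt_zetaWReg L) (hs.mul hy)
    (by simp [h0]))

lemma analyticAt_mul_zetaW {s y : E → ℂ} {v : E} (hs : AnalyticAt ℂ s v)
    (hy : AnalyticAt ℂ y v) (h0 : s v = 0) {c : ℂ} (hc : c ∉ L.lattice) :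
    AnalyticAt ℂ (fun v ↦ s v * zetaW L (c + s v * y v)) v :=
  hs.mul (AnalyticAt.comp_of_eq (g := zetaW L) (analyticAt_zetaW L hc)
    (analyticAt_const.add (hs.mul hy)) (by simp [h0]))

end AnalyticTerms

lemma analyticAt_apply_snd (v : ℂ × (Fin n → ℂ)) (μ : Fin n) :
    AnalyticAt ℂ (fun v : ℂ × (Fin n → ℂ) ↦ v.2 μ) v :=
  (ContinuousLinearMap.analyticAt
    ((ContinuousLinearMap.proj μ).comp (ContinuousLinearMap.snd ℂ ℂ (Fin n → ℂ))) v)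

lemma analyticAt_scaledEq (hp : ∀ i j, i ≠ j → p i - p j ∉ L.lattice) {idx : Fin n → Fin r}
    {x : Fin n → ℂ} (h1 : ∀ μ ν, idx μ = idx ν → x μ = x ν → μ = ν) (h2 : ∀ μ, x μ ≠ 0)
    (μ : Fin n) : AnalyticAt ℂ (scaledEq L p ℓ idx μ) (0, x) := by
  have hs : AnalyticAt ℂ (fun v : ℂ × (Fin n → ℂ) ↦ v.1) (0, x) := analyticAt_fst
  refine .sub (analyticAt_const.add (Finset.analyticAt_fun_sum _ fun ν _ ↦ ?_))
    (Finset.analyticAt_fun_sum _ fun i _ ↦ analyticAt_const.mul ?_)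
  · have hd : AnalyticAt ℂ (fun v : ℂ × (Fin n → ℂ) ↦ v.2 μ - v.2 ν) (0, x) :=
      (analyticAt_apply_snd _ μ).sub (analyticAt_apply_snd _ ν)
    unfold pairTerm
    split_ifs with h
    · refine .add ?_ (analyticAt_mul_zetaWReg hs hd rfl)
      by_cases hμ : μ = ν
      · subst hμ
        simp only [sub_self]
        exact analyticAt_const
      · exact hd.inv (sub_ne_zero.mpr fun e ↦ hμ (h1 μ ν h.symm e))
    · exact analyticAt_mul_zetaW hs hd rfl (hp _ _ fun e ↦ h e.symm)
  · unfold poleTerm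
    split_ifs with h
    · exact ((analyticAt_apply_snd _ μ).inv (h2 μ)).add
        (analyticAt_mul_zetaWReg hs (analyticAt_apply_snd _ μ) rfl)
    · exact analyticAt_mul_zetaW hs (analyticAt_apply_snd _ μ) rfl (hp _ _ fun e ↦ h e.symm)

lemma scaledEq_zero (idx : Fin n → Fin r) (μ : Fin n) (x : Fin n → ℂ) :
    scaledEq L p ℓ idx μ (0, x) = 1 + ∑ ν, (if idx ν = idx μ then (x μ - x ν)⁻¹ else 0)
      - wt ℓ (idx μ) * (x μ)⁻¹ := by
  simp only [scaledEq, pairTerm, poleTerm, zero_mul, add_zero]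
  congr 1
  rw [Finset.sum_eq_single (idx μ)]
  · simp
  · intro i _ hi
    simp [hi]
  · simp

lemma hasDerivAt_scaledEq_zero {idx : Fin n → Fin r} {x : Fin n → ℂ}
    (h1 : ∀ μ ν, idx μ = idx ν → x μ = x ν → μ = ν) (h2 : ∀ μ, x μ ≠ 0) (δ : Fin n → ℂ)
    (μ : Fin n) : HasDerivAt (fun t : ℂ ↦ scaledEq L p ℓ idx μ (0, x + t • δ))
      (- ∑ ν, (if idx ν = idx μ then (δ μ - δ ν) * ((x μ - x ν) ^ 2)⁻¹ else 0)
      + wt ℓ (idx μ) * (δ μ * (x μ ^ 2)⁻¹)) 0 := by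
  simp only [scaledEq_zero, Pi.add_apply, Pi.smul_apply, smul_eq_mul]
  have hl : ∀ μ, HasDerivAt (fun t : ℂ ↦ x μ + t * δ μ) (δ μ) 0 := fun μ ↦ by
    simpa using ((hasDerivAt_id (0 : ℂ)).mul_const (δ μ)).const_add (x μ)
  have hi : HasDerivAt (fun t : ℂ ↦ (x μ + t * δ μ)⁻¹) (- (δ μ * (x μ ^ 2)⁻¹)) 0 := by
    refine ((hl μ).inv (by simpa using h2 μ)).congr_deriv ?_
    simp [div_eq_mul_inv]
  have hs : HasDerivAt (fun t : ℂ ↦ ∑ ν, (if idx ν = idx μ then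
      (x μ + t * δ μ - (x ν + t * δ ν))⁻¹ else 0))
      (∑ ν, (if idx ν = idx μ then - ((δ μ - δ ν) * ((x μ - x ν) ^ 2)⁻¹) else 0)) 0 := by
    refine HasDerivAt.fun_sum fun ν _ ↦ ?_
    split_ifs with h
    · by_cases hμ : μ = ν
      · subst hμ
        simpa using hasDerivAt_const (0 : ℂ) (0 : ℂ)
      · have hne : x μ - x ν ≠ 0 := sub_ne_zero.mpr fun e ↦ hμ (h1 μ ν h.symm e)
        refine (((hl μ).sub (hl ν)).inv (by simpa using hne)).congr_deriv ?_
        simp only [zero_mul, add_zero, Pi.sub_apply]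
        rw [div_eq_mul_inv, neg_mul]
    · exact hasDerivAt_const _ _
  refine ((hs.const_add 1).sub (hi.const_mul (wt ℓ (idx μ)))).congr_deriv ?_
  rw [← Finset.sum_neg_distrib]
  simp only [mul_neg, sub_neg_eq_add]
  congr 1
  refine Finset.sum_congr rfl fun ν _ ↦ ?_
  split_ifs <;> simp

/-- Implicit function theorem, obtained by inverting `(s, x) ↦ (s, scaledEq)` at `(0, x)`. A kernel
vector of its derivative has no `s`-component, and the remaining part is killed by the linearized
equilibrium equations, hence zero by `h4`. -/
lemma exists_scaled_arc (hp : ∀ i j, i ≠ j → p i - p j ∉ L.lattice) {idx : Fin n → Fin r}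
    {x : Fin n → ℂ} (h1 : ∀ μ ν, idx μ = idx ν → x μ = x ν → μ = ν) (h2 : ∀ μ, x μ ≠ 0)
    (h3 : ∀ μ, 1 + ∑ ν, (if idx ν = idx μ then (x μ - x ν)⁻¹ else 0)
      - wt ℓ (idx μ) * (x μ)⁻¹ = 0)
    (h4 : ∀ δ : Fin n → ℂ,
      (∀ μ, - ∑ ν, (if idx ν = idx μ then (δ μ - δ ν) * ((x μ - x ν) ^ 2)⁻¹ else 0)
        + wt ℓ (idx μ) * (δ μ * (x μ ^ 2)⁻¹) = 0) → δ = 0) :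
    ∃ y : ℂ → Fin n → ℂ, (∀ μ, AnalyticAt ℂ (fun s ↦ y s μ) 0) ∧ y 0 = x ∧
      ∀ᶠ s in 𝓝 0, ∀ μ, scaledEq L p ℓ idx μ (s, y s) = 0 := by
  set F : ℂ × (Fin n → ℂ) → ℂ × (Fin n → ℂ) := fun v ↦ (v.1, fun μ ↦ scaledEq L p ℓ idx μ v)
    with hF
  have hG : AnalyticAt ℂ (fun v ↦ fun μ ↦ scaledEq L p ℓ idx μ v) ((0 : ℂ), x) :=
    AnalyticAt.pi fun μ ↦ analyticAt_scaledEq hp h1 h2 μ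
  have hFan : AnalyticAt ℂ F (0, x) := analyticAt_fst.prod hG
  have hF0 : F (0, x) = (0, 0) := by
    refine Prod.ext rfl (funext fun μ ↦ ?_)
    change scaledEq L p ℓ idx μ (0, x) = 0
    rw [scaledEq_zero]
    exact h3 μ
  have hinj : ∀ v, fderiv ℂ F (0, x) v = 0 → v = 0 := by
    rintro ⟨s, δ⟩ hv
    have hfd := (analyticAt_fst (𝕜 := ℂ) (p := ((0 : ℂ), x))).differentiableAt.hasFDerivAt.prodMk
      hG.differentiableAt.hasFDerivAt
    rw [HasFDerivAt.fderiv (f := F) hfd] at hv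
    have hv1 : s = 0 := by
      have := congrArg Prod.fst hv
      simpa [fderiv_fst] using this
    subst hv1
    have hv2 := congrArg Prod.snd hv
    simp only [ContinuousLinearMap.prod_apply, Prod.snd_zero] at hv2
    have hδ : δ = 0 := by
      refine h4 δ fun μ ↦ ?_
      have hl : HasDerivAt (fun t : ℂ ↦ (((0 : ℂ), x + t • δ) : ℂ × (Fin n → ℂ))) (0, δ) 0 := by
        refine (hasDerivAt_const _ _).prodMk ?_
        simpa using ((hasDerivAt_id (0 : ℂ)).smul_const δ).const_add x
      have hμ := (analyticAt_scaledEq (ℓ := ℓ) hp h1 h2 μ).differentiableAt.hasFDerivAt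
      have hx : ((0 : ℂ), x) = (fun t : ℂ ↦ (((0 : ℂ), x + t • δ) : ℂ × (Fin n → ℂ))) 0 := by simp
      have hd := HasFDerivAt.comp_hasDerivAt_of_eq (0 : ℂ) hμ hl hx
      rw [(hasDerivAt_scaledEq_zero (L := L) (p := p) (ℓ := ℓ) h1 h2 δ μ).unique hd]
      have h5 := (hasFDerivAt_pi'.mp hG.differentiableAt.hasFDerivAt) μ
      rw [hμ.unique h5]
      simp [hv2]
    rw [hδ]
    rfl
  obtain ⟨g, hg, hg0, hgr, -⟩ := exists_analytic_localInverse hFan hinj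
  rw [hF0] at hg hg0 hgr
  have hl : AnalyticAt ℂ (fun s : ℂ ↦ ((s, 0) : ℂ × (Fin n → ℂ))) 0 :=
    analyticAt_id.prod analyticAt_const
  have hgl : AnalyticAt ℂ (fun s : ℂ ↦ g (s, 0)) 0 := hg.comp_of_eq hl rfl
  have hev : ∀ᶠ s : ℂ in 𝓝 0, F (g (s, 0)) = (s, 0) :=
    (hl.continuousAt.tendsto).eventually hgr
  refine ⟨fun s ↦ (g (s, 0)).2, fun μ ↦ ?_, ?_, ?_⟩
  · exact (analyticAt_apply_snd _ μ).comp_of_eq hgl rfl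
  · change (g (0, 0)).2 = x
    rw [hg0]
  · filter_upwards [hev] with s hs μ
    have h5 : (g (s, 0)).1 = s := congrArg Prod.fst hs
    have h6 := congrFun (congrArg Prod.snd hs) μ
    have h7 : ((s, (g (s, 0)).2) : ℂ × (Fin n → ℂ)) = g (s, 0) :=
      Prod.ext h5.symm rfl
    rw [h7]
    exact h6

end

end GLame

namespace GLame

noncomputable section

variable {r n : ℕ} {L : PeriodPair} {p : Fin r → ℂ} {ℓ : Fin r → ℕ}

/-! ### Arcs of the curve and analyticity of their accessory parameters -/

lemma analyticAt_logDerivAnsatz {a : Fin n → ℂ} {h z : ℂ} (h1 : ∀ μ, z - a μ ∉ L.lattice)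
    (h2 : ∀ i, z - p i ∉ L.lattice) : AnalyticAt ℂ (logDerivAnsatz L p ℓ a h) z := by
  refine .sub (.add analyticAt_const (Finset.analyticAt_fun_sum _ fun μ _ ↦ ?_))
    (Finset.analyticAt_fun_sum _ fun i _ ↦ analyticAt_const.mul ?_)
  · exact analyticAt_zetaW_sub (h1 μ)
  · exact analyticAt_zetaW_sub (h2 i)

lemma continuousAt_logDerivAnsatz' {a : Fin n → ℂ} {z : ℂ} (h1 : ∀ μ, z - a μ ∉ L.lattice)
    (h2 : ∀ i, z - p i ∉ L.lattice) : ContinuousAt (logDerivAnsatz' L p ℓ a) z := by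
  refine AnalyticAt.continuousAt (𝕜 := ℂ)
    (.add (.neg (Finset.analyticAt_fun_sum _ fun μ _ ↦ ?_))
    (Finset.analyticAt_fun_sum _ fun i _ ↦ analyticAt_const.mul ?_))
  · exact analyticAt_weierstrassP_sub (h1 μ)
  · exact analyticAt_weierstrassP_sub (h2 i)

/-- The differential equation at a regular point, solved for `B`. -/
lemma IsAccessory.eq_at (hn : 0 < n)
    (hp : ∀ i j, i ≠ j → p i - p j ∉ L.lattice) (hℓ : ∀ i, 0 < ℓ i) (hsum : ∑ i, ℓ i = 2 * n)
    {a : Fin n → ℂ} {h : ℂ} (H : IsAnsatz L p ℓ a h) {A : Fin r → ℂ} {B : ℂ}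
    (hAB : IsAccessory L p ℓ a h A B) {z : ℂ} (h1 : ∀ μ, z - a μ ∉ L.lattice)
    (h2 : ∀ i, z - p i ∉ L.lattice) :
    B = logDerivAnsatz' L p ℓ a z + logDerivAnsatz L p ℓ a h z ^ 2
      - (∑ i, wt ℓ i * (wt ℓ i + 1) * L.weierstrassP (z - p i) + ∑ i, A i * zetaW L (z - p i)) := by
  have hc : ContinuousAt (riccatiDefect L p ℓ a h A B) z :=
    ((continuousAt_logDerivAnsatz' h1 h2).add
      ((analyticAt_logDerivAnsatz h1 h2).continuousAt.pow 2)).sub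
      (analyticAt_potential h2).continuousAt
  have h0 : riccatiDefect L p ℓ a h A B z = 0 := by
    refine tendsto_nhds_unique (hc.tendsto.mono_left inf_le_left : Tendsto _ (𝓝[≠] z) _) ?_
    refine (tendsto_const_nhds (x := (0 : ℂ))).congr' ?_
    filter_upwards [hAB.riccatiDefect_eq_zero hn hp hℓ hsum H z] with x hx
    exact hx.symm
  rw [riccatiDefect, potential] at h0
  linear_combination -h0

lemma exists_generic_point (L : PeriodPair) (a : Fin n → ℂ) (p : Fin r → ℂ) :
    ∃ z : ℂ, (∀ μ, z - a μ ∉ L.lattice) ∧ ∀ i, z - p i ∉ L.lattice :=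
  (eventually_generic L a p 0).exists

/-- Multiplied by `-ℓ_i`, the left-hand side is the rescaled residue `s A_i`. The right-hand side is
its continuation to `s = 0`. -/
lemma mul_ansatzRegP_zero {idx : Fin n → Fin r} {s : ℂ} (hs : s ≠ 0) (x : Fin n → ℂ) (i : Fin r) :
    s * ansatzRegP L p ℓ (fun μ ↦ p (idx μ) + s * x μ) s⁻¹ i 0
      = 1 - ∑ μ, (if idx μ = i then (x μ)⁻¹ + s * zetaWReg L (s * x μ)
        else s * zetaW L (p (idx μ) - p i + s * x μ))
        - s * ∑ j ∈ Finset.univ.erase i, wt ℓ j * zetaW L (p i - p j) := by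
  rw [ansatzRegP_zero, mul_sub, mul_add, mul_inv_cancel₀ hs, Finset.mul_sum, sub_eq_add_neg (1 : ℂ),
    ← Finset.sum_neg_distrib]
  congr 2
  refine Finset.sum_congr rfl fun μ _ ↦ ?_
  rw [zetaW_sub_comm, mul_neg]
  congr 1
  split_ifs with h
  · rw [← mul_zetaW_mul hs, h, add_sub_cancel_left]
  · congr 2
    ring

/-- Every admissible clustering is the limit of an analytic arc of the curve. -/
lemma exists_arc (hn : 0 < n) (hp : ∀ i j, i ≠ j → p i - p j ∉ L.lattice) (hℓ : ∀ i, 0 < ℓ i)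
    (hsum : ∑ i, ℓ i = 2 * n) {idx : Fin n → Fin r}
    (hidx : ∀ i, Fintype.card {μ // idx μ = i} ≤ ℓ i) :
    ∃ (a : ℂ → Fin n → ℂ) (A : ℂ → Fin r → ℂ) (B : ℂ → ℂ),
      Tendsto a (𝓝[≠] 0) (𝓝 fun μ ↦ p (idx μ)) ∧
      AnalyticAt ℂ A 0 ∧ AnalyticAt ℂ B 0 ∧
      A 0 = (fun i ↦ 2 * (Fintype.card {μ // idx μ = i} : ℂ) - ℓ i) ∧ B 0 = 1 ∧
      ∀ᶠ s in 𝓝[≠] 0, IsAnsatz L p ℓ (a s) s⁻¹ ∧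
        IsAccessory L p ℓ (a s) s⁻¹ (s⁻¹ • A s) (B s / s ^ 2) := by
  obtain ⟨x, h1, h2, h3, h4⟩ := exists_clustered_equilibrium ℓ hidx
  obtain ⟨y, hy, hy0, hyeq⟩ := exists_scaled_arc (L := L) (p := p) (ℓ := ℓ) hp h1 h2 h3 h4
  have hy0' : ∀ μ, y 0 μ = x μ := fun μ ↦ congrFun hy0 μ
  set a : ℂ → Fin n → ℂ := fun s μ ↦ p (idx μ) + s * y s μ with ha
  have hid : AnalyticAt ℂ (fun s : ℂ ↦ s) 0 := analyticAt_id
  have ha_an : ∀ μ, AnalyticAt ℂ (fun s ↦ a s μ) 0 := fun μ ↦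
    analyticAt_const.add (hid.mul (hy μ))
  have ha0 : ∀ μ, a 0 μ = p (idx μ) := fun μ ↦ by simp [ha]
  -- The constant `B` is recovered from the differential equation at a fixed `z` off the poles. The
  -- formula at `p_i` would involve `℘(p_i - a_μ)`, which is singular as `s → 0`.
  obtain ⟨z, -, hz⟩ := exists_generic_point L (fun _ : Fin 0 ↦ 0) p
  set A : ℂ → Fin r → ℂ := fun s i ↦ - (ℓ i * (1 - ∑ μ, (if idx μ = i then
    (y s μ)⁻¹ + s * zetaWReg L (s * y s μ) else s * zetaW L (p (idx μ) - p i + s * y s μ))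
    - s * ∑ j ∈ Finset.univ.erase i, wt ℓ j * zetaW L (p i - p j))) with hA
  set B : ℂ → ℂ := fun s ↦ s ^ 2 * logDerivAnsatz' L p ℓ (a s) z
    + (1 + s * logDerivAnsatz L p ℓ (a s) 0 z) ^ 2
    - (s ^ 2 * ∑ i, wt ℓ i * (wt ℓ i + 1) * L.weierstrassP (z - p i)
      + s * ∑ i, A s i * zetaW L (z - p i)) with hB
  have hA_an : ∀ i, AnalyticAt ℂ (fun s ↦ A s i) 0 := by
    intro i
    refine (analyticAt_const.mul ((analyticAt_const.sub
      (Finset.analyticAt_fun_sum _ fun μ _ ↦ ?_)).sub (hid.mul analyticAt_const))).neg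
    split_ifs with h
    · exact ((hy μ).inv (by rw [hy0']; exact h2 μ)).add (analyticAt_mul_zetaWReg hid (hy μ) rfl)
    · exact analyticAt_mul_zetaW hid (hy μ) rfl (hp _ _ h)
  have hza : ∀ μ, z - a 0 μ ∉ L.lattice := fun μ ↦ by rw [ha0]; exact hz _
  have hzA : ∀ μ, AnalyticAt ℂ (fun s ↦ zetaW L (z - a s μ)) 0 := fun μ ↦
    AnalyticAt.comp_of_eq (g := zetaW L) (analyticAt_zetaW L (hza μ))
      (analyticAt_const.sub (ha_an μ)) rfl
  have hpA : ∀ μ, AnalyticAt ℂ (fun s ↦ L.weierstrassP (z - a s μ)) 0 := fun μ ↦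
    AnalyticAt.comp_of_eq (g := L.weierstrassP) (analyticAt_weierstrassP L (hza μ))
      (analyticAt_const.sub (ha_an μ)) rfl
  have hB_an : AnalyticAt ℂ B 0 := by
    refine .sub (.add ((hid.pow 2).mul ?_) ((analyticAt_const.add (hid.mul ?_)).pow 2))
      (.add ((hid.pow 2).mul analyticAt_const) (hid.mul ?_))
    · exact (Finset.analyticAt_fun_sum _ fun μ _ ↦ hpA μ).neg.add analyticAt_const
    · exact (analyticAt_const.add (Finset.analyticAt_fun_sum _ fun μ _ ↦ hzA μ)).sub
        analyticAt_const
    · exact Finset.analyticAt_fun_sum _ fun i _ ↦ (hA_an i).mul analyticAt_const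
  refine ⟨a, A, B, ?_, AnalyticAt.pi hA_an, hB_an, ?_, by simp [hB], ?_⟩
  · refine tendsto_pi_nhds.mpr fun μ ↦ ?_
    have := (ha_an μ).continuousAt.tendsto
    rw [ha0] at this
    exact this.mono_left inf_le_left
  · funext i
    -- Summed over the cluster at `p_i`, the interactions cancel and the equilibrium equations give
    -- `k_i = n_i ∑ 1/x_μ`, where `k_i` is the size of the cluster. Hence `A_i(0) = -ℓ_i(1 - ∑
    -- 1/x_μ) = 2k_i - ℓ_i`.
    have hsumi : ∑ μ, (if idx μ = i then (1 + ∑ ν, (if idx ν = idx μ then (x μ - x ν)⁻¹ else 0)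
        - wt ℓ (idx μ) * (x μ)⁻¹) else 0) = 0 :=
      Finset.sum_eq_zero fun μ _ ↦ by rw [h3]; simp
    have hanti : ∑ μ, ∑ ν, (if idx μ = i ∧ idx ν = i then (x μ - x ν)⁻¹ else 0) = 0 := by
      refine sum_sum_antisymm Finset.univ
        (fun μ ν ↦ if idx μ = i ∧ idx ν = i then (x μ - x ν)⁻¹ else 0) fun μ ν ↦ ?_
      simp only [and_comm (a := idx ν = i)]
      split_ifs
      · rw [← neg_sub, inv_neg]
      · simp
    have hcard : ∑ μ, (if idx μ = i then (1 : ℂ) else 0)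
        = (Fintype.card {μ // idx μ = i} : ℂ) := by
      rw [Finset.sum_boole, Fintype.card_subtype]
    have hsplit : ∀ μ, (if idx μ = i then (1 + ∑ ν, (if idx ν = idx μ then (x μ - x ν)⁻¹ else 0)
        - wt ℓ (idx μ) * (x μ)⁻¹) else 0)
        = (if idx μ = i then (1 : ℂ) else 0)
          + ∑ ν, (if idx μ = i ∧ idx ν = i then (x μ - x ν)⁻¹ else 0)
          - wt ℓ i * (if idx μ = i then (x μ)⁻¹ else 0) := by
      intro μ
      by_cases h : idx μ = i
      · simp [h]
      · simp [h]
    simp only [hsplit, Finset.sum_add_distrib, Finset.sum_sub_distrib, hanti, hcard,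
      ← Finset.mul_sum] at hsumi
    simp only [hA, zero_mul, add_zero, sub_zero, hy0']
    rw [← two_mul_wt]
    linear_combination (-2 : ℂ) * hsumi
  · have hy_cont : ∀ μ, Tendsto (fun s ↦ y s μ) (𝓝[≠] 0) (𝓝 (x μ)) := fun μ ↦ by
      have := (hy μ).continuousAt.tendsto
      rw [hy0'] at this
      exact this.mono_left inf_le_left
    -- Within a cluster, differences are `s` times something with a nonzero limit: small but not
    -- zero, so not lattice points.
    have hsmall : ∀ f : ℂ → ℂ, ∀ b : ℂ, b ≠ 0 → Tendsto f (𝓝[≠] 0) (𝓝 b) →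
        ∀ᶠ s in 𝓝[≠] 0, s * f s ∉ L.lattice := by
      intro f b hb hf
      have hnhds : ((L.lattice : Set ℂ) \ {0})ᶜ ∈ 𝓝 (0 : ℂ) :=
        L.compl_lattice_sdiff_singleton_mem_nhds 0
      have ht : Tendsto (fun s : ℂ ↦ s * f s) (𝓝[≠] 0) (𝓝 0) := by
        have := (tendsto_id.mono_left inf_le_left : Tendsto id (𝓝[≠] (0 : ℂ)) (𝓝 0)).mul hf
        simpa using this
      filter_upwards [ht.eventually hnhds, self_mem_nhdsWithin, hf.eventually_ne hb]
        with s h5 h6 h7 h8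
      exact h5 ⟨h8, mul_ne_zero h6 h7⟩
    have hopen : ∀ f : ℂ → ℂ, ∀ b : ℂ, b ∉ L.lattice → Tendsto f (𝓝[≠] 0) (𝓝 b) →
        ∀ᶠ s in 𝓝[≠] 0, f s ∉ L.lattice := fun f b hb hf ↦
      hf.eventually (L.isClosed_lattice.isOpen_compl.mem_nhds hb)
    have ha_cont : ∀ μ, Tendsto (fun s ↦ a s μ) (𝓝[≠] 0) (𝓝 (p (idx μ))) := fun μ ↦ by
      have := (ha_an μ).continuousAt.tendsto
      rw [ha0] at this
      exact this.mono_left inf_le_left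
    have e1 : ∀ᶠ s in 𝓝[≠] 0, ∀ μ ν, μ ≠ ν → a s μ - a s ν ∉ L.lattice := by
      refine eventually_all.mpr fun μ ↦ eventually_all.mpr fun ν ↦ ?_
      by_cases hμν : μ = ν
      · exact .of_forall fun s h ↦ absurd hμν h
      by_cases hi : idx μ = idx ν
      · have hne : x μ - x ν ≠ 0 := sub_ne_zero.mpr fun e ↦ hμν (h1 μ ν hi e)
        filter_upwards [hsmall _ _ hne ((hy_cont μ).sub (hy_cont ν))] with s hs _
        convert hs using 1
        simp only [ha, hi]
        ring_nf
      · filter_upwards [hopen _ _ (hp _ _ hi) ((ha_cont μ).sub (ha_cont ν))] with s hs _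
        exact hs
    have e2 : ∀ᶠ s in 𝓝[≠] 0, ∀ μ i, a s μ - p i ∉ L.lattice := by
      refine eventually_all.mpr fun μ ↦ eventually_all.mpr fun i ↦ ?_
      by_cases hi : idx μ = i
      · filter_upwards [hsmall _ _ (h2 μ) (hy_cont μ)] with s hs
        convert hs using 1
        simp [ha, hi]
      · exact hopen _ _ (hp _ _ hi) ((ha_cont μ).sub_const (p i))
    have e3 : ∀ᶠ s in 𝓝[≠] 0, ∀ μ, z - a s μ ∉ L.lattice :=
      eventually_all.mpr fun μ ↦ hopen _ _ (hz (idx μ)) ((ha_cont μ).const_sub z)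
    filter_upwards [e1, e2, e3, hyeq.filter_mono inf_le_left, self_mem_nhdsWithin]
      with s h5 h6 h7 h8 hs
    have hs0 : s ≠ 0 := hs
    have H : IsAnsatz L p ℓ (a s) s⁻¹ := by
      refine (isAnsatz_iff hn hsum).mpr ⟨h5, h6, fun μ ↦ ?_⟩
      have := h8 μ
      rw [scaledEq_eq hs0] at this
      exact (mul_eq_zero.mp this).resolve_left hs0
    refine ⟨H, ?_⟩
    obtain ⟨B', hB'⟩ := exists_isAccessory hn hp hℓ hsum H
    have hAs : (fun i ↦ - (ℓ i * ansatzRegP L p ℓ (a s) s⁻¹ i 0)) = s⁻¹ • A s := by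
      funext i
      have := mul_ansatzRegP_zero (L := L) (p := p) (ℓ := ℓ) (idx := idx) hs0 (y s) i
      simp only [hA, Pi.smul_apply, smul_eq_mul]
      rw [← this]
      field_simp
      rfl
    rw [hAs] at hB'
    have hBs : B' = B s / s ^ 2 := by
      rw [hB'.eq_at hn hp hℓ hsum H h7 hz, eq_div_iff (pow_ne_zero 2 hs0)]
      have hy1 : logDerivAnsatz L p ℓ (a s) s⁻¹ z = s⁻¹ + logDerivAnsatz L p ℓ (a s) 0 z := by
        simp only [logDerivAnsatz]; ring
      simp only [hy1, hB, Pi.smul_apply, smul_eq_mul, mul_assoc, ← Finset.mul_sum]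
      field_simp
    rw [← hBs]
    exact hB'

end

end GLame

namespace GLame

noncomputable section

variable {r n : ℕ} {L : PeriodPair} {p : Fin r → ℂ} {ℓ : Fin r → ℕ}

/-! ### The homogeneous log-free polynomials -/

/-- The part of the regular part of the potential that is independent of the parameters. -/
def potBase (L : PeriodPair) (p : Fin r → ℂ) (ℓ : Fin r → ℕ) (i : Fin r) (u : ℂ) : ℂ :=
  wt ℓ i * (wt ℓ i + 1) * L.weierstrassPExcept 0 u
    + ∑ j ∈ Finset.univ.erase i, wt ℓ j * (wt ℓ j + 1) * L.weierstrassP (p i - p j + u)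

/-- The coefficient of `A_j` in the regular part of the potential at `p_i`. -/
def potZeta (L : PeriodPair) (p : Fin r → ℂ) (i j : Fin r) (u : ℂ) : ℂ :=
  if j = i then zetaWReg L u else zetaW L (p i - p j + u)

lemma regularPart_eq (i : Fin r) (A : Fin r → ℂ) (B u : ℂ) :
    regularPart L p ℓ i A B u = (potBase L p ℓ i u + ∑ j, A j * potZeta L p i j u) + B := by
  have h : ∑ j, A j * potZeta L p i j u
      = A i * zetaWReg L u + ∑ j ∈ Finset.univ.erase i, A j * zetaW L (p i - p j + u) := by
    rw [← Finset.add_sum_erase _ _ (Finset.mem_univ i)]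
    congr 1
    · simp [potZeta]
    · refine Finset.sum_congr rfl fun j hj ↦ ?_
      rw [potZeta, if_neg (Finset.ne_of_mem_erase hj)]
  rw [h, regularPart, potBase, Finset.sum_add_distrib]
  ring

lemma analyticAt_potBase (hp : ∀ i j, i ≠ j → p i - p j ∉ L.lattice) (i : Fin r) :
    AnalyticAt ℂ (potBase L p ℓ i) 0 :=
  .add (analyticAt_const.mul (L.analyticAt_weierstrassPExcept 0))
    (Finset.analyticAt_fun_sum _ fun j hj ↦ analyticAt_const.mul
      (analyticAt_weierstrassP_add (hp i j (Finset.ne_of_mem_erase hj).symm)))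

lemma analyticAt_potZeta (hp : ∀ i j, i ≠ j → p i - p j ∉ L.lattice) (i j : Fin r) :
    AnalyticAt ℂ (potZeta L p i j) 0 := by
  unfold potZeta
  split_ifs with h
  · exact analyticAt_zetaWReg L
  · exact analyticAt_zetaW_add (hp i j fun e ↦ h e.symm)

/-- The weighted homogeneous version of the Taylor coefficients of the potential. -/
def homCoeff (L : PeriodPair) (p : Fin r → ℂ) (ℓ : Fin r → ℕ) (i : Fin r) (u : WVec r) (m : ℕ) :
    ℂ :=
  u.1 ^ (m + 2) * PowerSeries.coeff m (taylor (potBase L p ℓ i))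
    + u.1 ^ (m + 1) * ∑ j, u.2.1 j * PowerSeries.coeff m (taylor (potZeta L p i j))
    + if m = 0 then u.2.2 else 0

lemma potCoeff_eq_homCoeff (hp : ∀ i j, i ≠ j → p i - p j ∉ L.lattice) (i : Fin r)
    (A : Fin r → ℂ) (B : ℂ) : potCoeff L p ℓ i A B = homCoeff L p ℓ i (1, A, B) := by
  funext m
  have hs : ∀ s : Finset (Fin r), AnalyticAt ℂ (fun u ↦ ∑ j ∈ s, A j * potZeta L p i j u) 0 :=
    fun s ↦ Finset.analyticAt_fun_sum _ fun j _ ↦ analyticAt_const.mul (analyticAt_potZeta hp i j)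
  have hsum : ∀ s : Finset (Fin r), taylor (fun u ↦ ∑ j ∈ s, A j * potZeta L p i j u)
      = ∑ j ∈ s, PowerSeries.C (A j) * taylor (potZeta L p i j) := by
    intro s
    induction s using Finset.induction_on with
    | empty => simpa using taylor_const 0
    | insert j s hj ih =>
      simp only [Finset.sum_insert hj]
      rw [taylor_add (f := fun u ↦ A j * potZeta L p i j u)
        (analyticAt_const.mul (analyticAt_potZeta hp i j)) (hs s), ih, taylor_const_mul]
  have h : potCoeff L p ℓ i A B m = PowerSeries.coeff m (taylor (regularPart L p ℓ i A B)) :=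
    (coeff_taylor _ m).symm
  rw [h, show regularPart L p ℓ i A B = _ from funext (regularPart_eq i A B),
    taylor_add (f := fun u ↦ potBase L p ℓ i u + ∑ j, A j * potZeta L p i j u)
      ((analyticAt_potBase hp i).add (hs _)) analyticAt_const,
    taylor_add (analyticAt_potBase hp i) (hs _), hsum, taylor_const, homCoeff]
  simp only [map_add, map_sum, PowerSeries.coeff_C_mul, PowerSeries.coeff_C, one_pow, one_mul]

lemma homCoeff_wscale (i : Fin r) (c : ℂ) (u : WVec r) (m : ℕ) :
    homCoeff L p ℓ i (wscale c u) m = c ^ (m + 2) * homCoeff L p ℓ i u m := by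
  simp only [homCoeff, wscale, Pi.smul_apply, smul_eq_mul, mul_assoc, ← Finset.mul_sum]
  by_cases hm : m = 0
  · simp only [hm, if_true]; ring
  · simp only [hm, if_false]; ring

lemma analyticAt_homCoeff (i : Fin r) (u : WVec r) (m : ℕ) :
    AnalyticAt ℂ (fun u : WVec r ↦ homCoeff L p ℓ i u m) u := by
  have h1 : AnalyticAt ℂ (fun u : WVec r ↦ u.1) u := analyticAt_fst
  have h2 : ∀ j, AnalyticAt ℂ (fun u : WVec r ↦ u.2.1 j) u := fun j ↦
    ContinuousLinearMap.analyticAt ((ContinuousLinearMap.proj j).comp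
      ((ContinuousLinearMap.fst ℂ (Fin r → ℂ) ℂ).comp
        (ContinuousLinearMap.snd ℂ ℂ ((Fin r → ℂ) × ℂ)))) u
  have h3 : AnalyticAt ℂ (fun u : WVec r ↦ u.2.2) u :=
    ContinuousLinearMap.analyticAt ((ContinuousLinearMap.snd ℂ (Fin r → ℂ) ℂ).comp
        (ContinuousLinearMap.snd ℂ ℂ ((Fin r → ℂ) × ℂ))) u
  refine .add (.add ((h1.pow _).mul analyticAt_const) ((h1.pow _).mul
    (Finset.analyticAt_fun_sum _ fun j _ ↦ (h2 j).mul analyticAt_const))) ?_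
  split_ifs
  · exact h3
  · exact analyticAt_const

/-- The weighted homogeneous log-free polynomial. -/
def logFreeHom (L : PeriodPair) (p : Fin r → ℂ) (ℓ : Fin r → ℕ) (i : Fin r) (u : WVec r) : ℂ :=
  frobRHS (u.2.1 i) (homCoeff L p ℓ i u) (frobCoeff (ℓ i) (u.2.1 i) (homCoeff L p ℓ i u) (ℓ i))
    (ℓ i)

lemma logFreeHom_one (hp : ∀ i j, i ≠ j → p i - p j ∉ L.lattice) (i : Fin r)
    (A : Fin r → ℂ) (B : ℂ) : logFreeHom L p ℓ i (1, A, B) = logFreePoly L p ℓ i A B := by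
  rw [logFreePoly, potCoeff_eq_homCoeff hp]
  rfl

lemma logFreeHom_wscale (i : Fin r) (c : ℂ) (u : WVec r) :
    logFreeHom L p ℓ i (wscale c u) = c ^ (ℓ i + 1) * logFreeHom L p ℓ i u :=
  frobRHS_scale c (u.2.1 i) (homCoeff_wscale i c u)
    (fun m ↦ frobCoeff_scale c (u.2.1 i) (homCoeff_wscale i c u) _ _ m) _

lemma analyticAt_logFreeHom (i : Fin r) (u : WVec r) :
    AnalyticAt ℂ (logFreeHom L p ℓ i) u := by
  have h2 : AnalyticAt ℂ (fun u : WVec r ↦ u.2.1 i) u :=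
    ContinuousLinearMap.analyticAt ((ContinuousLinearMap.proj i).comp
      ((ContinuousLinearMap.fst ℂ (Fin r → ℂ) ℂ).comp
        (ContinuousLinearMap.snd ℂ ℂ ((Fin r → ℂ) × ℂ)))) u
  exact analyticAt_frobRHS h2 (analyticAt_homCoeff i u)
    (fun m ↦ analyticAt_frobCoeff h2 (analyticAt_homCoeff i u) _ _ m) _

/-- At `A_0 = 0` every Taylor coefficient that depends on the poles carries a positive power of
`A_0`; only `α = A_i` and `β = B` survive. -/
lemma logFreeHom_zero (i : Fin r) (A : Fin r → ℂ) (B : ℂ) :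
    logFreeHom L p ℓ i (0, A, B) = whittakerPoly (ℓ i) (A i) B := by
  have : homCoeff L p ℓ i (0, A, B) = fun m ↦ if m = 0 then B else 0 := by
    funext m
    simp [homCoeff]
  rw [logFreeHom, this, whittakerPoly]

/-- The affine cone defined by the homogeneous log-free equations. -/
def logFreeCone (L : PeriodPair) (p : Fin r → ℂ) (ℓ : Fin r → ℕ) : Set (WVec r) :=
  {u | ∑ i, u.2.1 i = 0 ∧ ∀ i, logFreeHom L p ℓ i u = 0}

lemma wscale_mem_logFreeCone {c : ℂ} {u : WVec r} (hu : u ∈ logFreeCone L p ℓ) :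
    wscale c u ∈ logFreeCone L p ℓ := by
  refine ⟨?_, fun i ↦ by rw [logFreeHom_wscale, hu.2, mul_zero]⟩
  simp only [wscale, Pi.smul_apply, smul_eq_mul, ← Finset.mul_sum, hu.1, mul_zero]

lemma one_mem_logFreeCone_iff (hp : ∀ i j, i ≠ j → p i - p j ∉ L.lattice) (x : (Fin r → ℂ) × ℂ) :
    ((1, x.1, x.2) : WVec r) ∈ logFreeCone L p ℓ ↔ x ∈ logFreeVariety L p ℓ := by
  simp only [logFreeCone, logFreeVariety, Set.mem_ofPred_eq, logFreeHom_one hp]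

lemma isClosed_logFreeCone : IsClosed (logFreeCone L p ℓ) := by
  have h : ∀ i, Continuous (logFreeHom L p ℓ i) := fun i ↦
    continuous_iff_continuousAt.mpr fun u ↦ (analyticAt_logFreeHom i u).continuousAt
  have h1 : IsClosed {u : WVec r | ∑ i, u.2.1 i = 0} :=
    isClosed_eq (by fun_prop) continuous_const
  have h2 : IsClosed {u : WVec r | ∀ i, logFreeHom L p ℓ i u = 0} := by
    rw [Set.ofPred_forall]
    exact isClosed_iInter fun i ↦ isClosed_eq (h i) continuous_const
  exact h1.inter h2

lemma wscale_toAffine {u : WVec r} (hu : u.1 ≠ 0) :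
    wscale u.1 (1, (toAffine u).1, (toAffine u).2) = u := by
  refine Prod.ext (by simp [wscale]) (Prod.ext ?_ ?_)
  · simp [wscale, toAffine, smul_smul, hu]
  · simp only [wscale, toAffine]
    field_simp

lemma toAffine_wscale {c : ℂ} (hc : c ≠ 0) (u : WVec r) : toAffine (wscale c u) = toAffine u := by
  refine Prod.ext ?_ ?_
  · simp only [toAffine, wscale, smul_smul, mul_inv]
    congr 1
    field_simp
  · simp only [toAffine, wscale]
    rw [mul_pow, mul_div_mul_left _ _ (pow_ne_zero 2 hc)]

/-- The point at infinity of the branch that corresponds to `k`. -/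
def infVec (ℓ k : Fin r → ℕ) : WVec r := (0, fun i ↦ 2 * (k i : ℂ) - ℓ i, 1)

lemma infVec_ne_zero (ℓ k : Fin r → ℕ) : infVec ℓ k ≠ 0 := fun h ↦
  one_ne_zero (congrArg (fun u : WVec r ↦ u.2.2) h)

lemma wscale_ne_zero {c : ℂ} (hc : c ≠ 0) {u : WVec r} (hu : u ≠ 0) : wscale c u ≠ 0 := by
  intro h
  apply hu
  rw [← wscale_inv_cancel hc u, h]
  simp [wscale]

lemma exists_root_of_whittakerPoly {ℓ : ℕ} {α c : ℂ} (h : whittakerPoly ℓ α (c ^ 2) = 0) :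
    ∃ k ≤ ℓ, α = c * (2 * (k : ℂ) - ℓ) := by
  obtain ⟨a, ha, h1⟩ := exists_whittakerPoly_eq ℓ
  rw [h1] at h
  obtain ⟨k, hk, hk'⟩ := Finset.prod_eq_zero_iff.mp ((mul_eq_zero.mp h).resolve_left ha)
  exact ⟨k, by simpa [Nat.lt_succ_iff] using hk, sub_eq_zero.mp hk'⟩

/-- With `B = c²` the factorization gives `A_i = c(2k_i - ℓ_i)`. If `c` were zero the whole vector
would vanish, and `∑ A_i = 0` then says `∑ k_i = n`. -/
lemma exists_infVec_of_mem (hsum : ∑ i, ℓ i = 2 * n) {u : WVec r} (hu : u ∈ logFreeCone L p ℓ)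
    (hne : u ≠ 0) (h0 : u.1 = 0) : ∃ (k : Fin r → ℕ) (c : ℂ), ∑ i, k i = n ∧ (∀ i, k i ≤ ℓ i) ∧
      c ≠ 0 ∧ u = wscale c (infVec ℓ k) := by
  obtain ⟨t, A, B⟩ := u
  obtain rfl : t = 0 := h0
  obtain ⟨c, hc⟩ := IsAlgClosed.exists_pow_nat_eq B (n := 2) (by norm_num)
  have h1 : ∀ i, ∃ k ≤ ℓ i, A i = c * (2 * (k : ℂ) - ℓ i) := fun i ↦ by
    have := hu.2 i
    rw [logFreeHom_zero, ← hc] at this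
    exact exists_root_of_whittakerPoly this
  choose k hk hA using h1
  have hc0 : c ≠ 0 := by
    rintro rfl
    apply hne
    refine Prod.ext rfl (Prod.ext (funext fun i ↦ ?_) ?_)
    · change A i = 0
      rw [hA, zero_mul]
    · change B = 0
      rw [← hc]; simp
  refine ⟨k, c, ?_, hk, hc0, ?_⟩
  · have h2 : ∑ i, A i = 0 := hu.1
    simp only [hA, ← Finset.mul_sum, Finset.sum_sub_distrib] at h2
    have h3 := (mul_eq_zero.mp h2).resolve_left hc0
    have h4 : (∑ i, (ℓ i : ℂ)) = 2 * n := by exact_mod_cast congrArg (Nat.cast (R := ℂ)) hsum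
    rw [h4] at h3
    have h5 : ((∑ i, k i : ℕ) : ℂ) = n := by
      push_cast
      linear_combination h3 / 2
    exact_mod_cast h5
  · refine Prod.ext ?_ (Prod.ext (funext fun i ↦ ?_) ?_)
    · simp [wscale, infVec]
    · simp [wscale, infVec, hA]
    · simp [wscale, infVec, hc]

/-! ### Analytic arcs and the points at infinity -/

/-- An analytic arc of the generalized Lamé curve that ends in the Type I boundary point
`∑ k_i p_i`, with its rescaled accessory parameters. -/
structure BoundaryArc (L : PeriodPair) (p : Fin r → ℂ) (ℓ : Fin r → ℕ) (n : ℕ)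
    (k : Fin r → ℕ) where
  /-- the cluster of each of the points -/
  idx : Fin n → Fin r
  card_idx : ∀ i, Fintype.card {μ // idx μ = i} = k i
  /-- the points -/
  a : ℂ → Fin n → ℂ
  /-- the rescaled residues -/
  A : ℂ → Fin r → ℂ
  /-- the rescaled constant of the potential -/
  B : ℂ → ℂ
  tendsto_a : Tendsto a (𝓝[≠] 0) (𝓝 fun μ ↦ p (idx μ))
  analyticAt_A : AnalyticAt ℂ A 0
  analyticAt_B : AnalyticAt ℂ B 0
  A_zero : A 0 = fun i ↦ 2 * (k i : ℂ) - ℓ i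
  B_zero : B 0 = 1
  isAnsatz : ∀ᶠ s in 𝓝[≠] 0, IsAnsatz L p ℓ (a s) s⁻¹ ∧
    IsAccessory L p ℓ (a s) s⁻¹ (s⁻¹ • A s) (B s / s ^ 2)

lemma exists_clustering {k : Fin r → ℕ} (hk : ∑ i, k i = n) :
    ∃ idx : Fin n → Fin r, ∀ i, Fintype.card {μ // idx μ = i} = k i := by
  have hcard : Fintype.card (Fin n) = Fintype.card (Σ i, Fin (k i)) := by simp [hk]
  let e : Fin n ≃ Σ i, Fin (k i) := Fintype.equivOfCardEq hcard
  refine ⟨fun μ ↦ (e μ).1, fun i ↦ ?_⟩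
  have : {μ // (e μ).1 = i} ≃ Fin (k i) :=
    (e.subtypeEquiv (fun μ ↦ Iff.rfl)).trans (Equiv.sigmaSubtype i)
  rw [Fintype.card_congr this, Fintype.card_fin]

end

end GLame

namespace GLame

noncomputable section

variable {r n : ℕ} {L : PeriodPair} {p : Fin r → ℂ} {ℓ : Fin r → ℕ} {k : Fin r → ℕ}

/-! ### Parametrizing the cone by an arc -/

lemma nonempty_boundaryArc (hn : 0 < n) (hp : ∀ i j, i ≠ j → p i - p j ∉ L.lattice)
    (hℓ : ∀ i, 0 < ℓ i) (hsum : ∑ i, ℓ i = 2 * n) (hk : ∑ i, k i = n) (hkℓ : ∀ i, k i ≤ ℓ i) :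
    Nonempty (BoundaryArc L p ℓ n k) := by
  obtain ⟨idx, hidx⟩ := exists_clustering hk
  obtain ⟨a, A, B, h1, h2, h3, h4, h5, h6⟩ := exists_arc (L := L) (p := p) hn hp hℓ hsum
    (idx := idx) fun i ↦ (hidx i).trans_le (hkℓ i)
  exact ⟨⟨idx, hidx, a, A, B, h1, h2, h3, by rw [h4]; funext i; rw [hidx], h5, h6⟩⟩

namespace BoundaryArc

variable (arc : BoundaryArc L p ℓ n k)

/-- The parametrization of the cone over a branch. -/
def param (v : ℂ × ℂ) : WVec r := wscale v.2 (v.1, arc.A v.1, arc.B v.1)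

lemma param_zero (c : ℂ) : arc.param (0, c) = wscale c (infVec ℓ k) := by
  simp only [param, infVec, arc.A_zero, arc.B_zero]

lemma analyticAt_param (c : ℂ) : AnalyticAt ℂ arc.param (0, c) := by
  have h1 : AnalyticAt ℂ (fun v : ℂ × ℂ ↦ v.1) (0, c) := analyticAt_fst
  have h2 : AnalyticAt ℂ (fun v : ℂ × ℂ ↦ v.2) (0, c) := analyticAt_snd
  have hA : AnalyticAt ℂ (fun v : ℂ × ℂ ↦ arc.A v.1) (0, c) :=
    arc.analyticAt_A.comp_of_eq h1 rfl
  have hB : AnalyticAt ℂ (fun v : ℂ × ℂ ↦ arc.B v.1) (0, c) :=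
    arc.analyticAt_B.comp_of_eq h1 rfl
  exact (h2.mul h1).prod ((h2.smul hA).prod ((h2.pow 2).mul hB))

/-- For `s ≠ 0` the vector is `s` times the affine point of `V` under the arc; `s = 0` follows
because the cone is closed. -/
lemma eventually_mem_cone (hn : 0 < n) (hp : ∀ i j, i ≠ j → p i - p j ∉ L.lattice)
    (hℓ : ∀ i, 0 < ℓ i) (hsum : ∑ i, ℓ i = 2 * n) :
    ∀ᶠ s in 𝓝 0, (s, arc.A s, arc.B s) ∈ logFreeCone L p ℓ := by
  have h1 : ∀ᶠ s in 𝓝[≠] 0, (s, arc.A s, arc.B s) ∈ logFreeCone L p ℓ := by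
    filter_upwards [arc.isAnsatz, self_mem_nhdsWithin] with s hs hs0
    have h := (one_mem_logFreeCone_iff hp _).mpr (hs.2.mem_logFreeVariety hn hp hℓ hsum hs.1)
    have h2 := wscale_mem_logFreeCone (c := s) h
    convert h2 using 1
    have hs0' : s ≠ 0 := hs0
    refine Prod.ext (by simp [wscale]) (Prod.ext ?_ ?_)
    · simp [wscale, smul_smul, hs0']
    · simp only [wscale]; field_simp
  have hc : ContinuousAt (fun s ↦ ((s, arc.A s, arc.B s) : WVec r)) 0 :=
    continuousAt_id.prodMk (arc.analyticAt_A.continuousAt.prodMk arc.analyticAt_B.continuousAt)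
  have h0 : ((0, arc.A 0, arc.B 0) : WVec r) ∈ logFreeCone L p ℓ :=
    isClosed_logFreeCone.mem_of_tendsto (b := 𝓝[≠] (0 : ℂ))
      (hc.tendsto.mono_left nhdsWithin_le_nhds) h1
  rw [eventually_nhdsWithin_iff] at h1
  filter_upwards [h1] with s hs
  by_cases h : s = 0
  · rw [h]; exact h0
  · exact hs h

lemma eventually_param_mem (hn : 0 < n) (hp : ∀ i j, i ≠ j → p i - p j ∉ L.lattice)
    (hℓ : ∀ i, 0 < ℓ i) (hsum : ∑ i, ℓ i = 2 * n) (c : ℂ) :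
    ∀ᶠ v in 𝓝 ((0 : ℂ), c), arc.param v ∈ logFreeCone L p ℓ := by
  have ht : Tendsto (fun v : ℂ × ℂ ↦ v.1) (𝓝 ((0 : ℂ), c)) (𝓝 0) := continuous_fst.tendsto _
  filter_upwards [ht.eventually (arc.eventually_mem_cone hn hp hℓ hsum)] with v hv
  exact wscale_mem_logFreeCone hv

end BoundaryArc

/-! ### The cone over the closure of the log-free variety -/

lemma wp_mk_eq_iff {u v : WVec r} (hu : u ≠ 0) (hv : v ≠ 0) :
    WP.mk u hu = WP.mk v hv ↔ ∃ c : ℂ, c ≠ 0 ∧ v = wscale c u :=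
  Quotient.eq (r := wpSetoid r)

lemma wp_mk_wscale {c : ℂ} (hc : c ≠ 0) {u : WVec r} (hu : u ≠ 0) :
    WP.mk (wscale c u) (wscale_ne_zero hc hu) = WP.mk u hu :=
  ((wp_mk_eq_iff _ _).mpr ⟨c, hc, rfl⟩).symm

/-- The cone is closed and stable under scaling, so its classes form a closed set in the quotient
topology, and this set contains the affine points of `V`. -/
lemma cone_subset (hp : ∀ i j, i ≠ j → p i - p j ∉ L.lattice) {u : WVec r}
    (hu : u ∈ cone (projLogFree L p ℓ)) : u ∈ logFreeCone L p ℓ := by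
  obtain ⟨hne, hu⟩ := hu
  set S : Set (WP r) := {P | ∀ u hu, P = WP.mk u hu → u ∈ logFreeCone L p ℓ} with hS
  have hclosed : IsClosed S := by
    refine (isQuotientMap_quotient_mk' (s := wpSetoid r)).isClosed_preimage.mp ?_
    have : Quotient.mk (wpSetoid r) ⁻¹' S
        = Subtype.val ⁻¹' (logFreeCone L p ℓ) := by
      ext ⟨v, hv⟩
      constructor
      · intro h
        exact h v hv rfl
      · intro h w hw hvw
        obtain ⟨c, hc, rfl⟩ := (wp_mk_eq_iff hv hw).mp hvw
        exact wscale_mem_logFreeCone h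
    change IsClosed (Quotient.mk (wpSetoid r) ⁻¹' S)
    rw [this]
    exact isClosed_logFreeCone.preimage continuous_subtype_val
  have hsub : projLogFree L p ℓ ⊆ S := by
    refine closure_minimal ?_ hclosed
    rintro _ ⟨x, hx, h, rfl⟩ w hw hvw
    obtain ⟨c, hc, rfl⟩ := (wp_mk_eq_iff h hw).mp hvw
    exact wscale_mem_logFreeCone ((one_mem_logFreeCone_iff hp x).mpr hx)
  exact hsub hu u hne rfl

lemma mem_cone_of_affine (hp : ∀ i j, i ≠ j → p i - p j ∉ L.lattice) {u : WVec r}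
    (hu : u ∈ logFreeCone L p ℓ) (h0 : u.1 ≠ 0) : u ∈ cone (projLogFree L p ℓ) := by
  have hne : u ≠ 0 := fun h ↦ h0 (by rw [h]; rfl)
  have e : ((1, (toAffine u).1, (toAffine u).2) : WVec r) = wscale u.1⁻¹ u := by
    have h := wscale_inv_cancel h0 ((1, (toAffine u).1, (toAffine u).2) : WVec r)
    rw [wscale_toAffine h0] at h
    exact h.symm
  refine ⟨hne, subset_closure ⟨toAffine u, ?_, ?_, ?_⟩⟩
  · rw [← one_mem_logFreeCone_iff hp, e]
    exact wscale_mem_logFreeCone hu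
  · exact fun h ↦ one_ne_zero (congrArg (fun u : WVec r ↦ u.1) h)
  · refine (wp_mk_eq_iff _ _).mpr ⟨u.1⁻¹, inv_ne_zero h0, e⟩

lemma wscale_mem_cone {X : Set (WP r)} {c : ℂ} (hc : c ≠ 0) {u : WVec r} (hu : u ∈ cone X) :
    wscale c u ∈ cone X := by
  obtain ⟨hne, h⟩ := hu
  exact ⟨wscale_ne_zero hc hne, by rwa [wp_mk_wscale hc hne]⟩

lemma BoundaryArc.infVec_mem_cone (arc : BoundaryArc L p ℓ n k) (hn : 0 < n)
    (hp : ∀ i j, i ≠ j → p i - p j ∉ L.lattice)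
    (hℓ : ∀ i, 0 < ℓ i) (hsum : ∑ i, ℓ i = 2 * n) :
    infVec ℓ k ∈ cone (projLogFree L p ℓ) := by
  refine ⟨infVec_ne_zero ℓ k, ?_⟩
  have hc : ContinuousAt (fun s ↦ ((s, arc.A s, arc.B s) : WVec r)) 0 :=
    continuousAt_id.prodMk (arc.analyticAt_A.continuousAt.prodMk arc.analyticAt_B.continuousAt)
  have h0 : ((0, arc.A 0, arc.B 0) : WVec r) = infVec ℓ k := by
    rw [arc.A_zero, arc.B_zero]; rfl
  rw [ContinuousAt, h0] at hc
  have hne : ∀ᶠ s in 𝓝 (0 : ℂ), ((s, arc.A s, arc.B s) : WVec r) ≠ 0 :=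
    hc.eventually_ne (infVec_ne_zero ℓ k)
  -- The default value only makes `f` total; near `s = 0` the vector is nonzero, being close to
  -- `infVec ℓ k`.
  set f : ℂ → {u : WVec r // u ≠ 0} := fun s ↦
    if h : ((s, arc.A s, arc.B s) : WVec r) ≠ 0 then ⟨_, h⟩ else ⟨_, infVec_ne_zero ℓ k⟩ with hf
  have hfv : ∀ s, ((s, arc.A s, arc.B s) : WVec r) ≠ 0 →
      (f s : WVec r) = (s, arc.A s, arc.B s) := by
    intro s hs
    rw [hf]
    simp only [dif_pos hs]
  have ht : Tendsto f (𝓝 0) (𝓝 ⟨infVec ℓ k, infVec_ne_zero ℓ k⟩) := by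
    rw [tendsto_subtype_rng]
    refine hc.congr' ?_
    filter_upwards [hne] with s hs
    exact (hfv s hs).symm
  have ht' : Tendsto (fun s ↦ Quotient.mk (wpSetoid r) (f s)) (𝓝[≠] 0)
      (𝓝 (WP.mk (infVec ℓ k) (infVec_ne_zero ℓ k))) :=
    ((continuous_quotient_mk'.tendsto _).comp ht).mono_left inf_le_left
  refine isClosed_closure.mem_of_tendsto ht' ?_
  filter_upwards [hne.filter_mono inf_le_left,
    (arc.eventually_mem_cone hn hp hℓ hsum).filter_mono inf_le_left,
    self_mem_nhdsWithin] with s h1 h2 h3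
  obtain ⟨h4, h5⟩ := mem_cone_of_affine hp h2 h3
  have : f s = ⟨_, h4⟩ := Subtype.ext (hfv s h1)
  rw [this]
  exact h5

/-- The homogenized equations could have zeros at infinity outside the closure of `V`. This does not
happen, because each such zero is the limit of an arc. -/
lemma mem_cone_iff (hn : 0 < n) (hp : ∀ i j, i ≠ j → p i - p j ∉ L.lattice)
    (hℓ : ∀ i, 0 < ℓ i) (hsum : ∑ i, ℓ i = 2 * n) {u : WVec r} :
    u ∈ cone (projLogFree L p ℓ) ↔ u ≠ 0 ∧ u ∈ logFreeCone L p ℓ := by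
  refine ⟨fun h ↦ ⟨h.1, cone_subset hp h⟩, fun ⟨hne, hu⟩ ↦ ?_⟩
  by_cases h0 : u.1 = 0
  · obtain ⟨k, c, hk, hkℓ, hc, rfl⟩ := exists_infVec_of_mem hsum hu hne h0
    obtain ⟨arc⟩ := nonempty_boundaryArc (L := L) (p := p) hn hp hℓ hsum hk hkℓ
    exact wscale_mem_cone hc (arc.infVec_mem_cone hn hp hℓ hsum)
  · exact mem_cone_of_affine hp hu h0

/-! ### Local uniqueness of the branches -/

/-- The first and last coordinates together with the log-free polynomials. -/
def logFreeChart (L : PeriodPair) (p : Fin r → ℂ) (ℓ : Fin r → ℕ) (u : WVec r) : WVec r :=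
  (u.1, fun i ↦ logFreeHom L p ℓ i u, u.2.2)

/-- The root `2k - ℓ` is simple, so the product of the other factors is a nonzero derivative. -/
lemma hasDerivAt_whittakerPoly {ℓ k : ℕ} (hk : k ≤ ℓ) : ∃ b : ℂ, b ≠ 0 ∧ ∀ δ : ℂ,
    HasDerivAt (fun t : ℂ ↦ whittakerPoly ℓ (2 * k - ℓ + t * δ) 1) (δ * b) 0 := by
  obtain ⟨a, ha, h⟩ := exists_whittakerPoly_one ℓ
  have hmem : k ∈ Finset.range (ℓ + 1) := by simp; omega
  refine ⟨a * ∏ j ∈ (Finset.range (ℓ + 1)).erase k, (2 * (k : ℂ) - ℓ - (2 * j - ℓ)), ?_, ?_⟩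
  · refine mul_ne_zero ha (Finset.prod_ne_zero_iff.mpr fun j hj ↦ ?_)
    exact sub_ne_zero.mpr ((two_mul_sub_injective ℓ).ne (Finset.ne_of_mem_erase hj).symm)
  · intro δ
    set g : ℂ → ℂ := fun t ↦ a * ∏ j ∈ (Finset.range (ℓ + 1)).erase k,
      (2 * (k : ℂ) - ℓ + t * δ - (2 * j - ℓ)) with hg
    have hgd : DifferentiableAt ℂ g 0 := by
      rw [hg]; fun_prop
    have h1 : HasDerivAt (fun t : ℂ ↦ t * δ) δ 0 := by
      simpa using (hasDerivAt_id (0 : ℂ)).mul_const δ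
    refine ((h1.mul hgd.hasDerivAt).congr_deriv ?_).congr_of_eventuallyEq
      (.of_forall fun t ↦ ?_)
    · simp [hg]
    · change whittakerPoly ℓ (2 * k - ℓ + t * δ) 1 = _
      rw [h, ← Finset.mul_prod_erase _ _ hmem]
      simp only [hg, Pi.mul_apply]
      ring

lemma analyticAt_logFreeChart (u : WVec r) : AnalyticAt ℂ (logFreeChart L p ℓ) u :=
  analyticAt_fst.prod ((AnalyticAt.pi fun i ↦ analyticAt_logFreeHom i u).prod
    (ContinuousLinearMap.analyticAt ((ContinuousLinearMap.snd ℂ (Fin r → ℂ) ℂ).comp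
        (ContinuousLinearMap.snd ℂ ℂ ((Fin r → ℂ) × ℂ))) u))

/-- A kernel vector has no component along `A_0` and `B`. On the slice `A_0 = 0`, `B = 1` the `i`-th
polynomial depends on `A_i` alone, with nonzero derivative. -/
lemma fderiv_logFreeChart_injective (hkℓ : ∀ i, k i ≤ ℓ i) (v : WVec r)
    (hv : fderiv ℂ (logFreeChart L p ℓ) (infVec ℓ k) v = 0) : v = 0 := by
  obtain ⟨t, δ, b⟩ := v
  have hd := (analyticAt_logFreeChart (L := L) (p := p) (ℓ := ℓ)
    (infVec ℓ k)).differentiableAt.hasFDerivAt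
  have hcomp : ∀ f : WVec r →L[ℂ] ℂ, ∀ g : WVec r → ℂ, (∀ u, f (logFreeChart L p ℓ u) = g u) →
      ∀ g' : WVec r →L[ℂ] ℂ, HasFDerivAt g g' (infVec ℓ k) → g' (t, δ, b) = 0 := by
    intro f g hfg g' hg'
    have h1 := f.hasFDerivAt.comp (infVec ℓ k) hd
    have h2 : (⇑f ∘ logFreeChart L p ℓ) = g := funext hfg
    rw [h2] at h1
    rw [hg'.unique h1, ContinuousLinearMap.comp_apply, hv, map_zero]
  set f1 : WVec r →L[ℂ] ℂ := ContinuousLinearMap.fst ℂ ℂ ((Fin r → ℂ) × ℂ) with hf1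
  set f3 : WVec r →L[ℂ] ℂ := (ContinuousLinearMap.snd ℂ (Fin r → ℂ) ℂ).comp
        (ContinuousLinearMap.snd ℂ ℂ ((Fin r → ℂ) × ℂ)) with hf3
  have ht : t = 0 := hcomp f1 f1 (fun u ↦ rfl) f1 f1.hasFDerivAt
  have hb : b = 0 := hcomp f3 f3 (fun u ↦ rfl) f3 f3.hasFDerivAt
  subst ht hb
  have hδ : δ = 0 := by
    funext i
    set f2 : WVec r →L[ℂ] ℂ := (ContinuousLinearMap.proj i).comp
      ((ContinuousLinearMap.fst ℂ (Fin r → ℂ) ℂ).comp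
        (ContinuousLinearMap.snd ℂ ℂ ((Fin r → ℂ) × ℂ))) with hf2
    have hG := (analyticAt_logFreeHom (L := L) (p := p) (ℓ := ℓ) i
      (infVec ℓ k)).differentiableAt.hasFDerivAt
    have h1 := hcomp f2 (logFreeHom L p ℓ i) (fun u ↦ rfl) _ hG
    obtain ⟨b, hb, hbd⟩ := hasDerivAt_whittakerPoly (hkℓ i)
    have hl : HasDerivAt (fun t : ℂ ↦ ((0, (infVec ℓ k).2.1 + t • δ, 1) : WVec r))
        (0, δ, 0) 0 := by
      refine (hasDerivAt_const _ _).prodMk (HasDerivAt.prodMk ?_ (hasDerivAt_const _ _))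
      simpa using ((hasDerivAt_id (0 : ℂ)).smul_const δ).const_add (infVec ℓ k).2.1
    have hx : infVec ℓ k = (fun t : ℂ ↦ ((0, (infVec ℓ k).2.1 + t • δ, 1) : WVec r)) 0 := by
      simp [infVec]
    have h2 := HasFDerivAt.comp_hasDerivAt_of_eq (0 : ℂ) hG hl hx
    rw [h1] at h2
    have h3 : (logFreeHom L p ℓ i ∘ fun t : ℂ ↦ ((0, (infVec ℓ k).2.1 + t • δ, 1) : WVec r))
        = fun t : ℂ ↦ whittakerPoly (ℓ i) (2 * k i - ℓ i + t * δ i) 1 := by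
      funext t
      rw [Function.comp_apply, logFreeHom_zero]
      rfl
    rw [h3] at h2
    exact (mul_eq_zero.mp ((hbd (δ i)).unique h2)).resolve_right hb
  rw [hδ]
  rfl

lemma exists_logFreeChart_injOn (hkℓ : ∀ i, k i ≤ ℓ i) :
    ∃ N ∈ 𝓝 (infVec ℓ k), Set.InjOn (logFreeChart L p ℓ) N := by
  obtain ⟨g, -, -, -, hg⟩ := exists_analytic_localInverse
    (analyticAt_logFreeChart (L := L) (p := p) (ℓ := ℓ) (infVec ℓ k))
    (fderiv_logFreeChart_injective hkℓ)
  refine ⟨_, hg, fun u hu v hv h ↦ ?_⟩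
  have hu' : g (logFreeChart L p ℓ u) = u := hu
  have hv' : g (logFreeChart L p ℓ v) = v := hv
  rw [← hu', h, hv']

namespace BoundaryArc

variable (arc : BoundaryArc L p ℓ n k)

/-- Near the point at infinity the cone is covered by the parametrization. -/
lemma eventually_exists_param (hn : 0 < n) (hp : ∀ i j, i ≠ j → p i - p j ∉ L.lattice)
    (hℓ : ∀ i, 0 < ℓ i) (hsum : ∑ i, ℓ i = 2 * n) (hkℓ : ∀ i, k i ≤ ℓ i) {N : Set (ℂ × ℂ)}
    (hN : N ∈ 𝓝 ((0 : ℂ), (1 : ℂ))) :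
    ∀ᶠ u in 𝓝 (infVec ℓ k), u ∈ logFreeCone L p ℓ → ∃ v ∈ N, u = arc.param v := by
  -- The `A_0`- and `B`-coordinates of the parametrization, `(c s, c² B(s))`, are locally invertible
  -- at `(s, c) = (0, 1)` because `B(0) = 1`.
  set T : ℂ × ℂ → ℂ × ℂ := fun v ↦ ((arc.param v).1, (arc.param v).2.2) with hT
  have hpar := arc.analyticAt_param 1
  have hp0 : arc.param (0, 1) = infVec ℓ k := by rw [param_zero, wscale_one]
  have hTan : AnalyticAt ℂ T (0, 1) := by
    have h1 : AnalyticAt ℂ (fun v ↦ (arc.param v).1) (0, 1) :=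
      AnalyticAt.comp_of_eq (g := fun u : WVec r ↦ u.1) analyticAt_fst hpar rfl
    have h2 : AnalyticAt ℂ (fun v ↦ (arc.param v).2.2) (0, 1) :=
      AnalyticAt.comp_of_eq (g := fun u : WVec r ↦ u.2.2)
        (ContinuousLinearMap.analyticAt ((ContinuousLinearMap.snd ℂ (Fin r → ℂ) ℂ).comp
        (ContinuousLinearMap.snd ℂ ℂ ((Fin r → ℂ) × ℂ))) (arc.param (0, 1))) hpar rfl
    exact h1.prod h2
  have hT0 : T (0, 1) = (0, 1) := by
    simp only [hT, hp0]; rfl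
  have hinj : ∀ v, fderiv ℂ T (0, 1) v = 0 → v = 0 := by
    rintro ⟨x, y⟩ hv
    have hl : HasDerivAt (fun t : ℂ ↦ ((t * x, 1 + t * y) : ℂ × ℂ)) (x, y) 0 := by
      refine HasDerivAt.prodMk ?_ ?_
      · simpa using (hasDerivAt_id (0 : ℂ)).mul_const x
      · simpa using ((hasDerivAt_id (0 : ℂ)).mul_const y).const_add 1
    have h1 := HasFDerivAt.comp_hasDerivAt_of_eq (0 : ℂ) hTan.differentiableAt.hasFDerivAt hl
      (by simp)
    rw [hv] at h1
    have hx : HasDerivAt (fun t : ℂ ↦ t * x) x 0 := by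
      simpa using (hasDerivAt_id (0 : ℂ)).mul_const x
    have hy : HasDerivAt (fun t : ℂ ↦ 1 + t * y) y 0 := by
      simpa using ((hasDerivAt_id (0 : ℂ)).mul_const y).const_add 1
    have h2 : HasDerivAt (fun t : ℂ ↦ (1 + t * y) * (t * x)) 0 0 :=
      (hasFDerivAt_fst (p := T (0, 1))).comp_hasDerivAt_of_eq (0 : ℂ) h1 (by simp)
    have h3 : HasDerivAt (fun t : ℂ ↦ (1 + t * y) ^ 2 * arc.B (t * x)) 0 0 :=
      (hasFDerivAt_snd (p := T (0, 1))).comp_hasDerivAt_of_eq (0 : ℂ) h1 (by simp)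
    have hx0 : x = 0 := by
      have := (hy.mul hx).unique h2
      simpa using this
    subst hx0
    have hy0 : y = 0 := by
      simp only [mul_zero, arc.B_zero, mul_one] at h3
      have := (hy.pow 2).unique h3
      simpa using this
    rw [hy0]
    rfl
  obtain ⟨g, hg, hg0, hgr, -⟩ := exists_analytic_localInverse hTan hinj
  rw [hT0] at hg hg0 hgr
  obtain ⟨M, hM, hMinj⟩ := exists_logFreeChart_injOn (L := L) (p := p) hkℓ
  have htu : Tendsto (fun u : WVec r ↦ (u.1, u.2.2)) (𝓝 (infVec ℓ k)) (𝓝 ((0 : ℂ), (1 : ℂ))) :=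
    Continuous.tendsto' (by fun_prop) _ _ rfl
  have hgu : Tendsto (fun u : WVec r ↦ g (u.1, u.2.2)) (𝓝 (infVec ℓ k))
      (𝓝 ((0 : ℂ), (1 : ℂ))) := by
    have := hg.continuousAt.tendsto.comp htu
    rwa [hg0] at this
  have hpu : Tendsto (fun u : WVec r ↦ arc.param (g (u.1, u.2.2))) (𝓝 (infVec ℓ k))
      (𝓝 (infVec ℓ k)) := by
    have := hpar.continuousAt.tendsto.comp hgu
    rwa [hp0] at this
  filter_upwards [htu.eventually hgr, hgu.eventually hN, hpu.eventually hM, hM,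
    hgu.eventually (arc.eventually_param_mem hn hp hℓ hsum 1)] with u h1 h2 h3 h4 h5 h6
  -- The given point and the parametrized one share `A_0` and `B`, and all log-free polynomials
  -- vanish on both, so they coincide in the chart.
  refine ⟨_, h2, hMinj h4 h3 ?_⟩
  have h7 : (arc.param (g (u.1, u.2.2))).1 = u.1 := congrArg (fun v : ℂ × ℂ ↦ v.1) h1
  have h8 : (arc.param (g (u.1, u.2.2))).2.2 = u.2.2 := congrArg (fun v : ℂ × ℂ ↦ v.2) h1
  refine Prod.ext h7.symm (Prod.ext (funext fun i ↦ ?_) h8.symm)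
  exact (h6.2 i).trans (h5.2 i).symm

end BoundaryArc

end

end GLame

namespace GLame

noncomputable section

variable {r n : ℕ} {L : PeriodPair} {p : Fin r → ℂ} {ℓ : Fin r → ℕ} {k : Fin r → ℕ}

/-! ### Irreducibility of the germs at infinity -/

/-- Analytic germs have no zero divisors: if `f` is nonzero at some point of a ball, then `g`
vanishes near that point, hence on the ball by the identity theorem. -/
lemma eventually_eq_zero_or_of_mul {E : Type*} [NormedAddCommGroup E] [NormedSpace ℂ E]
    {f g : E → ℂ} {x : E} (hf : AnalyticAt ℂ f x) (hg : AnalyticAt ℂ g x)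
    (hfg : ∀ᶠ u in 𝓝 x, f u * g u = 0) : (∀ᶠ u in 𝓝 x, f u = 0) ∨ ∀ᶠ u in 𝓝 x, g u = 0 := by
  obtain ⟨ε, hε, hball⟩ := Metric.eventually_nhds_iff_ball.mp
    ((hf.eventually_analyticAt.and hg.eventually_analyticAt).and hfg)
  refine or_iff_not_imp_left.mpr fun hnf ↦ ?_
  obtain ⟨w, hw, hwf⟩ : ∃ w ∈ Metric.ball x ε, f w ≠ 0 := by
    by_contra! hcon
    exact hnf (Metric.eventually_nhds_iff_ball.mpr ⟨ε, hε, hcon⟩)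
  have hg0 : g =ᶠ[𝓝 w] 0 := by
    filter_upwards [(hball w hw).1.1.continuousAt.eventually_ne hwf,
      Metric.isOpen_ball.mem_nhds hw] with u h1 h2
    exact (mul_eq_zero.mp (hball u h2).2).resolve_left h1
  have hgan : AnalyticOnNhd ℂ g (Metric.ball x ε) := fun u hu ↦ (hball u hu).1.2
  have := hgan.eqOn_zero_of_preconnected_of_eventuallyEq_zero
    Metric.isPreconnected_ball hw hg0
  exact Metric.eventually_nhds_iff_ball.mpr ⟨ε, hε, this⟩

/-- The image of a smooth germ lies in one of two analytic germs that cover it. -/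
lemma IsAnalyticGerm.eventually_mem_or {E M : Type*} [NormedAddCommGroup E] [NormedSpace ℂ E]
    [NormedAddCommGroup M] [NormedSpace ℂ M] {φ : E → M} {x : E} (hφ : AnalyticAt ℂ φ x)
    {S T : Set M} (hS : IsAnalyticGerm S (φ x)) (hT : IsAnalyticGerm T (φ x))
    (h : ∀ᶠ v in 𝓝 x, φ v ∈ S ∪ T) : (∀ᶠ v in 𝓝 x, φ v ∈ S) ∨ ∀ᶠ v in 𝓝 x, φ v ∈ T := by
  obtain ⟨m, f, hf, hfS⟩ := hS
  obtain ⟨m', g, hg, hgT⟩ := hT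
  have hfS' := hφ.continuousAt.eventually hfS
  have hgT' := hφ.continuousAt.eventually hgT
  by_cases h1 : ∀ i, ∀ᶠ v in 𝓝 x, f i (φ v) = 0
  · left
    filter_upwards [hfS', eventually_all.mpr h1] with v hv hv'
    exact hv.mpr hv'
  · right
    rw [not_forall] at h1
    obtain ⟨i, hi⟩ := h1
    have h2 : ∀ j, ∀ᶠ v in 𝓝 x, g j (φ v) = 0 := by
      intro j
      refine (eventually_eq_zero_or_of_mul ((hf i).comp hφ) ((hg j).comp hφ) ?_).resolve_left hi
      filter_upwards [h, hfS', hgT'] with v hv h3 h4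
      rcases hv with hv | hv
      · simp [h3.mp hv i]
      · simp [h4.mp hv j]
    filter_upwards [hgT', eventually_all.mpr h2] with v hv hv'
    exact hv.mpr hv'

lemma isAnalyticGerm_logFreeCone (u : WVec r) : IsAnalyticGerm (logFreeCone L p ℓ) u := by
  refine ⟨r + 1, Fin.cons (fun u ↦ ∑ i, u.2.1 i) fun i ↦ logFreeHom L p ℓ i, ?_, ?_⟩
  · refine Fin.cases ?_ fun i ↦ analyticAt_logFreeHom i u
    rw [Fin.cons_zero]
    refine Finset.analyticAt_fun_sum _ fun i _ ↦ ?_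
    exact ContinuousLinearMap.analyticAt ((ContinuousLinearMap.proj (R := ℂ) i).comp
      ((ContinuousLinearMap.fst ℂ (Fin r → ℂ) ℂ).comp
        (ContinuousLinearMap.snd ℂ ℂ ((Fin r → ℂ) × ℂ)))) u
  · refine .of_forall fun v ↦ ?_
    rw [Fin.forall_fin_succ]
    rfl

lemma IsAnalyticGerm.congr {M : Type*} [NormedAddCommGroup M] [NormedSpace ℂ M] {S T : Set M}
    {v : M} (hS : IsAnalyticGerm S v) (h : ∀ᶠ u in 𝓝 v, u ∈ T ↔ u ∈ S) : IsAnalyticGerm T v := by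
  obtain ⟨m, f, hf, hfS⟩ := hS
  exact ⟨m, f, hf, by filter_upwards [h, hfS] with u h1 h2; rw [h1, h2]⟩

section

variable (hn : 0 < n) (hp : ∀ i j, i ≠ j → p i - p j ∉ L.lattice) (hℓ : ∀ i, 0 < ℓ i)
  (hsum : ∑ i, ℓ i = 2 * n)

include hn hp hℓ hsum

lemma eventually_mem_cone_iff {u : WVec r} (hu : u ≠ 0) :
    ∀ᶠ v in 𝓝 u, v ∈ cone (projLogFree L p ℓ) ↔ v ∈ logFreeCone L p ℓ := by
  filter_upwards [eventually_ne_nhds hu] with v hv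
  rw [mem_cone_iff hn hp hℓ hsum]
  exact and_iff_right hv

lemma isAnalyticGerm_cone {u : WVec r} (hu : u ≠ 0) :
    IsAnalyticGerm (cone (projLogFree L p ℓ)) u :=
  (isAnalyticGerm_logFreeCone u).congr (eventually_mem_cone_iff hn hp hℓ hsum hu)

lemma BoundaryArc.eventually_exists_param_wscale (arc : BoundaryArc L p ℓ n k)
    (hkℓ : ∀ i, k i ≤ ℓ i) {c : ℂ} (hc : c ≠ 0) {N : Set (ℂ × ℂ)} (hN : N ∈ 𝓝 ((0 : ℂ), c)) :
    ∀ᶠ u in 𝓝 (wscale c (infVec ℓ k)), u ∈ logFreeCone L p ℓ → ∃ v ∈ N, u = arc.param v := by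
  have h1 : ContinuousAt (fun v : ℂ × ℂ ↦ (v.1, c * v.2)) (0, 1) := by fun_prop
  have h2 : (fun v : ℂ × ℂ ↦ (v.1, c * v.2)) ⁻¹' N ∈ 𝓝 ((0 : ℂ), (1 : ℂ)) := by
    refine h1.preimage_mem_nhds ?_
    simpa using hN
  have h3 := arc.eventually_exists_param hn hp hℓ hsum hkℓ h2
  have h4 : Tendsto (wscale c⁻¹) (𝓝 (wscale c (infVec ℓ k))) (𝓝 (infVec ℓ k)) := by
    have := (continuous_wscale (r := r) c⁻¹).tendsto (wscale c (infVec ℓ k))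
    rwa [wscale_inv_cancel hc] at this
  filter_upwards [h4.eventually h3] with u hu hmem
  obtain ⟨v, hv, huv⟩ := hu (wscale_mem_logFreeCone hmem)
  refine ⟨_, hv, ?_⟩
  have : u = wscale c (wscale c⁻¹ u) := by rw [wscale_wscale, mul_inv_cancel₀ hc, wscale_one]
  rw [this, huv]
  simp only [BoundaryArc.param, wscale_wscale]

/-- The germ is the image of a smooth germ under the parametrization. A covering by two analytic
germs pulls back to one where a single member suffices, and the parametrization reaches all nearby
points of the cone. -/
lemma isIrreducibleGerm_cone (hk : ∑ i, k i = n) (hkℓ : ∀ i, k i ≤ ℓ i) {c : ℂ} (hc : c ≠ 0) :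
    IsIrreducibleGerm (cone (projLogFree L p ℓ)) (wscale c (infVec ℓ k)) := by
  have hne := wscale_ne_zero hc (infVec_ne_zero ℓ k)
  obtain ⟨arc⟩ := nonempty_boundaryArc (L := L) (p := p) hn hp hℓ hsum hk hkℓ
  refine ⟨isAnalyticGerm_cone hn hp hℓ hsum hne,
    wscale_mem_cone hc (arc.infVec_mem_cone hn hp hℓ hsum), fun S T hS hT hST ↦ ?_⟩
  have hcont := (arc.analyticAt_param c).continuousAt
  have hiff := eventually_mem_cone_iff hn hp hℓ hsum hne
  rw [← arc.param_zero] at hS hT hST hiff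
  have hmem : ∀ᶠ v in 𝓝 ((0 : ℂ), c), arc.param v ∈ cone (projLogFree L p ℓ) := by
    filter_upwards [hcont.eventually hiff, arc.eventually_param_mem hn hp hℓ hsum c] with v h1 h2
    exact h1.mpr h2
  have key : ∀ S' T' : Set (WVec r), cone (projLogFree L p ℓ) =ᶠ[𝓝 (arc.param (0, c))]
      (S' ∪ T' : Set (WVec r)) → (∀ᶠ v in 𝓝 ((0 : ℂ), c), arc.param v ∈ S') →
      cone (projLogFree L p ℓ) =ᶠ[𝓝 (arc.param (0, c))] S' := by
    intro S' T' hcov hS'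
    have h2 := arc.eventually_exists_param_wscale hn hp hℓ hsum hkℓ hc hS'
    rw [← arc.param_zero] at h2
    filter_upwards [hcov.mem_iff, hiff, h2] with u h3 h4 h5
    refine propext ⟨fun h ↦ ?_, fun h ↦ h3.mpr (Or.inl h)⟩
    obtain ⟨v, hv, rfl⟩ := h5 (h4.mp h)
    exact hv
  have hcov : ∀ᶠ v in 𝓝 ((0 : ℂ), c), arc.param v ∈ S ∪ T := by
    filter_upwards [hmem, hcont.eventually hST.mem_iff] with v h1 h2
    exact h2.mp h1
  rw [← arc.param_zero]
  refine (IsAnalyticGerm.eventually_mem_or (arc.analyticAt_param c) hS hT hcov).imp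
    (key S T hST) (key T S ?_)
  rwa [Set.union_comm]

lemma isGermComponent_cone (hk : ∑ i, k i = n) (hkℓ : ∀ i, k i ≤ ℓ i) {c : ℂ} (hc : c ≠ 0) :
    IsGermComponent (cone (projLogFree L p ℓ)) (cone (projLogFree L p ℓ))
      (wscale c (infVec ℓ k)) :=
  ⟨isIrreducibleGerm_cone hn hp hℓ hsum hk hkℓ hc, EventuallyLE.refl _ _, fun _ _ _ h ↦ h⟩

/-- The branch at the point at infinity that belongs to `k`. -/
def infBranch (hk : ∑ i, k i = n) (hkℓ : ∀ i, k i ≤ ℓ i) : PreBranch (projLogFree L p ℓ) where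
  pt := infVec ℓ k
  ne_zero := infVec_ne_zero ℓ k
  at_infinity := rfl
  carrier := cone (projLogFree L p ℓ)
  isComponent := by
    simpa only [wscale_one] using isGermComponent_cone hn hp hℓ hsum hk hkℓ one_ne_zero

lemma PreBranch.exists_infVec (b : PreBranch (projLogFree L p ℓ)) :
    ∃ (k : Fin r → ℕ) (c : ℂ), ∑ i, k i = n ∧ (∀ i, k i ≤ ℓ i) ∧ c ≠ 0 ∧
      b.pt = wscale c (infVec ℓ k) := by
  have h1 : b.pt ∈ cone (projLogFree L p ℓ) :=
    b.isComponent.2.1.self_of_nhds b.isComponent.1.2.1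
  obtain ⟨h2, h3⟩ := (mem_cone_iff hn hp hℓ hsum).mp h1
  exact exists_infVec_of_mem hsum h3 h2 b.at_infinity

/-- The full germ of the cone is already irreducible, so a maximal irreducible germ inside it is all
of it. -/
lemma PreBranch.carrier_eventuallyEq (b : PreBranch (projLogFree L p ℓ)) :
    b.carrier =ᶠ[𝓝 b.pt] cone (projLogFree L p ℓ) := by
  obtain ⟨k, c, hk, hkℓ, hc, h⟩ := b.exists_infVec hn hp hℓ hsum
  refine b.isComponent.2.1.antisymm (b.isComponent.2.2 _ ?_ b.isComponent.2.1
    (EventuallyLE.refl _ _))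
  rw [h]
  exact isIrreducibleGerm_cone hn hp hℓ hsum hk hkℓ hc

/-- The branches at infinity are determined by their points. -/
lemma branch_point_injective :
    Function.Injective (Branch.point : Branch (projLogFree L p ℓ) → WP r) := by
  intro b b' h
  induction b using Quotient.inductionOn with | h b => ?_
  induction b' using Quotient.inductionOn with | h b' => ?_
  obtain ⟨c, hc, hpt⟩ := (wp_mk_eq_iff b.ne_zero b'.ne_zero).mp h
  refine Quotient.sound ⟨c, hc, hpt, ?_⟩
  have h1 := (b'.carrier_eventuallyEq hn hp hℓ hsum).mem_iff
  rw [hpt] at h1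
  filter_upwards [(b.carrier_eventuallyEq hn hp hℓ hsum).mem_iff,
    (continuous_wscale c).continuousAt.eventually h1] with u h2 h3
  rw [h2, h3]
  refine ⟨wscale_mem_cone hc, fun h ↦ ?_⟩
  have := wscale_mem_cone (inv_ne_zero hc) h
  rwa [wscale_inv_cancel hc] at this

lemma infBranch_point (hk : ∑ i, k i = n) (hkℓ : ∀ i, k i ≤ ℓ i) :
    Branch.point (Quotient.mk _ (infBranch hn hp hℓ hsum hk hkℓ))
      = WP.mk (infVec ℓ k) (infVec_ne_zero ℓ k) := rfl

end

end

end GLame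

namespace GLame

noncomputable section

variable {r n : ℕ} {L : PeriodPair} {p : Fin r → ℂ} {ℓ : Fin r → ℕ} {k : Fin r → ℕ}

/-! ### Asymptotics of the ansatz as `h → ∞` -/

/-- The sum of the residue equations over a cluster of points. -/
lemma sum_ansatzEq_cluster {a : Fin n → ℂ} {h : ℂ} (H : ∀ μ, ansatzEq L p ℓ a h μ = 0)
    (G : Finset (Fin n)) :
    (G.card : ℂ) * h + ∑ μ ∈ G, ∑ ν ∈ Gᶜ, zetaW L (a μ - a ν)
      = ∑ i, wt ℓ i * ∑ μ ∈ G, zetaW L (a μ - p i) := by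
  have h1 : ∑ μ ∈ G, ansatzEq L p ℓ a h μ = 0 := Finset.sum_eq_zero fun μ _ ↦ H μ
  have h2 : ∑ μ ∈ G, ∑ ν ∈ G, zetaW L (a μ - a ν) = 0 :=
    sum_sum_antisymm G (fun μ ν ↦ zetaW L (a μ - a ν)) fun μ ν ↦ zetaW_sub_comm _ _
  simp only [ansatzEq, ← Finset.sum_add_sum_compl G, Finset.sum_add_distrib,
    Finset.sum_sub_distrib, Finset.sum_const, nsmul_eq_mul] at h1
  have h3 : ∑ i, wt ℓ i * ∑ μ ∈ G, zetaW L (a μ - p i)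
      = ∑ μ ∈ G, ∑ i, wt ℓ i * zetaW L (a μ - p i) := by
    simp only [Finset.mul_sum]
    exact Finset.sum_comm
  linear_combination h1 - h2 - h3

section

variable {α : Type*} {F : Filter α} {a : α → Fin n → ℂ} {h : α → ℂ} {a₀ : Fin n → ℂ}

lemma tendsto_zetaW {f : α → ℂ} {z : ℂ} (hf : Tendsto f F (𝓝 z)) (hz : z ∉ L.lattice) :
    Tendsto (fun x ↦ zetaW L (f x)) F (𝓝 (zetaW L z)) :=
  (analyticAt_zetaW L hz).continuousAt.tendsto.comp hf

/-- Sum the residue equations over the points whose limit is congruent to that of `a_μ`.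
Interactions inside this cluster cancel; if the limit is not a pole, all other terms converge, and
so would `h`. -/
lemma exists_pole_of_tendsto [F.NeBot] (hn : 0 < n) (hsum : ∑ i, ℓ i = 2 * n)
    (ha : Tendsto a F (𝓝 a₀)) (hh : Tendsto h F (Bornology.cobounded ℂ))
    (H : ∀ᶠ x in F, IsAnsatz L p ℓ (a x) (h x)) (μ : Fin n) : ∃ i, a₀ μ - p i ∈ L.lattice := by
  classical
  by_contra! hcon
  have haμ := fun ν ↦ tendsto_pi_nhds.mp ha ν
  set G : Finset (Fin n) := Finset.univ.filter fun ν ↦ a₀ ν - a₀ μ ∈ L.lattice with hG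
  have hmem : ∀ ν, ν ∈ G ↔ a₀ ν - a₀ μ ∈ L.lattice := fun ν ↦ by simp [hG]
  have hcard : (G.card : ℂ) ≠ 0 := by
    have : G.Nonempty := ⟨μ, by simp [hmem]⟩
    exact_mod_cast this.card_pos.ne'
  have h1 : Tendsto (fun x ↦ ∑ ν ∈ G, ∑ κ ∈ Gᶜ, zetaW L (a x ν - a x κ)) F
      (𝓝 (∑ ν ∈ G, ∑ κ ∈ Gᶜ, zetaW L (a₀ ν - a₀ κ))) := by
    refine tendsto_finsetSum _ fun ν hν ↦ tendsto_finsetSum _ fun κ hκ ↦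
      tendsto_zetaW ((haμ ν).sub (haμ κ)) fun hc ↦ ?_
    rw [Finset.mem_compl, hmem] at hκ
    rw [hmem] at hν
    exact hκ (by simpa using sub_mem hν hc)
  have h2 : Tendsto (fun x ↦ ∑ i, wt ℓ i * ∑ ν ∈ G, zetaW L (a x ν - p i)) F
      (𝓝 (∑ i, wt ℓ i * ∑ ν ∈ G, zetaW L (a₀ ν - p i))) := by
    refine tendsto_finsetSum _ fun i _ ↦ (tendsto_finsetSum _ fun ν hν ↦
      tendsto_zetaW ((haμ ν).sub_const _) fun hc ↦ ?_).const_mul _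
    rw [hmem] at hν
    exact hcon i (by simpa using sub_mem hc hν)
  have h3 : Tendsto h F (𝓝 ((∑ i, wt ℓ i * ∑ ν ∈ G, zetaW L (a₀ ν - p i)
      - ∑ ν ∈ G, ∑ κ ∈ Gᶜ, zetaW L (a₀ ν - a₀ κ)) / G.card)) := by
    refine ((h2.sub h1).div_const _).congr' ?_
    filter_upwards [H] with x hx
    rw [← sum_ansatzEq_cluster ((isAnsatz_iff hn hsum).mp hx).2.2 G]
    field_simp
    ring
  exact h3.not_tendsto (Metric.disjoint_nhds_cobounded _) hh

lemma tendsto_inv_mul_of_eq {f g : α → ℂ} {m c : ℂ}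
    (hh : Tendsto h F (Bornology.cobounded ℂ)) (hg : Tendsto g F (𝓝 c))
    (hf : ∀ᶠ x in F, f x = m * h x + g x) : Tendsto (fun x ↦ (h x)⁻¹ * f x) F (𝓝 m) := by
  have h1 : Tendsto (fun x ↦ (h x)⁻¹) F (𝓝 0) := tendsto_inv₀_cobounded.comp hh
  have h2 : Tendsto (fun x ↦ m + (h x)⁻¹ * g x) F (𝓝 (m + 0 * c)) := (h1.mul hg).const_add m
  rw [zero_mul, add_zero] at h2
  refine h2.congr' ?_
  filter_upwards [hf, hh.eventually_ne_cobounded 0] with x hx hx0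
  rw [hx]
  field_simp

variable {idx : Fin n → Fin r} {A : α → Fin r → ℂ} {B : α → ℂ}

/-- The singular sum `∑ ζ(a_μ - p_i)` over the cluster at `p_i` occurs both in `A_i` and in the
summed residue equations. Eliminating it gives `A_i = (2k_i - ℓ_i) h` plus a convergent term. -/
lemma tendsto_inv_mul_residue (hn : 0 < n) (hp : ∀ i j, i ≠ j → p i - p j ∉ L.lattice)
    (hℓ : ∀ i, 0 < ℓ i) (hsum : ∑ i, ℓ i = 2 * n)
    (hidx : ∀ i, Fintype.card {μ // idx μ = i} = k i)
    (ha : Tendsto a F (𝓝 fun μ ↦ p (idx μ))) (hh : Tendsto h F (Bornology.cobounded ℂ))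
    (H : ∀ᶠ x in F, IsAnsatz L p ℓ (a x) (h x) ∧ IsAccessory L p ℓ (a x) (h x) (A x) (B x))
    (i : Fin r) : Tendsto (fun x ↦ (h x)⁻¹ * A x i) F (𝓝 (2 * (k i : ℂ) - ℓ i)) := by
  have haμ := fun ν ↦ tendsto_pi_nhds.mp ha ν
  set G : Finset (Fin n) := Finset.univ.filter fun ν ↦ idx ν = i with hG
  have hmem : ∀ ν, ν ∈ G ↔ idx ν = i := fun ν ↦ by simp [hG]
  have hcard : G.card = k i := by rw [← hidx i, Fintype.card_subtype]
  have hℓi : (ℓ i : ℂ) ≠ 0 := by exact_mod_cast (hℓ i).ne'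
  set D : (Fin n → ℂ) → ℂ := fun b ↦ ∑ ν ∈ G, ∑ κ ∈ Gᶜ, zetaW L (b ν - b κ) with hD
  set R : (Fin n → ℂ) → ℂ := fun b ↦
    ∑ j ∈ Finset.univ.erase i, wt ℓ j * ∑ ν ∈ G, zetaW L (b ν - p j) with hR
  set S : (Fin n → ℂ) → ℂ := fun b ↦ ∑ ν ∈ Gᶜ, zetaW L (p i - b ν) with hS
  have h1 : Tendsto (fun x ↦ D (a x)) F (𝓝 (D fun μ ↦ p (idx μ))) := by
    refine tendsto_finsetSum _ fun ν hν ↦ tendsto_finsetSum _ fun κ hκ ↦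
      tendsto_zetaW ((haμ ν).sub (haμ κ)) (hp _ _ ?_)
    rw [Finset.mem_compl, hmem] at hκ
    rw [(hmem ν).mp hν]
    exact Ne.symm hκ
  have h2 : Tendsto (fun x ↦ R (a x)) F (𝓝 (R fun μ ↦ p (idx μ))) := by
    refine tendsto_finsetSum _ fun j hj ↦ (tendsto_finsetSum _ fun ν hν ↦
      tendsto_zetaW ((haμ ν).sub_const _) (hp _ _ ?_)).const_mul _
    rw [(hmem ν).mp hν]
    exact (Finset.ne_of_mem_erase hj).symm
  have h3 : Tendsto (fun x ↦ S (a x)) F (𝓝 (S fun μ ↦ p (idx μ))) := by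
    refine tendsto_finsetSum _ fun ν hν ↦ tendsto_zetaW ((haμ ν).const_sub _) (hp _ _ ?_)
    rw [Finset.mem_compl, hmem] at hν
    exact Ne.symm hν
  refine tendsto_inv_mul_of_eq (g := fun x ↦ 2 * (D (a x) - R (a x)) + ℓ i * (-S (a x)
    + ∑ j ∈ Finset.univ.erase i, wt ℓ j * zetaW L (p i - p j))) hh
    (((h1.sub h2).const_mul 2).add ((h3.neg.add_const _).const_mul _)) ?_
  filter_upwards [H] with x ⟨hx, hx'⟩
  have e1 := sum_ansatzEq_cluster ((isAnsatz_iff hn hsum).mp hx).2.2 G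
  rw [hcard, ← Finset.add_sum_erase _ _ (Finset.mem_univ i)] at e1
  have e2 := (hx' i).1
  rw [div_eq_iff hℓi, ← Finset.sum_add_sum_compl G] at e2
  have e3 : ∑ ν ∈ G, zetaW L (p i - a x ν) = -∑ ν ∈ G, zetaW L (a x ν - p i) := by
    rw [← Finset.sum_neg_distrib]
    exact Finset.sum_congr rfl fun ν _ ↦ zetaW_sub_comm _ _
  rw [e3] at e2
  simp only [hD, hR, hS]
  linear_combination e2 - 2 * e1 - (∑ ν ∈ G, zetaW L (a x ν - p i)) * two_mul_wt ℓ i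

/-- For the last coordinate the differential equation is used at a fixed generic `z`: there `y(z)/h
→ 1`, and all other terms of `B/h²` tend to zero. -/
lemma tendsto_wscale_inv (hn : 0 < n) (hp : ∀ i j, i ≠ j → p i - p j ∉ L.lattice)
    (hℓ : ∀ i, 0 < ℓ i) (hsum : ∑ i, ℓ i = 2 * n)
    (hidx : ∀ i, Fintype.card {μ // idx μ = i} = k i)
    (ha : Tendsto a F (𝓝 fun μ ↦ p (idx μ))) (hh : Tendsto h F (Bornology.cobounded ℂ))
    (H : ∀ᶠ x in F, IsAnsatz L p ℓ (a x) (h x) ∧ IsAccessory L p ℓ (a x) (h x) (A x) (B x)) :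
    Tendsto (fun x ↦ wscale (h x)⁻¹ (1, A x, B x)) F (𝓝 (infVec ℓ k)) := by
  have haμ := fun ν ↦ tendsto_pi_nhds.mp ha ν
  have hinv : Tendsto (fun x ↦ (h x)⁻¹) F (𝓝 0) := tendsto_inv₀_cobounded.comp hh
  have hA := fun i ↦ tendsto_inv_mul_residue hn hp hℓ hsum hidx ha hh H i
  have h1 : Tendsto (fun x ↦ (h x)⁻¹ * 1) F (𝓝 0) := by simpa using hinv
  refine h1.prodMk_nhds (Tendsto.prodMk_nhds (tendsto_pi_nhds.mpr hA) ?_)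
  obtain ⟨z, -, hz⟩ := exists_generic_point L (Fin.elim0 : Fin 0 → ℂ) p
  have hza : ∀ᶠ x in F, ∀ μ, z - a x μ ∉ L.lattice := eventually_all.mpr fun μ ↦
    ((haμ μ).const_sub z).eventually (L.isClosed_lattice.isOpen_compl.mem_nhds (hz (idx μ)))
  have h2 : Tendsto (fun x ↦ logDerivAnsatz' L p ℓ (a x) z) F
      (𝓝 (logDerivAnsatz' L p ℓ (fun μ ↦ p (idx μ)) z)) := by
    refine (Tendsto.neg (tendsto_finsetSum _ fun μ _ ↦ ?_)).add_const _
    exact (analyticAt_weierstrassP L (hz (idx μ))).continuousAt.tendsto.comp ((haμ μ).const_sub z)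
  have h3 : Tendsto (fun x ↦ (h x)⁻¹ * logDerivAnsatz L p ℓ (a x) (h x) z) F (𝓝 1) := by
    refine tendsto_inv_mul_of_eq (g := fun x ↦ ∑ μ, zetaW L (z - a x μ)
      - ∑ i, wt ℓ i * zetaW L (z - p i)) hh ((tendsto_finsetSum _ fun μ _ ↦
        tendsto_zetaW ((haμ μ).const_sub z) (hz (idx μ))).sub_const _) (.of_forall fun x ↦ ?_)
    rw [logDerivAnsatz]
    ring
  have h4 : Tendsto (fun x ↦ ∑ i, (h x)⁻¹ * A x i * zetaW L (z - p i)) F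
      (𝓝 (∑ i, (2 * (k i : ℂ) - ℓ i) * zetaW L (z - p i))) :=
    tendsto_finsetSum _ fun i _ ↦ (hA i).mul_const _
  have h5 := (((hinv.pow 2).mul (h2.sub_const (∑ i, wt ℓ i * (wt ℓ i + 1)
    * L.weierstrassP (z - p i)))).add (h3.pow 2)).sub (hinv.mul h4)
  have e : (0 : ℂ) ^ 2 * (logDerivAnsatz' L p ℓ (fun μ ↦ p (idx μ)) z
      - ∑ i, wt ℓ i * (wt ℓ i + 1) * L.weierstrassP (z - p i)) + 1 ^ 2
      - 0 * ∑ i, (2 * (k i : ℂ) - ℓ i) * zetaW L (z - p i) = 1 := by ring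
  rw [e] at h5
  refine h5.congr' ?_
  filter_upwards [H, hza] with x ⟨hx, hx'⟩ hxz
  have e1 := hx'.eq_at hn hp hℓ hsum hx hxz hz
  have e2 : ∑ i, (h x)⁻¹ * A x i * zetaW L (z - p i)
      = (h x)⁻¹ * ∑ i, A x i * zetaW L (z - p i) := by
    rw [Finset.mul_sum]
    exact Finset.sum_congr rfl fun i _ ↦ by ring
  rw [e2]
  linear_combination -(h x)⁻¹ ^ 2 * e1

/-- The multiplicities of a limit of ansatz data with `h → ∞` are at most `2 n_i`. -/
lemma card_le_of_tendsto [F.NeBot] (hn : 0 < n) (hp : ∀ i j, i ≠ j → p i - p j ∉ L.lattice)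
    (hℓ : ∀ i, 0 < ℓ i) (hsum : ∑ i, ℓ i = 2 * n)
    (hidx : ∀ i, Fintype.card {μ // idx μ = i} = k i)
    (ha : Tendsto a F (𝓝 fun μ ↦ p (idx μ))) (hh : Tendsto h F (Bornology.cobounded ℂ))
    (H : ∀ᶠ x in F, IsAnsatz L p ℓ (a x) (h x)) (i : Fin r) : k i ≤ ℓ i := by
  have H' : ∀ x, ∃ AB : (Fin r → ℂ) × ℂ, IsAnsatz L p ℓ (a x) (h x) →
      IsAccessory L p ℓ (a x) (h x) AB.1 AB.2 := by
    intro x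
    by_cases hx : IsAnsatz L p ℓ (a x) (h x)
    · obtain ⟨B, hB⟩ := exists_isAccessory hn hp hℓ hsum hx
      exact ⟨(_, B), fun _ ↦ hB⟩
    · exact ⟨0, fun h ↦ absurd h hx⟩
  choose AB hAB using H'
  have H2 : ∀ᶠ x in F, IsAnsatz L p ℓ (a x) (h x) ∧
      IsAccessory L p ℓ (a x) (h x) (AB x).1 (AB x).2 := by
    filter_upwards [H] with x hx
    exact ⟨hx, hAB x hx⟩
  -- The limit stays in the closed cone, so `2k_i - ℓ_i` is a root of the polynomial at infinity,
  -- and all roots are of the form `2j - ℓ_i` with `j ≤ ℓ_i`.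
  have h1 : infVec ℓ k ∈ logFreeCone L p ℓ := by
    refine isClosed_logFreeCone.mem_of_tendsto
      (tendsto_wscale_inv hn hp hℓ hsum hidx ha hh H2) ?_
    filter_upwards [H2] with x hx
    exact wscale_mem_logFreeCone
      ((one_mem_logFreeCone_iff hp _).mpr (hx.2.mem_logFreeVariety hn hp hℓ hsum hx.1))
  have h2 := h1.2 i
  rw [infVec, logFreeHom_zero, ← one_pow 2] at h2
  obtain ⟨j, hj, hj'⟩ := exists_root_of_whittakerPoly h2
  have h3 : k i = j := two_mul_sub_injective (ℓ i) (by simpa using hj')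
  omega

end

end

end GLame

namespace GLame

noncomputable section

variable {r n : ℕ} {L : PeriodPair} {p : Fin r → ℂ} {ℓ : Fin r → ℕ} {k : Fin r → ℕ}

/-! ### Divisors -/

/-- Equal multisets mean that corresponding fibres have equal cardinality; the permutation is
assembled from bijections of the fibres. -/
lemma exists_perm_of_map_eq {β : Type*} {f g : Fin n → β}
    (h : Finset.univ.val.map f = Finset.univ.val.map g) :
    ∃ σ : Equiv.Perm (Fin n), ∀ μ, g (σ μ) = f μ := by
  classical
  have hc : ∀ b, Nonempty ({μ // f μ = b} ≃ {μ // g μ = b}) := by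
    intro b
    have h1 := congrArg (Multiset.count b) h
    rw [Multiset.count_map, Multiset.count_map] at h1
    refine Fintype.card_eq.mp ?_
    rw [Fintype.card_subtype, Fintype.card_subtype]
    simp only [eq_comm (a := b)] at h1
    exact h1
  exact ⟨Equiv.ofFiberEquiv fun b ↦ (hc b).some, fun μ ↦ Equiv.ofFiberEquiv_map _ μ⟩

lemma LameBundle.mk_eq_mk_infty {a a' : Fin n → ℂ} (σ : Equiv.Perm (Fin n))
    (h : ∀ μ, a' μ - a (σ μ) ∈ L.lattice) :
    LameBundle.mk L a OnePoint.infty = LameBundle.mk L a' OnePoint.infty :=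
  Quotient.sound ⟨σ, fun μ ↦ ⟨_, h μ⟩, fun μ ↦ by simp, rfl⟩

/-- At `h = ∞` the quasi-period shift is invisible, so the divisor alone determines the point. -/
lemma TypeI.ext_divisor {y y' : TypeI L p ℓ n} (h : y.1.divisor = y'.1.divisor) : y = y' := by
  obtain ⟨y, hy, a, rfl⟩ := y
  obtain ⟨y', hy', a', rfl⟩ := y'
  obtain ⟨σ, hσ⟩ := exists_perm_of_map_eq h.symm
  exact Subtype.ext (LameBundle.mk_eq_mk_infty σ fun μ ↦
    (Submodule.Quotient.eq L.lattice).mp (hσ μ).symm)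

lemma divisor_mk_comp {idx : Fin n → Fin r} (hidx : ∀ i, Fintype.card {μ // idx μ = i} = k i) :
    (LameBundle.mk L (fun μ ↦ p (idx μ)) OnePoint.infty).divisor = poleDivisor L p k := by
  classical
  change Multiset.map (fun μ ↦ (Submodule.Quotient.mk (p (idx μ)) : Curve L)) Finset.univ.val = _
  rw [← Multiset.sum_map_singleton (Multiset.map _ _), Multiset.map_map]
  change ∑ μ, ({(Submodule.Quotient.mk (p (idx μ)) : Curve L)} : Multiset (Curve L)) = _
  rw [poleDivisor, ← Finset.sum_fiberwise _ idx]
  refine Finset.sum_congr rfl fun i _ ↦ ?_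
  rw [Finset.sum_congr rfl (g := fun _ ↦ {(Submodule.Quotient.mk (p i) : Curve L)})
    fun μ hμ ↦ by rw [(Finset.mem_filter.mp hμ).2], Finset.sum_const, ← hidx i,
    Fintype.card_subtype]

lemma poleDivisor_injective (hp : ∀ i j, i ≠ j → p i - p j ∉ L.lattice) :
    Function.Injective (poleDivisor L p) := by
  classical
  intro k k' h
  have hcount : ∀ (k : Fin r → ℕ) i,
      Multiset.count (Submodule.Quotient.mk (p i) : Curve L) (poleDivisor L p k) = k i := by
    intro k i
    rw [poleDivisor, Multiset.count_sum', Finset.sum_eq_single i]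
    · simp
    · intro j _ hj
      rw [Multiset.count_nsmul, Multiset.count_singleton, if_neg, mul_zero]
      rw [Submodule.Quotient.eq]
      exact hp i j (Ne.symm hj)
    · simp
  funext i
  rw [← hcount k i, h, hcount]

lemma poleDivisor_add (k k' : Fin r → ℕ) :
    poleDivisor L p k + poleDivisor L p k' = poleDivisor L p (k + k') := by
  simp only [poleDivisor, ← Finset.sum_add_distrib, Pi.add_apply, add_nsmul]

lemma sum_card_fibers (idx : Fin n → Fin r) :
    ∑ i, Fintype.card {μ // idx μ = i} = n := by
  rw [← Fintype.card_sigma, Fintype.card_congr (Equiv.sigmaFiberEquiv idx), Fintype.card_fin]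

/-! ### The topology of the bundle -/

/-- The saturation of an open set is the union of its preimages under the continuous maps by which
permutations and periods act. -/
lemma isOpenMap_lameBundle_mk : IsOpenMap (Quotient.mk (lameSetoid L n)) := by
  intro U hU
  rw [← isQuotientMap_quotient_mk'.isOpen_preimage]
  have hT : ∀ (σ : Equiv.Perm (Fin n)) (ω : Fin n → L.lattice),
      Continuous fun x : (Fin n → ℂ) × OnePoint ℂ ↦ ((fun μ ↦ x.1 (σ μ) + (ω μ : ℂ),
        OnePoint.map (fun h ↦ h + ∑ μ, quasiPeriod L (ω μ)) x.2) : (Fin n → ℂ) × OnePoint ℂ) := by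
    intro σ ω
    have h2 : Continuous (OnePoint.map fun h : ℂ ↦ h + ∑ μ, quasiPeriod L (ω μ)) :=
      OnePoint.continuous_map (by fun_prop)
        (Homeomorph.addRight (∑ μ, quasiPeriod L (ω μ))).map_coclosedCompact.le
    exact (by fun_prop : Continuous fun x : (Fin n → ℂ) × OnePoint ℂ ↦
      (fun μ ↦ x.1 (σ μ) + (ω μ : ℂ))).prodMk (h2.comp continuous_snd)
  have : Quotient.mk (lameSetoid L n) ⁻¹' (Quotient.mk (lameSetoid L n) '' U)
      = ⋃ (σ : Equiv.Perm (Fin n)) (ω : Fin n → L.lattice),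
        (fun x : (Fin n → ℂ) × OnePoint ℂ ↦ ((fun μ ↦ x.1 (σ μ) + (ω μ : ℂ),
        OnePoint.map (fun h ↦ h + ∑ μ, quasiPeriod L (ω μ)) x.2) :
          (Fin n → ℂ) × OnePoint ℂ)) ⁻¹' U := by
    ext x
    simp only [Set.mem_preimage, Set.mem_image, Set.mem_iUnion]
    constructor
    · rintro ⟨y, hy, hxy⟩
      obtain ⟨σ, ω, h1, h2⟩ := Quotient.exact hxy.symm
      refine ⟨σ, ω, ?_⟩
      rwa [← funext h1, ← h2]
    · rintro ⟨σ, ω, h⟩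
      exact ⟨_, h, (Quotient.sound ⟨σ, ω, fun _ ↦ rfl, rfl⟩ : Quotient.mk (lameSetoid L n) x
        = Quotient.mk (lameSetoid L n) _).symm⟩
  change IsOpen (Quotient.mk (lameSetoid L n) ⁻¹' _)
  rw [this]
  exact isOpen_iUnion fun σ ↦ isOpen_iUnion fun ω ↦ hU.preimage (hT σ ω)

lemma nhds_prod_cobounded (a₀ : Fin n → ℂ) :
    comap (Prod.map id ((↑) : ℂ → OnePoint ℂ)) (𝓝 (a₀, OnePoint.infty))
      = 𝓝 a₀ ×ˢ Bornology.cobounded ℂ := by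
  change comap (fun x : (Fin n → ℂ) × ℂ ↦ (id x.1, (x.2 : OnePoint ℂ))) _ = _
  rw [nhds_prod_eq, ← prod_comap_comap_eq, OnePoint.comap_coe_nhds_infty, comap_id,
    coclosedCompact_eq_cocompact, Metric.cobounded_eq_cocompact]

lemma eventually_mk_mem {a₀ : Fin n → ℂ} {U : Set (LameBundle L n)}
    (hU : U ∈ 𝓝 (LameBundle.mk L a₀ OnePoint.infty)) :
    ∀ᶠ x : (Fin n → ℂ) × ℂ in 𝓝 a₀ ×ˢ Bornology.cobounded ℂ, LameBundle.mk L x.1 x.2 ∈ U := by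
  rw [← nhds_prod_cobounded]
  have : Tendsto (Quotient.mk (lameSetoid L n)) (𝓝 (a₀, OnePoint.infty))
      (𝓝 (LameBundle.mk L a₀ OnePoint.infty)) := continuous_quotient_mk'.tendsto _
  exact (this.comp tendsto_comap).eventually hU

/-- Openness of the quotient map turns a property valid near `(a₀, ∞)` into one valid, for a
suitable representative, on a neighbourhood in the bundle. -/
lemma exists_nhds_of_eventually {a₀ : Fin n → ℂ} {P : (Fin n → ℂ) × ℂ → Prop}
    (hP : ∀ᶠ x in 𝓝 a₀ ×ˢ Bornology.cobounded ℂ, P x) :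
    ∃ U ∈ 𝓝 (LameBundle.mk L a₀ OnePoint.infty), ∀ (a : Fin n → ℂ) (h : ℂ),
      LameBundle.mk L a (h : OnePoint ℂ) ∈ U → ∃ (σ : Equiv.Perm (Fin n)) (ω : Fin n → L.lattice),
        P (fun μ ↦ a (σ μ) + ω μ, h + ∑ μ, quasiPeriod L (ω μ)) := by
  rw [← nhds_prod_cobounded] at hP
  obtain ⟨W, hW, hWP⟩ := mem_comap.mp hP
  refine ⟨_, isOpenMap_lameBundle_mk.image_mem_nhds hW, ?_⟩
  rintro a h ⟨w, hw, hwe⟩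
  obtain ⟨σ, ω, h1, h2⟩ := Quotient.exact hwe.symm
  refine ⟨σ, ω, hWP ?_⟩
  change ((fun μ ↦ a (σ μ) + (ω μ : ℂ)), ((h + ∑ μ, quasiPeriod L (ω μ) : ℂ) : OnePoint ℂ)) ∈ W
  have e : w = ((fun μ ↦ a (σ μ) + (ω μ : ℂ)),
      ((h + ∑ μ, quasiPeriod L (ω μ) : ℂ) : OnePoint ℂ)) := Prod.ext (funext h1) h2
  rwa [← e]

section

variable (hn : 0 < n) (hp : ∀ i j, i ≠ j → p i - p j ∉ L.lattice) (hℓ : ∀ i, 0 < ℓ i)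
  (hsum : ∑ i, ℓ i = 2 * n)

/-! ### The Type I boundary points -/

include hn hsum in
-- Membership in the closure is lifted from the quotient to representatives near `(a₀, ∞)`; this
-- works because the ansatz equations are invariant under permutations and periods.
lemma neBot_ansatz {a₀ : Fin n → ℂ}
    (h : LameBundle.mk L a₀ OnePoint.infty ∈ closure (lameCurve L p ℓ n)) :
    ((𝓝 a₀ ×ˢ Bornology.cobounded ℂ) ⊓ 𝓟 {x : (Fin n → ℂ) × ℂ | IsAnsatz L p ℓ x.1 x.2}).NeBot := by
  by_contra hcon
  rw [not_neBot, inf_principal_eq_bot] at hcon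
  obtain ⟨U, hU, hUP⟩ := exists_nhds_of_eventually (L := L) hcon
  obtain ⟨_, hy, a, h, hans, rfl⟩ := mem_closure_iff_nhds.mp h U hU
  obtain ⟨σ, ω, hσ⟩ := hUP a h hy
  exact hσ (hans.translate hn hsum σ ω)

include hn hp hℓ hsum

lemma TypeI.exists_idx (y : TypeI L p ℓ n) : ∃ idx : Fin n → Fin r,
    y.1 = LameBundle.mk L (fun μ ↦ p (idx μ)) OnePoint.infty ∧
      ∀ i, Fintype.card {μ // idx μ = i} ≤ ℓ i := by
  obtain ⟨y, hy, a₀, rfl⟩ := y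
  have hans : ∀ b : Fin n → ℂ, ∀ᶠ x : (Fin n → ℂ) × ℂ in (𝓝 b ×ˢ Bornology.cobounded ℂ) ⊓
      𝓟 {x : (Fin n → ℂ) × ℂ | IsAnsatz L p ℓ x.1 x.2}, IsAnsatz L p ℓ x.1 x.2 := fun b ↦
    eventually_inf_principal.mpr (.of_forall fun _ h ↦ h)
  have h1 : ∀ μ, ∃ i, a₀ μ - p i ∈ L.lattice := by
    have := neBot_ansatz hn hsum hy
    exact exists_pole_of_tendsto hn hsum (tendsto_fst.mono_left inf_le_left)
      (tendsto_snd.mono_left inf_le_left) (hans a₀)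
  choose idx hidx using h1
  have h2 : LameBundle.mk L a₀ OnePoint.infty
      = LameBundle.mk L (fun μ ↦ p (idx μ)) OnePoint.infty :=
    (LameBundle.mk_eq_mk_infty 1 hidx).symm
  refine ⟨idx, h2, ?_⟩
  -- The limit argument is applied a second time, now at the representative with entries exactly `p
  -- (idx μ)`, as the estimate of the multiplicities requires.
  rw [h2] at hy
  have := neBot_ansatz hn hsum hy
  exact card_le_of_tendsto hn hp hℓ hsum (fun _ ↦ rfl)
      (tendsto_fst.mono_left inf_le_left : Tendsto _ ((𝓝 _ ×ˢ Bornology.cobounded ℂ) ⊓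
      𝓟 {x : (Fin n → ℂ) × ℂ | IsAnsatz L p ℓ x.1 x.2}) _)
      (tendsto_snd.mono_left inf_le_left) (hans _)

lemma TypeI.exists_divisor_eq (y : TypeI L p ℓ n) : ∃ k : Fin r → ℕ,
    ∑ i, k i = n ∧ (∀ i, k i ≤ ℓ i) ∧ y.1.divisor = poleDivisor L p k := by
  obtain ⟨idx, h1, h2⟩ := y.exists_idx hn hp hℓ hsum
  exact ⟨_, sum_card_fibers idx, h2, by rw [h1, divisor_mk_comp fun _ ↦ rfl]⟩

omit hn hp hℓ hsum in
lemma BoundaryArc.tendsto_mk (arc : BoundaryArc L p ℓ n k) :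
    Tendsto (fun s : ℂ ↦ LameBundle.mk L (arc.a s) (s⁻¹ : ℂ)) (𝓝[≠] 0)
      (𝓝 (LameBundle.mk L (fun μ ↦ p (arc.idx μ)) OnePoint.infty)) := fun _ hU ↦
  (arc.tendsto_a.prodMk tendsto_inv₀_nhdsNE_zero).eventually (eventually_mk_mem hU)

lemma exists_typeI (hk : ∑ i, k i = n) (hkℓ : ∀ i, k i ≤ ℓ i) :
    ∃ y : TypeI L p ℓ n, y.1.divisor = poleDivisor L p k := by
  obtain ⟨arc⟩ := nonempty_boundaryArc (L := L) (p := p) hn hp hℓ hsum hk hkℓ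
  refine ⟨⟨LameBundle.mk L (fun μ ↦ p (arc.idx μ)) OnePoint.infty,
    mem_closure_of_tendsto arc.tendsto_mk ?_, _, rfl⟩, divisor_mk_comp arc.card_idx⟩
  filter_upwards [arc.isAnsatz] with s hs
  exact ⟨_, _, hs.1, rfl⟩

/-! ### The germ at a Type I point and the branch -/

/-- Scaling moves the centre to `infVec ℓ k` and leaves affine coordinates unchanged, so the filter
depends only on the cone near that vector. -/
lemma PreBranch.mem_affineFilter_iff (b : PreBranch (projLogFree L p ℓ)) {c : ℂ} (hc : c ≠ 0)
    (hpt : b.pt = wscale c (infVec ℓ k)) {S : Set ((Fin r → ℂ) × ℂ)} :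
    S ∈ b.affineFilter ↔
      ∀ᶠ u in 𝓝 (infVec ℓ k), u ∈ logFreeCone L p ℓ → u.1 ≠ 0 → toAffine u ∈ S := by
  have h1 := (b.carrier_eventuallyEq hn hp hℓ hsum).mem_iff
  have h2 := eventually_mem_cone_iff (L := L) (p := p) hn hp hℓ hsum b.ne_zero
  have hsymm : ∀ u : WVec r, wscale c (wscale c⁻¹ u) = u := fun u ↦ by
    rw [wscale_wscale, mul_inv_cancel₀ hc, wscale_one]
  rw [PreBranch.affineFilter, mem_map, mem_nhdsWithin_iff_eventually]
  have h3 : (∀ᶠ u in 𝓝 b.pt, u ∈ b.carrier ∩ {u | u.1 ≠ 0} → u ∈ toAffine ⁻¹' S) ↔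
      ∀ᶠ u in 𝓝 b.pt, u ∈ logFreeCone L p ℓ → u.1 ≠ 0 → toAffine u ∈ S := by
    refine eventually_congr ?_
    filter_upwards [h1, h2] with u h4 h5
    rw [Set.mem_inter_iff, h4, h5, and_imp]
    rfl
  rw [h3, hpt]
  constructor
  · intro h
    filter_upwards [(continuous_wscale c).continuousAt.eventually h] with u hu hu1 hu2
    rw [← toAffine_wscale hc]
    exact hu (wscale_mem_logFreeCone hu1) (mul_ne_zero hc hu2)
  · intro h
    have ht : Tendsto (wscale c⁻¹) (𝓝 (wscale c (infVec ℓ k))) (𝓝 (infVec ℓ k)) := by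
      have := (continuous_wscale (r := r) c⁻¹).tendsto (wscale c (infVec ℓ k))
      rwa [wscale_inv_cancel hc] at this
    filter_upwards [ht.eventually h] with u hu hu1 hu2
    rw [← toAffine_wscale (inv_ne_zero hc)]
    exact hu (wscale_mem_logFreeCone hu1) (mul_ne_zero (inv_ne_zero hc) hu2)

lemma exists_piImage_subset {idx : Fin n → Fin r}
    (hidx : ∀ i, Fintype.card {μ // idx μ = i} = k i) {S : Set ((Fin r → ℂ) × ℂ)}
    (hS : ∀ᶠ u in 𝓝 (infVec ℓ k), u ∈ logFreeCone L p ℓ → u.1 ≠ 0 → toAffine u ∈ S) :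
    ∃ U ∈ 𝓝 (LameBundle.mk L (fun μ ↦ p (idx μ)) OnePoint.infty), piImage L p ℓ n U ⊆ S := by
  -- The filter of ansatz data together with their accessory parameters, as `(a, h)` approaches the
  -- boundary point.
  set F : Filter (((Fin n → ℂ) × ℂ) × ((Fin r → ℂ) × ℂ)) :=
    comap Prod.fst (𝓝 (fun μ ↦ p (idx μ)) ×ˢ Bornology.cobounded ℂ) ⊓
      𝓟 {x | IsAnsatz L p ℓ x.1.1 x.1.2 ∧ IsAccessory L p ℓ x.1.1 x.1.2 x.2.1 x.2.2} with hF
  have h1 : Tendsto (fun x ↦ x.1) F (𝓝 (fun μ ↦ p (idx μ)) ×ˢ Bornology.cobounded ℂ) :=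
    tendsto_comap.mono_left inf_le_left
  have h2 : ∀ᶠ x in F, IsAnsatz L p ℓ x.1.1 x.1.2 ∧
      IsAccessory L p ℓ x.1.1 x.1.2 x.2.1 x.2.2 :=
    eventually_inf_principal.mpr (.of_forall fun _ h ↦ h)
  have hh : Tendsto (fun x ↦ x.1.2) F (Bornology.cobounded ℂ) := tendsto_snd.comp h1
  have h3 := tendsto_wscale_inv hn hp hℓ hsum hidx (tendsto_fst.comp h1) hh h2
  have h4 : ∀ᶠ x in F, x.2 ∈ S := by
    filter_upwards [h3.eventually hS, h2, hh.eventually_ne_cobounded 0] with x h5 h6 h7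
    have h8 := h5 (wscale_mem_logFreeCone
      ((one_mem_logFreeCone_iff hp _).mpr (h6.2.mem_logFreeVariety hn hp hℓ hsum h6.1)))
      (mul_ne_zero (inv_ne_zero h7) one_ne_zero)
    rw [toAffine_wscale (inv_ne_zero h7)] at h8
    simpa [toAffine] using h8
  rw [hF, eventually_inf_principal, eventually_comap] at h4
  obtain ⟨U, hU, hUP⟩ := exists_nhds_of_eventually (L := L) h4
  refine ⟨U, hU, ?_⟩
  rintro x ⟨a, h, hans, hmem, hacc⟩
  obtain ⟨σ, ω, hσ⟩ := hUP a h hmem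
  exact hσ (_, x) rfl ⟨hans.translate hn hsum σ ω, hacc.translate hans.off_poles σ ω⟩

/-- Points of the cone near `infVec ℓ k` are scaled points of the arc. Off the infinity divisor the
arc parameter is nonzero, and such a point is the image of an actual point of the curve in `U`. -/
lemma BoundaryArc.eventually_toAffine_mem (arc : BoundaryArc L p ℓ n k) (hkℓ : ∀ i, k i ≤ ℓ i)
    {U : Set (LameBundle L n)}
    (hU : U ∈ 𝓝 (LameBundle.mk L (fun μ ↦ p (arc.idx μ)) OnePoint.infty)) :
    ∀ᶠ u in 𝓝 (infVec ℓ k), u ∈ logFreeCone L p ℓ → u.1 ≠ 0 →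
      toAffine u ∈ piImage L p ℓ n U := by
  have h1 := arc.isAnsatz.and (arc.tendsto_mk.eventually hU)
  rw [eventually_nhdsWithin_iff] at h1
  have h2 : {v : ℂ × ℂ | v.2 ≠ 0 ∧ (v.1 ∈ ({0}ᶜ : Set ℂ) →
      (IsAnsatz L p ℓ (arc.a v.1) v.1⁻¹ ∧ IsAccessory L p ℓ (arc.a v.1) v.1⁻¹
        (v.1⁻¹ • arc.A v.1) (arc.B v.1 / v.1 ^ 2)) ∧
        LameBundle.mk L (arc.a v.1) (v.1⁻¹ : ℂ) ∈ U)} ∈ 𝓝 ((0 : ℂ), (1 : ℂ)) :=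
    ((continuous_snd.tendsto ((0 : ℂ), (1 : ℂ))).eventually_ne one_ne_zero).and
      ((continuous_fst.tendsto ((0 : ℂ), (1 : ℂ))).eventually h1)
  filter_upwards [arc.eventually_exists_param hn hp hℓ hsum hkℓ h2] with u hu hmem h0
  obtain ⟨v, ⟨hv2, hv⟩, rfl⟩ := hu hmem
  have hv1 : v.1 ≠ 0 := right_ne_zero_of_mul h0
  obtain ⟨⟨h3, h4⟩, h5⟩ := hv hv1
  rw [BoundaryArc.param, toAffine_wscale hv2]
  exact ⟨_, _, h3, h5, h4⟩

lemma lift_piImage_eq (y : TypeI L p ℓ n) (hk : ∑ i, k i = n) (hkℓ : ∀ i, k i ≤ ℓ i)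
    (hy : y.1.divisor = poleDivisor L p k) (b : PreBranch (projLogFree L p ℓ)) {c : ℂ}
    (hc : c ≠ 0) (hpt : b.pt = wscale c (infVec ℓ k)) :
    (𝓝 y.1).lift' (piImage L p ℓ n) = b.affineFilter := by
  obtain ⟨arc⟩ := nonempty_boundaryArc (L := L) (p := p) hn hp hℓ hsum hk hkℓ
  have hmono : Monotone (piImage L p ℓ n) := fun U V hUV x ⟨a, h, h1, h2, h3⟩ ↦
    ⟨a, h, h1, hUV h2, h3⟩
  have hy' : y.1 = LameBundle.mk L (fun μ ↦ p (arc.idx μ)) OnePoint.infty := by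
    obtain ⟨a, ha⟩ := y.2.2
    have h := hy
    rw [← divisor_mk_comp arc.card_idx, ha] at h
    obtain ⟨σ, hσ⟩ := exists_perm_of_map_eq h.symm
    rw [ha]
    exact LameBundle.mk_eq_mk_infty σ fun μ ↦ (Submodule.Quotient.eq L.lattice).mp (hσ μ).symm
  rw [hy']
  ext S
  rw [b.mem_affineFilter_iff hn hp hℓ hsum hc hpt, mem_lift'_sets hmono]
  constructor
  · rintro ⟨U, hU, hUS⟩
    filter_upwards [arc.eventually_toAffine_mem hn hp hℓ hsum hkℓ hU] with u h1 h2 h3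
    exact hUS (h1 h2 h3)
  · exact exists_piImage_subset hn hp hℓ hsum arc.card_idx

end

end

end GLame

namespace GLame

noncomputable section

variable {r n : ℕ} {L : PeriodPair} {p : Fin r → ℂ} {ℓ : Fin r → ℕ} {k k' : Fin r → ℕ}

/-! ### The bijection between Type I points and branches -/

lemma infVec_eq_wscale_neg_one (h : k + k' = ℓ) : infVec ℓ k' = wscale (-1) (infVec ℓ k) := by
  refine Prod.ext (by simp [infVec, wscale]) (Prod.ext (funext fun i ↦ ?_)
    (by simp [infVec, wscale]))
  have : (k i : ℂ) + k' i = ℓ i := by exact_mod_cast congrFun h i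
  simp only [infVec, wscale, Pi.smul_apply, smul_eq_mul]
  linear_combination 2 * this

/-- The last coordinate gives `c² = 1`: the stabilizer `±1` of the weight-2 coordinate is the source
of the equivalence of boundary points. -/
lemma eq_or_add_eq_of_infVec {c : ℂ} (h : infVec ℓ k' = wscale c (infVec ℓ k)) :
    k' = k ∨ k + k' = ℓ := by
  have h1 : (1 : ℂ) = c ^ 2 * 1 := congrArg (fun u : WVec r ↦ u.2.2) h
  have h2 : ∀ i, 2 * (k' i : ℂ) - ℓ i = c * (2 * (k i : ℂ) - ℓ i) := fun i ↦
    congrFun (congrArg (fun u : WVec r ↦ u.2.1) h) i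
  rcases mul_self_eq_one_iff.mp (by linear_combination -h1 : c * c = 1) with rfl | rfl
  · left
    funext i
    have : (k' i : ℂ) = k i := by linear_combination h2 i / 2
    exact_mod_cast this
  · right
    funext i
    have : (k i : ℂ) + k' i = ℓ i := by linear_combination h2 i / 2
    exact_mod_cast this

lemma infPoint_eq_mk_infVec (ℓ k : Fin r → ℕ) :
    WP.infPoint (fun i ↦ 2 * (wt ℓ i - (k i : ℂ))) = WP.mk (infVec ℓ k) (infVec_ne_zero ℓ k) := by
  refine (wp_mk_eq_iff _ _).mpr ⟨-1, by norm_num, ?_⟩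
  refine Prod.ext (by simp [infVec, wscale]) (Prod.ext (funext fun i ↦ ?_)
    (by simp [infVec, wscale]))
  simp only [infVec, wscale, Pi.smul_apply, smul_eq_mul]
  linear_combination two_mul_wt ℓ i

section

variable (hn : 0 < n) (hp : ∀ i j, i ≠ j → p i - p j ∉ L.lattice) (hℓ : ∀ i, 0 < ℓ i)
  (hsum : ∑ i, ℓ i = 2 * n)

include hn hp hℓ hsum

lemma TypeI.exists_branch (y : TypeI L p ℓ n) : ∃ b : Branch (projLogFree L p ℓ),
    ∀ k : Fin r → ℕ, y.1.divisor = poleDivisor L p k →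
      b.point = WP.mk (infVec ℓ k) (infVec_ne_zero ℓ k) := by
  obtain ⟨k, hk, hkℓ, hy⟩ := y.exists_divisor_eq hn hp hℓ hsum
  refine ⟨Quotient.mk _ (infBranch hn hp hℓ hsum hk hkℓ), fun k' hk' ↦ ?_⟩
  obtain rfl : k = k' := poleDivisor_injective hp (hy.symm.trans hk')
  exact infBranch_point hn hp hℓ hsum hk hkℓ

omit hn hℓ hsum in
lemma TypeI.rel_iff {y y' : TypeI L p ℓ n} (hy : y.1.divisor = poleDivisor L p k)
    (hy' : y'.1.divisor = poleDivisor L p k') : y.Rel y' ↔ k + k' = ℓ := by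
  rw [TypeI.Rel, hy, hy', poleDivisor_add]
  exact (poleDivisor_injective hp).eq_iff

/-- The correspondence between Type I points and branches. -/
lemma exists_typeIClass_equiv_branch : ∃ Φ : TypeIClass L p ℓ n ≃ Branch (projLogFree L p ℓ),
    ∀ (y : TypeI L p ℓ n) (k : Fin r → ℕ), y.1.divisor = poleDivisor L p k →
      (Φ (Quot.mk _ y)).point = WP.mk (infVec ℓ k) (infVec_ne_zero ℓ k) := by
  choose f hf using fun y : TypeI L p ℓ n ↦ y.exists_branch hn hp hℓ hsum
  -- Both well-definedness and bijectivity reduce to comparing points at infinity, as each carries a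
  -- single branch.
  have hinj := branch_point_injective (L := L) (p := p) hn hp hℓ hsum
  have hrel : ∀ y y' : TypeI L p ℓ n, y.Rel y' → f y = f y' := by
    intro y y' h
    obtain ⟨k, -, -, hy⟩ := y.exists_divisor_eq hn hp hℓ hsum
    obtain ⟨k', -, -, hy'⟩ := y'.exists_divisor_eq hn hp hℓ hsum
    refine hinj ?_
    rw [hf y k hy, hf y' k' hy']
    exact (wp_mk_eq_iff _ _).mpr ⟨-1, by norm_num,
      infVec_eq_wscale_neg_one ((TypeI.rel_iff hp hy hy').mp h)⟩
  refine ⟨Equiv.ofBijective (Quot.lift f hrel) ⟨?_, ?_⟩, fun y k hk ↦ hf y k hk⟩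
  · intro y y' h
    induction y using Quot.ind with | mk y => ?_
    induction y' using Quot.ind with | mk y' => ?_
    obtain ⟨k, -, -, hy⟩ := y.exists_divisor_eq hn hp hℓ hsum
    obtain ⟨k', -, -, hy'⟩ := y'.exists_divisor_eq hn hp hℓ hsum
    have h1 : (f y).point = (f y').point := congrArg Branch.point h
    rw [hf y k hy, hf y' k' hy', wp_mk_eq_iff] at h1
    obtain ⟨c, -, hc⟩ := h1
    rcases eq_or_add_eq_of_infVec hc with rfl | h2
    · rw [TypeI.ext_divisor (hy.trans hy'.symm)]
    · exact Quot.sound ((TypeI.rel_iff hp hy hy').mpr h2)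
  · intro b
    induction b using Quotient.inductionOn with | h b => ?_
    obtain ⟨k, c, hk, hkℓ, hc, hpt⟩ := b.exists_infVec hn hp hℓ hsum
    obtain ⟨y, hy⟩ := exists_typeI (L := L) (p := p) hn hp hℓ hsum hk hkℓ
    refine ⟨Quot.mk _ y, hinj ?_⟩
    change (f y).point = _
    rw [hf y k hy]
    exact (wp_mk_eq_iff _ _).mpr ⟨c, hc, hpt⟩

end

end

end GLame

theorem theorem5p2 (τ : UpperHalfPlane) {r n : ℕ} (hn : 0 < n) (p : Fin r → ℂ)
    (hp : ∀ i j, i ≠ j → p i - p j ∉ (GLame.tauPeriods τ).lattice)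
    (ℓ : Fin r → ℕ) (hℓ : ∀ i, 0 < ℓ i) (hsum : ∑ i, ℓ i = 2 * n) :
    -- the Type I boundary points are the points `a_k`, one for each admissible `k`
    (∀ y : GLame.TypeI (GLame.tauPeriods τ) p ℓ n, ∃ k : Fin r → ℕ,
      ∑ i, k i = n ∧ (∀ i, k i ≤ ℓ i) ∧
        y.1.divisor = GLame.poleDivisor (GLame.tauPeriods τ) p k) ∧
    (∀ k : Fin r → ℕ, ∑ i, k i = n → (∀ i, k i ≤ ℓ i) →
      ∃! y : GLame.TypeI (GLame.tauPeriods τ) p ℓ n,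
        y.1.divisor = GLame.poleDivisor (GLame.tauPeriods τ) p k) ∧
    ∃ Φ : GLame.TypeIClass (GLame.tauPeriods τ) p ℓ n ≃
        GLame.Branch (GLame.projLogFree (GLame.tauPeriods τ) p ℓ),
      -- `Φ` is induced by the natural map: the germ of the curve at a Type I point maps onto
      -- the corresponding branch
      (∀ (y : GLame.TypeI (GLame.tauPeriods τ) p ℓ n)
        (b : GLame.PreBranch (GLame.projLogFree (GLame.tauPeriods τ) p ℓ)),
        Φ (Quot.mk _ y) = Quotient.mk _ b →
          (nhds y.1).lift' (GLame.piImage (GLame.tauPeriods τ) p ℓ n) = b.affineFilter) ∧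
      -- position of the branch of `a_k`
      (∀ (y : GLame.TypeI (GLame.tauPeriods τ) p ℓ n) (k : Fin r → ℕ),
        y.1.divisor = GLame.poleDivisor (GLame.tauPeriods τ) p k →
          (Φ (Quot.mk _ y)).point
            = GLame.WP.infPoint (fun i => 2 * (GLame.wt ℓ i - (k i : ℂ)))) ∧
      -- a self-equivalent point gives the unique branch through the orbifold point
      (∀ y : GLame.TypeI (GLame.tauPeriods τ) p ℓ n, y.Rel y →
        (Φ (Quot.mk _ y)).point = GLame.WP.infPoint 0 ∧
        ∀ b : GLame.Branch (GLame.projLogFree (GLame.tauPeriods τ) p ℓ),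
          b.point = GLame.WP.infPoint 0 → b = Φ (Quot.mk _ y)) := by
  set L := GLame.tauPeriods τ
  obtain ⟨Φ, hΦ⟩ := GLame.exists_typeIClass_equiv_branch (L := L) (p := p) hn hp hℓ hsum
  refine ⟨fun y ↦ y.exists_divisor_eq hn hp hℓ hsum, fun k hk hkℓ ↦ ?_, Φ, fun y b hb ↦ ?_,
    fun y k hy ↦ ?_, fun y hy ↦ ?_⟩
  · obtain ⟨y, hy⟩ := GLame.exists_typeI (L := L) (p := p) hn hp hℓ hsum hk hkℓ
    exact ⟨y, hy, fun y' hy' ↦ GLame.TypeI.ext_divisor (hy'.trans hy.symm)⟩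
  · obtain ⟨k, hk, hkℓ, hy⟩ := y.exists_divisor_eq hn hp hℓ hsum
    have h1 := hΦ y k hy
    rw [hb] at h1
    -- The representative `b` may be centred at any multiple of `infVec ℓ k`; the factor `c` records
    -- which.
    obtain ⟨c, hc, hpt⟩ := (GLame.wp_mk_eq_iff _ b.ne_zero).mp h1.symm
    exact GLame.lift_piImage_eq hn hp hℓ hsum y hk hkℓ hy b hc hpt
  · rw [hΦ y k hy, GLame.infPoint_eq_mk_infVec]
  · obtain ⟨k, hk, hkℓ, hyk⟩ := y.exists_divisor_eq hn hp hℓ hsum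
    -- Self-equivalence makes every coordinate `2k_i - ℓ_i` vanish, so the point at infinity is the
    -- orbifold point.
    have h1 : k + k = ℓ := (GLame.TypeI.rel_iff hp hyk hyk).mp hy
    have h2 : (Φ (Quot.mk _ y)).point = GLame.WP.infPoint 0 := by
      rw [hΦ y k hyk, ← GLame.infPoint_eq_mk_infVec]
      congr 1
      funext i
      have h3 : (k i : ℂ) + k i = ℓ i := by exact_mod_cast congrFun h1 i
      rw [GLame.wt, ← h3, Pi.zero_apply]
      ring
    exact ⟨h2, fun b hb ↦ GLame.branch_point_injective hn hp hℓ hsum (hb.trans h2.symm)⟩
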